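/- Let $G$ be a discrete group with a proper Dirac weight $l\colon G\to\mathbb R$ (that is, $\{g : -n\le l(g)\le n\}$ is finite for every $n\in\mathbb N$, and $x\mapsto l(x)-l(g^{-1}x)$ is bounded for every $g\in G$), let $\alpha$ be an action of $G$ by $*$-automorphisms on a unital $C^*$-algebra $A$, and let $(\mathcal A,H,D,\pi)$ be an odd spectral triple on $A$, with $\mathcal A\subseteq A$ a dense unital $*$-subalgebra. Suppose that the triple is $G$-equivariant: there is a unitary representation $u\colon G\to\mathcal L(H)$ such that $\pi(\alpha_g(a))=u_g\pi(a)u_g^*$, each $u_g$ leaves $\operatorname{Dom}D$ invariant, and each commutator $[D,u_g]$ extends to a bounded operator. Let $A\rtimes_{\alpha,r}G$ be the reduced crossed product, the closed span of the elements $a\delta_g=\hat\rho(a)\hat\lambda_g$ in $\mathcal L(K\otimes\ell^2(G))$ for a faithful representation $\rho$ of $A$ on $K$, where $\hat\rho(a)(\xi\otimes\delta_h)=\rho(\alpha_{h^{-1}}(a))\xi\otimes\delta_h$ and $\hat\lambda_g(\xi\otimes\delta_h)=\xi\otimes\delta_{gh}$. Let $C_c(G,\mathcal A)$ be the $*$-subalgebra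 of $A\rtimes_{\alpha,r}G$ generated by the elements $a\delta_g$ with $a\in\mathcal A$, $g\in G$. On $\widehat H=H\otimes\ell^2(G)\otimes\mathbb C^2$ put $$\widehat D=D\otimes 1\otimes\sigma_1+1\otimes M_l\otimes\sigma_2,\qquad \widehat\chi=1\otimes1\otimes\sigma_3 ,$$ where $M_l$ is multiplication by $l$ and the $\sigma_i$ are the Pauli matrices. Then the following hold. (a) There is a representation $\hat\pi_2\rtimes\hat\Gamma$ of $A\rtimes_{\alpha,r}G$ on $\widehat H$ which on each of the two copies of $H\otimes\ell^2(G)$ is given by $a\delta_g\mapsto\hat\pi_2(a)\hat\Gamma_g$, where $\hat\pi_2(a)(\xi\otimes\delta_h)=\pi(a)\xi\otimes\delta_h$ and $\hat\Gamma_g(\xi\otimes\delta_h)=u_g\xi\otimes\delta_{gh}$, and $(C_c(G,\mathcal A),\widehat H,\widehat D,\hat\pi_2\rtimes\hat\Gamma)$ with the grading $\widehat\chi$ is an even spectral triple on $A\rtimes_{\alpha,r}G$. If $\alpha_g(\mathcal A)\subseteq\mathcal A$ for all $g\in G$, then $C_c(G,\mathcal A)$ is just the set of finite sums $\sum_g a_g\delta_g$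 with $a_g\in\mathcal A$. (b) There is a coaction $\widehat\alpha\colon A\rtimes_{\alpha,r}G\to(A\rtimes_{\alpha,r}G)\otimes C^*_r(G)$ of $G$ (the dual coaction) with $\widehat\alpha(a\delta_g)=a\delta_g\otimes\delta_g$. Here $\otimes$ is the minimal tensor product, and a coaction on a unital $C^*$-algebra $B$ is a unital $*$-homomorphism $\theta\colon B\to B\otimes C^*_r(G)$ such that $(\theta\otimes\mathrm{id})\theta=(\mathrm{id}\otimes\Delta)\theta$, with $\Delta(\delta_g)=\delta_g\otimes\delta_g$, and $\theta(B)(1\otimes C^*_r(G))$ is linearly dense in $B\otimes C^*_r(G)$. (c) The triple of (a) is equivariant with respect to the dual coaction, through the unitary corepresentation $\Theta\colon\widehat H\to\widehat H\otimes C^*_r(G)$ given on each copy of $H\otimes\ell^2(G)$ by $\Theta(\xi\otimes\delta_g)=\xi\otimes\delta_g\otimes\delta_g$. In detail, with the Hilbert $C^*_r(G)$-module $\widehat H\otimes C^*_r(G)$: 1. $(\Theta\otimes\mathrm{id})\Theta=(\mathrm{id}\otimes\Delta)\Theta$, the span of $\Theta(\widehat H)C^*_r(G)$ is dense in $\widehat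 H\otimes C^*_r(G)$, and $\langle\Theta(x)\,|\,\Theta(y)\rangle=\langle x,y\rangle 1$ for all $x,y\in\widehat H$. 2. There is a dense subspace $W\subseteq\widehat H$ that is invariant under $A\rtimes_{\alpha,r}G$, and $\Theta(bx)=\widehat\alpha(b)\Theta(x)$ for all $b\in A\rtimes_{\alpha,r}G$ and $x\in\widehat H$, where $A\rtimes_{\alpha,r}G$ acts through $\hat\pi_2\rtimes\hat\Gamma$ and $(A\rtimes_{\alpha,r}G)\otimes C^*_r(G)$ through $(\hat\pi_2\rtimes\hat\Gamma)\otimes\mathrm{id}$. 3. The map $x\otimes c\mapsto\Theta(x)c$ extends to a unitary operator $U$ on $\widehat H\otimes C^*_r(G)$, which commutes with $\widehat D\otimes1$ and with $\widehat\chi\otimes1$. 4. For every $b\in A\rtimes_{\alpha,r}G$ and every state $\varphi$ of $C^*_r(G)$, the operator $(\mathrm{id}\otimes\varphi)(U(b\otimes1)U^*)$ lies in the bicommutant of the image of $A\rtimes_{\alpha,r}G$ in $\mathcal L(\widehat H)$. -/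

import Mathlib

open scoped InnerProductSpace

noncomputable section

namespace CrossedTriple

/-! ### Spectral triples -/

section Triples

variable {H : Type*} [NormedAddCommGroup H] [InnerProductSpace ℂ H] [CompleteSpace H]

/-- The bounded operator `T` leaves the domain of `D` invariant and the commutator `[D, T]`,
defined on `Dom D`, extends to a bounded operator on `H`. -/
def HasBoundedCommutator (D : H →ₗ.[ℂ] H) (T : H →L[ℂ] H) : Prop :=
  ∃ hT : ∀ x : D.domain, T x ∈ D.domain,
    ∃ C : H →L[ℂ] H, ∀ x : D.domain, D ⟨T x, hT x⟩ - T (D x) = C x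

/-- `R = (1 + D²)^(-1/2)` for a self-adjoint `D`: `R` is the positive bounded operator whose square
inverts `1 + D²`, that is, `R² x ∈ Dom D²` and `(1 + D²) R² x = x` for every `x`
(`1 + D²` is injective, so that a right inverse is the inverse). -/
def IsInvSqrtOneAddSq (D : H →ₗ.[ℂ] H) (R : H →L[ℂ] H) : Prop :=
  R.IsPositive ∧ ∀ x : H, ∃ h₁ : R (R x) ∈ D.domain, ∃ h₂ : D ⟨R (R x), h₁⟩ ∈ D.domain,
    R (R x) + D ⟨D ⟨R (R x), h₁⟩, h₂⟩ = x

/-- `(𝓑, H, D)` is an odd spectral triple on the unital C⋆-algebra `B`, represented by `π`. -/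
structure IsSpectralTriple {B : Type*} [Ring B] [StarRing B] [Algebra ℂ B] [StarModule ℂ B]
    [TopologicalSpace B] (𝓑 : StarSubalgebra ℂ B) (π : B →⋆ₐ[ℂ] (H →L[ℂ] H))
    (D : H →ₗ.[ℂ] H) : Prop where
  dense : Dense (𝓑 : Set B)
  dense_domain : Dense (D.domain : Set H)
  selfAdjoint : IsSelfAdjoint D
  compact : ∃ R : H →L[ℂ] H, IsInvSqrtOneAddSq D R ∧ IsCompactOperator R
  commutator : ∀ b ∈ 𝓑, HasBoundedCommutator D (π b)

/-- `(𝓑, H, D, χ)` is an even spectral triple on `B`, with grading operator `χ`. -/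
structure IsEvenSpectralTriple {B : Type*} [Ring B] [StarRing B] [Algebra ℂ B] [StarModule ℂ B]
    [TopologicalSpace B] (𝓑 : StarSubalgebra ℂ B) (π : B →⋆ₐ[ℂ] (H →L[ℂ] H))
    (D : H →ₗ.[ℂ] H) (χ : H →L[ℂ] H) : Prop extends IsSpectralTriple 𝓑 π D where
  grading_selfAdjoint : IsSelfAdjoint χ
  grading_sq : χ * χ = 1
  grading_comm : ∀ b : B, π b * χ = χ * π b
  grading_anticomm : ∃ hχ : ∀ x : D.domain, χ x ∈ D.domain,
    ∀ x : D.domain, D ⟨χ x, hχ x⟩ = -χ (D x)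

/-- The unitary representation `u` of `G` on `H` makes the triple with Dirac operator `D` and
representation `π` of `A` equivariant for the action `α` of the discrete group `G` on `A`. -/
structure IsGroupEquivariant {A : Type*} [CStarAlgebra A] {G : Type*} [Group G]
    (α : G →* (A ≃⋆ₐ[ℂ] A)) (π : A →⋆ₐ[ℂ] (H →L[ℂ] H)) (D : H →ₗ.[ℂ] H)
    (u : G →* unitary (H →L[ℂ] H)) : Prop where
  covariant : ∀ (g : G) (a : A),
    π (α g a) = (u g : H →L[ℂ] H) * π a * star (u g : H →L[ℂ] H)
  commutator : ∀ g : G, HasBoundedCommutator D (u g : H →L[ℂ] H)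

end Triples

/-! ### Weights -/

/-- A weight is proper if its level sets `{-n ≤ l ≤ n}` are finite. -/
def IsProperWeight {G : Type*} (l : G → ℝ) : Prop :=
  ∀ n : ℕ, {g : G | -(n : ℝ) ≤ l g ∧ l g ≤ n}.Finite

/-- A Dirac weight: all the functions `x ↦ l x - l (g⁻¹ x)` are bounded. -/
def IsDiracWeight {G : Type*} [Group G] (l : G → ℝ) : Prop :=
  ∀ g : G, ∃ C : ℝ, ∀ x : G, |l x - l (g⁻¹ * x)| ≤ C

/-! ### The Hilbert space `X ⊗ ℓ²(G)` and its operators -/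

/-- The Hilbert space tensor product `X ⊗ ℓ²(G)`, realized as `ℓ²(G, X)`: the elementary tensor
`ξ ⊗ η` is the function `h ↦ η h • ξ`. In particular `ℓ²(G) = L2 G ℂ`. -/
abbrev L2 (G : Type*) (X : Type*) [NormedAddCommGroup X] : Type _ := lp (fun _ : G => X) 2

section Operators

variable {G : Type*}
variable {X Y : Type*} [NormedAddCommGroup X] [InnerProductSpace ℂ X]
  [NormedAddCommGroup Y] [InnerProductSpace ℂ Y]

open Classical in
/-- The elementary tensor `ξ ⊗ δ_g`. -/
def deltaVec (g : G) (ξ : X) : L2 G X := lp.single 2 g ξ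

theorem two_toReal_pos : (0 : ℝ) < (2 : ENNReal).toReal := by norm_num

theorem memℓp_diag (T : G → X →L[ℂ] Y) (C : ℝ) (hT : ∀ g, ‖T g‖ ≤ C) (ψ : L2 G X) :
    Memℓp (fun g => T g (ψ g)) 2 := by
  have h : Memℓp (fun g => (C : ℂ) • ψ g) 2 := (lp.memℓp ψ).const_smul (C : ℂ)
  refine memℓp_gen ?_
  refine Summable.of_nonneg_of_le (fun g => by positivity) (fun g => ?_)
    ((memℓp_gen_iff two_toReal_pos).1 h)
  refine Real.rpow_le_rpow (norm_nonneg _) ?_ two_toReal_pos.le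
  have h0 : 0 ≤ C := (norm_nonneg _).trans (hT g)
  rw [norm_smul, Complex.norm_real, Real.norm_of_nonneg h0]
  exact (T g).le_of_opNorm_le (hT g) _

/-- The diagonal operator `(diagOp T ψ) h = T h (ψ h)` of a bounded family of operators. -/
def diagOp (T : G → X →L[ℂ] Y) (hT : ∃ C : ℝ, ∀ g, ‖T g‖ ≤ C) : L2 G X →L[ℂ] L2 G Y :=
  LinearMap.mkContinuousOfExistsBound
    { toFun := fun ψ => ⟨fun g => T g (ψ g), memℓp_diag T hT.choose hT.choose_spec ψ⟩
      map_add' := fun ψ φ => by ext g; exact map_add (T g) (ψ g) (φ g)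
      map_smul' := fun c ψ => by ext g; exact map_smul (T g) c (ψ g) }
    (by
      obtain ⟨C, hC⟩ := hT
      refine ⟨|C|, fun ψ => ?_⟩
      have : ‖((|C| : ℝ) : ℂ) • ψ‖ = |C| * ‖ψ‖ := by
        rw [norm_smul, Complex.norm_real, Real.norm_of_nonneg (abs_nonneg C)]
      rw [← this]
      refine lp.norm_le_of_tsum_le two_toReal_pos (norm_nonneg _) ?_
      rw [lp.norm_rpow_eq_tsum two_toReal_pos]
      refine Summable.tsum_le_tsum (fun g => ?_)
        ((memℓp_gen_iff two_toReal_pos).1 (lp.memℓp _))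
        ((memℓp_gen_iff two_toReal_pos).1 (lp.memℓp _))
      refine Real.rpow_le_rpow (norm_nonneg _) ?_ two_toReal_pos.le
      rw [lp.coeFn_smul, Pi.smul_apply, norm_smul, Complex.norm_real,
        Real.norm_of_nonneg (abs_nonneg C)]
      exact (T g).le_of_opNorm_le ((hC g).trans (le_abs_self C)) _)

@[simp] theorem diagOp_apply (T : G → X →L[ℂ] Y) (hT : ∃ C : ℝ, ∀ g, ‖T g‖ ≤ C)
    (ψ : L2 G X) (h : G) : diagOp T hT ψ h = T h (ψ h) := rfl

/-- The operator `1 ⊗ λ_k` on `X ⊗ ℓ²(G)`, where `λ` is the left regular representation: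
`(1 ⊗ λ_k) (ξ ⊗ δ_h) = ξ ⊗ δ_{kh}`. -/
def translate [Group G] (X : Type*) [NormedAddCommGroup X] [InnerProductSpace ℂ X] (k : G) :
    L2 G X →L[ℂ] L2 G X :=
  LinearMap.mkContinuous
    { toFun := fun ψ => ⟨fun h => ψ (k⁻¹ * h), memℓp_gen <|
          ((Equiv.mulLeft k⁻¹).summable_iff
            (f := fun h => ‖ψ h‖ ^ (2 : ENNReal).toReal)).2
            ((memℓp_gen_iff two_toReal_pos).1 (lp.memℓp ψ))⟩
      map_add' := fun ψ φ => by ext g; rfl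
      map_smul' := fun c ψ => by ext g; rfl } 1 (fun ψ => by
      rw [one_mul]
      refine lp.norm_le_of_tsum_le two_toReal_pos (norm_nonneg _) ?_
      rw [lp.norm_rpow_eq_tsum two_toReal_pos]
      exact ((Equiv.mulLeft k⁻¹).tsum_eq (fun h => ‖ψ h‖ ^ (2 : ENNReal).toReal)).le)

@[simp] theorem translate_apply [Group G] (k : G) (ψ : L2 G X) (h : G) :
    translate X k ψ h = ψ (k⁻¹ * h) := rfl

/-- The operator `T ⊗ 1 : X ⊗ ℓ²(G) → Y ⊗ ℓ²(G)`. -/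
def ampl (G : Type*) (T : X →L[ℂ] Y) : L2 G X →L[ℂ] L2 G Y :=
  diagOp (fun _ : G => T) ⟨‖T‖, fun _ => le_rfl⟩

/-- The operator `T ⊗ λ_g : X ⊗ ℓ²(G) → Y ⊗ ℓ²(G)`, `ξ ⊗ δ_h ↦ T ξ ⊗ δ_{gh}`. -/
def tens [Group G] (T : X →L[ℂ] Y) (g : G) : L2 G X →L[ℂ] L2 G Y :=
  ampl G T ∘L translate X g

/-- The operator `ℓ²(G) → X ⊗ ℓ²(G)`, `η ↦ ξ ⊗ η`. -/
def leftVec (G : Type*) (ξ : X) : L2 G ℂ →L[ℂ] L2 G X :=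
  ampl G (ContinuousLinearMap.toSpanSingleton ℂ ξ)

end Operators

/-! ### The reduced group C⋆-algebra and tensor products with it -/

section Cr

/-- The reduced group C⋆-algebra `C⋆_r(G) ⊆ 𝓛(ℓ²(G))`, the closed ⋆-subalgebra generated by the
left translations `λ_g`. -/
def Cr (G : Type*) [Group G] : StarSubalgebra ℂ (L2 G ℂ →L[ℂ] L2 G ℂ) :=
  (StarAlgebra.adjoin ℂ (Set.range fun g : G => translate ℂ g)).topologicalClosure

variable {G : Type*} [Group G]

/-- The element `λ_g` of `C⋆_r(G)` (written `δ_g` as an element of the group algebra). -/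
def lam (g : G) : Cr G :=
  ⟨translate ℂ g, StarSubalgebra.le_topologicalClosure _
    (StarAlgebra.subset_adjoin ℂ _ ⟨g, rfl⟩)⟩

/-- A state on `C⋆_r(G)`: a positive linear functional with value `1` at the unit. -/
def IsState (φ : Cr G →ₗ[ℂ] ℂ) : Prop :=
  (∀ c : Cr G, 0 ≤ (φ (star c * c)).re ∧ (φ (star c * c)).im = 0) ∧ φ 1 = 1

variable {K : Type*} [NormedAddCommGroup K] [InnerProductSpace ℂ K] [CompleteSpace K]

variable (G) in
/-- The spatial (minimal) tensor product `B ⊗ C⋆_r(G) ⊆ 𝓛(K ⊗ ℓ²(G))` of a C⋆-algebra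
`B ⊆ 𝓛(K)` with `C⋆_r(G)`. It is generated by the operators `b ⊗ λ_g`, as the `λ_g` span a dense
subspace of `C⋆_r(G)`. -/
def tensorCr (B : StarSubalgebra ℂ (K →L[ℂ] K)) :
    StarSubalgebra ℂ (L2 G K →L[ℂ] L2 G K) :=
  (StarAlgebra.adjoin ℂ
    {T : L2 G K →L[ℂ] L2 G K | ∃ b ∈ B, ∃ g : G, T = tens b g}).topologicalClosure

/-- The element `b ⊗ λ_g` of `B ⊗ C⋆_r(G)`. -/
def tensorElem {B : StarSubalgebra ℂ (K →L[ℂ] K)} (b : B) (g : G) : tensorCr G B :=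
  ⟨tens (b : K →L[ℂ] K) g, StarSubalgebra.le_topologicalClosure _
    (StarAlgebra.subset_adjoin ℂ _ ⟨b, b.2, g, rfl⟩)⟩

/-- The unital ⋆-homomorphism `θ : B → B ⊗ C⋆_r(G)` is a coaction of `G` on the unital C⋆-algebra
`B ⊆ 𝓛(K)`. In `coassoc`, `Φ` is `θ ⊗ id` and `Ψ` is `id ⊗ Δ`, where `Δ (λ_g) = λ_g ⊗ λ_g`; both
are maps from `B ⊗ C⋆_r(G)` to `B ⊗ C⋆_r(G) ⊗ C⋆_r(G) ⊆ 𝓛(K ⊗ ℓ²(G) ⊗ ℓ²(G))`, and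
⋆-homomorphisms are determined by their values on the elements `b ⊗ λ_g`. In `dense`, the factor
`1 ⊗ C⋆_r(G)` is the tensor product of the scalars `⊥ = ℂ1` with `C⋆_r(G)`. -/
structure IsCoaction (B : StarSubalgebra ℂ (K →L[ℂ] K)) (θ : B →⋆ₐ[ℂ] tensorCr G B) : Prop where
  coassoc : ∃ Φ Ψ : tensorCr G B →⋆ₐ[ℂ] (L2 G (L2 G K) →L[ℂ] L2 G (L2 G K)),
    (∀ (b : B) (g : G), Φ (tensorElem b g) = tens (θ b : L2 G K →L[ℂ] L2 G K) g) ∧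
    (∀ (b : B) (g : G), Ψ (tensorElem b g) = tens (tens (b : K →L[ℂ] K) g) g) ∧
    ∀ b : B, Φ (θ b) = Ψ (θ b)
  dense : closure (Submodule.span ℂ {T : L2 G K →L[ℂ] L2 G K |
      ∃ (b : B) (c : tensorCr G (⊥ : StarSubalgebra ℂ (K →L[ℂ] K))),
        T = (θ b : L2 G K →L[ℂ] L2 G K) * c} : Set (L2 G K →L[ℂ] L2 G K)) =
    (tensorCr G B : Set (L2 G K →L[ℂ] L2 G K))

end Cr

/-! ### The Hilbert module `X ⊗ C⋆_r(G)` -/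

section HilbertModule

variable {G : Type*} [Group G]
variable {X : Type*} [NormedAddCommGroup X] [InnerProductSpace ℂ X]

variable (G X) in
/-- The exterior tensor product `X ⊗ C⋆_r(G)`, a Hilbert module over `C⋆_r(G)`, realized by
operators from `ℓ²(G)` to `X ⊗ ℓ²(G)`: the elementary tensor `ξ ⊗ c` is the operator
`η ↦ ξ ⊗ c η`. The right action of `c` is `S ↦ S ∘ c`, the `C⋆_r(G)`-valued inner product is
`⟨S | T⟩ = S† ∘ T`, and the norm of the Hilbert module is the operator norm. -/
def hmod : Submodule ℂ (L2 G ℂ →L[ℂ] L2 G X) :=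
  (Submodule.span ℂ {S : L2 G ℂ →L[ℂ] L2 G X |
    ∃ (ξ : X) (c : Cr G), S = leftVec G ξ ∘L (c : L2 G ℂ →L[ℂ] L2 G ℂ)}).topologicalClosure

/-- The elementary tensor `ξ ⊗ c` in `X ⊗ C⋆_r(G)`. -/
def elem (ξ : X) (c : Cr G) : hmod G X :=
  ⟨leftVec G ξ ∘L (c : L2 G ℂ →L[ℂ] L2 G ℂ), Submodule.le_topologicalClosure _
    (Submodule.subset_span ⟨ξ, c, rfl⟩)⟩

theorem ampl_comp_mem (T : X →L[ℂ] X) (S : hmod G X) :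
    ampl G T ∘L (S : L2 G ℂ →L[ℂ] L2 G X) ∈ hmod G X := by
  let F := ContinuousLinearMap.compL ℂ (L2 G ℂ) (L2 G X) (L2 G X) (ampl G T)
  have h : hmod G X ≤ (hmod G X).comap F.toLinearMap := by
    refine Submodule.topologicalClosure_minimal _ (Submodule.span_le.2 ?_)
      ((Submodule.isClosed_topologicalClosure _).preimage F.continuous)
    rintro _ ⟨ξ, c, rfl⟩
    have : F (leftVec G ξ ∘L (c : L2 G ℂ →L[ℂ] L2 G ℂ)) = (elem (T ξ) c : hmod G X) := by
      ext η h
      simp [F, elem, leftVec, ampl]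
    change F (leftVec G ξ ∘L (c : L2 G ℂ →L[ℂ] L2 G ℂ)) ∈ hmod G X
    rw [this]
    exact (elem (T ξ) c : hmod G X).2
  exact h S.2

/-- The operator `T ⊗ 1` on the Hilbert module `X ⊗ C⋆_r(G)`. -/
def modAmpl (T : X →L[ℂ] X) : hmod G X →ₗ[ℂ] hmod G X where
  toFun S := ⟨ampl G T ∘L (S : L2 G ℂ →L[ℂ] L2 G X), ampl_comp_mem T S⟩
  map_add' S S' := by ext1; simp
  map_smul' c S := by ext1; simp

variable (G) in
/-- The graph of the (in general unbounded) operator `D ⊗ 1` on the Hilbert module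
`X ⊗ C⋆_r(G)`: the closure of the graph of `ξ ⊗ c ↦ D ξ ⊗ c` on the algebraic tensor product of
`Dom D` and `C⋆_r(G)`. -/
def amplGraph (D : X →ₗ.[ℂ] X) : Submodule ℂ (hmod G X × hmod G X) :=
  (Submodule.span ℂ {p : hmod G X × hmod G X |
    ∃ (ξ : D.domain) (c : Cr G), p = (elem (ξ : X) c, elem (D ξ) c)}).topologicalClosure

variable [CompleteSpace X]

theorem adjoint_comp_mem (S T : hmod G X) :
    ContinuousLinearMap.adjoint (S : L2 G ℂ →L[ℂ] L2 G X) ∘L (T : L2 G ℂ →L[ℂ] L2 G X) ∈ Cr G := by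
  have key : ∀ R : L2 G ℂ →L[ℂ] L2 G X, (∀ (η : X) (d : Cr G),
      ContinuousLinearMap.adjoint R ∘L (leftVec G η ∘L (d : L2 G ℂ →L[ℂ] L2 G ℂ)) ∈ Cr G) →
      ∀ T : hmod G X, ContinuousLinearMap.adjoint R ∘L (T : L2 G ℂ →L[ℂ] L2 G X) ∈ Cr G := by
    intro R hR T
    let F := ContinuousLinearMap.compL ℂ (L2 G ℂ) (L2 G X) (L2 G ℂ) (ContinuousLinearMap.adjoint R)
    have h : hmod G X ≤ (Subalgebra.toSubmodule (Cr G).toSubalgebra).comap F.toLinearMap := by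
      refine Submodule.topologicalClosure_minimal _ (Submodule.span_le.2 ?_)
        ((StarSubalgebra.isClosed_topologicalClosure _).preimage F.continuous)
      rintro _ ⟨η, d, rfl⟩
      exact hR η d
    exact h T.2
  have hstar : ∀ R R' : L2 G ℂ →L[ℂ] L2 G X, ContinuousLinearMap.adjoint R ∘L R' ∈ Cr G →
      ContinuousLinearMap.adjoint R' ∘L R ∈ Cr G := by
    intro R R' h
    have h' := star_mem h
    rwa [ContinuousLinearMap.star_eq_adjoint, ContinuousLinearMap.adjoint_comp,
      ContinuousLinearMap.adjoint_adjoint] at h'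
  refine key _ (fun η d => hstar _ _ (key _ (fun ξ c => ?_) S)) T
  have hc : ContinuousLinearMap.adjoint (leftVec G η) ∘L leftVec G ξ =
      ⟪η, ξ⟫_ℂ • (1 : L2 G ℂ →L[ℂ] L2 G ℂ) := by
    refine ContinuousLinearMap.ext fun v => ext_inner_left ℂ fun w => ?_
    rw [ContinuousLinearMap.comp_apply, ContinuousLinearMap.adjoint_inner_right,
      lp.inner_eq_tsum, smul_apply, inner_smul_right,
      one_apply_eq_self, lp.inner_eq_tsum, ← tsum_mul_left]
    refine tsum_congr fun h => ?_
    simp only [leftVec, ampl, diagOp_apply, ContinuousLinearMap.toSpanSingleton_apply,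
      inner_smul_left, inner_smul_right, RCLike.inner_apply]
    ring
  have : ContinuousLinearMap.adjoint (leftVec G η ∘L (d : L2 G ℂ →L[ℂ] L2 G ℂ)) ∘L
      (leftVec G ξ ∘L (c : L2 G ℂ →L[ℂ] L2 G ℂ)) =
      ⟪η, ξ⟫_ℂ • (star (d : L2 G ℂ →L[ℂ] L2 G ℂ) * (c : L2 G ℂ →L[ℂ] L2 G ℂ)) := by
    rw [ContinuousLinearMap.adjoint_comp, ContinuousLinearMap.comp_assoc,
      ← ContinuousLinearMap.comp_assoc _ (leftVec G ξ), hc, ContinuousLinearMap.star_eq_adjoint]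
    ext v : 1
    simp
  rw [this]
  exact (Cr G).smul_mem (mul_mem (star_mem d.2) c.2) _

/-- The `C⋆_r(G)`-valued inner product `⟨S | T⟩ = S† ∘ T` on `X ⊗ C⋆_r(G)`; it satisfies
`⟨ξ ⊗ c | η ⊗ d⟩ = ⟪ξ, η⟫ c⋆ d`. -/
def modInner (S T : hmod G X) : Cr G :=
  ⟨ContinuousLinearMap.adjoint (S : L2 G ℂ →L[ℂ] L2 G X) ∘L (T : L2 G ℂ →L[ℂ] L2 G X),
    adjoint_comp_mem S T⟩

/-- The linear map `Θ : X → X ⊗ C⋆_r(G)` is a unitary corepresentation of `G` on `X`. In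
`coassoc`, `Φ` is `Θ ⊗ id` and `Ψ` is `id ⊗ Δ`, where `Δ (λ_g) = λ_g ⊗ λ_g`; both are maps from
`X ⊗ C⋆_r(G)` to `X ⊗ C⋆_r(G) ⊗ C⋆_r(G)`, whose elements are operators from `ℓ²(G) ⊗ ℓ²(G)` to
`X ⊗ ℓ²(G) ⊗ ℓ²(G)`. -/
structure IsUnitaryCorep (Θ : X →ₗ[ℂ] hmod G X) : Prop where
  coassoc : ∃ Φ Ψ : hmod G X →L[ℂ] (L2 G (L2 G ℂ) →L[ℂ] L2 G (L2 G X)),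
    (∀ (ξ : X) (g : G), Φ (elem ξ (lam g)) = tens (Θ ξ : L2 G ℂ →L[ℂ] L2 G X) g) ∧
    (∀ (ξ : X) (g : G), Ψ (elem ξ (lam g)) =
      tens (elem ξ (lam g) : L2 G ℂ →L[ℂ] L2 G X) g) ∧
    ∀ ξ : X, Φ (Θ ξ) = Ψ (Θ ξ)
  dense : closure (Submodule.span ℂ {S : L2 G ℂ →L[ℂ] L2 G X | ∃ (ξ : X) (c : Cr G),
      S = (Θ ξ : L2 G ℂ →L[ℂ] L2 G X) ∘L (c : L2 G ℂ →L[ℂ] L2 G ℂ)} :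
        Set (L2 G ℂ →L[ℂ] L2 G X)) = (hmod G X : Set (L2 G ℂ →L[ℂ] L2 G X))
  isometric : ∀ ξ η : X, modInner (Θ ξ) (Θ η) = ⟪ξ, η⟫_ℂ • (1 : Cr G)

/-- `U` is the operatorial form `ξ ⊗ c ↦ Θ(ξ) c` of the corepresentation `Θ`, as a unitary operator
on the Hilbert module `X ⊗ C⋆_r(G)`. -/
def IsOperatorForm (Θ : X →ₗ[ℂ] hmod G X) (U : hmod G X ≃ₗᵢ[ℂ] hmod G X) : Prop :=
  ∀ (ξ : X) (c : Cr G), (U (elem ξ c) : L2 G ℂ →L[ℂ] L2 G X) =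
    (Θ ξ : L2 G ℂ →L[ℂ] L2 G X) ∘L (c : L2 G ℂ →L[ℂ] L2 G ℂ)

/-- `R = (id ⊗ φ)(T)`, the slice of an operator `T` on `X ⊗ C⋆_r(G)` by a functional `φ` on
`C⋆_r(G)`: the bounded operator on `X` with `⟪ξ, R η⟫ = φ ⟨ξ ⊗ 1 | T (η ⊗ 1)⟩`. -/
def IsSlice (φ : Cr G →ₗ[ℂ] ℂ) (T : hmod G X → hmod G X) (R : X →L[ℂ] X) : Prop :=
  ∀ ξ η : X, ⟪ξ, R η⟫_ℂ = φ (modInner (elem ξ 1) (T (elem η 1)))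

variable {K : Type*} [NormedAddCommGroup K] [InnerProductSpace ℂ K] [CompleteSpace K]

/-- The unitary corepresentation `Θ` on `X` implements the equivariance, for coactions of `G`, of an
even spectral triple on the C⋆-algebra `B ⊆ 𝓛(K)` with coaction `θ`; here `π` is the representation
of `B` on `X`, `D` the Dirac operator and `χ` the grading operator. -/
structure Implements {B : StarSubalgebra ℂ (K →L[ℂ] K)} (θ : B →⋆ₐ[ℂ] tensorCr G B)
    (π : B →⋆ₐ[ℂ] (X →L[ℂ] X)) (D : X →ₗ.[ℂ] X) (χ : X →L[ℂ] X)
    (Θ : X →ₗ[ℂ] hmod G X) : Prop where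
  corep : IsUnitaryCorep Θ
  /-- A dense subspace is an equivariant `B`-module: `Θ (b ▷ x) = θ b ▷ Θ x`, where
  `B ⊗ C⋆_r(G)` acts on `X ⊗ C⋆_r(G)` through `Φ = π ⊗ id`. -/
  equivariant : ∃ W : Submodule ℂ X, Dense (W : Set X) ∧ (∀ b : B, ∀ x ∈ W, π b x ∈ W) ∧
    ∃ Φ : tensorCr G B →⋆ₐ[ℂ] (L2 G X →L[ℂ] L2 G X),
      (∀ (b : B) (g : G), Φ (tensorElem b g) = tens (π b) g) ∧
      ∀ (b : B) (x : X), (Θ (π b x) : L2 G ℂ →L[ℂ] L2 G X) =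
        Φ (θ b) ∘L (Θ x : L2 G ℂ →L[ℂ] L2 G X)
  /-- The operatorial form `U` of `Θ` commutes with `D ⊗ 1` (it maps the graph of `D ⊗ 1` onto
  itself) and with `χ ⊗ 1`, and the slices of `Ad_U (b) = U (π b ⊗ 1) U⋆` by states lie in the
  bicommutant of `B`. -/
  operator : ∃ U : hmod G X ≃ₗᵢ[ℂ] hmod G X, IsOperatorForm Θ U ∧
    (∀ S T : hmod G X, (U S, U T) ∈ amplGraph G D ↔ (S, T) ∈ amplGraph G D) ∧
    (∀ S : hmod G X, U (modAmpl χ S) = modAmpl χ (U S)) ∧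
    ∀ (b : B) (φ : Cr G →ₗ[ℂ] ℂ), IsState φ →
      ∃ R ∈ Set.centralizer (Set.centralizer (Set.range π)),
        IsSlice φ (fun S => U (modAmpl (π b) (U.symm S))) R

end HilbertModule

/-! ### The reduced crossed product -/

section CrossedProduct

variable {A : Type*} [CStarAlgebra A] {G : Type*} [Group G]
variable {K : Type*} [NormedAddCommGroup K] [InnerProductSpace ℂ K] [CompleteSpace K]

/-- The operator `ρ̂(a)` on `K ⊗ ℓ²(G)`, `ρ̂(a) (ξ ⊗ δ_h) = ρ(α_{h⁻¹}(a)) ξ ⊗ δ_h`. -/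
def regA (α : G →* (A ≃⋆ₐ[ℂ] A)) (ρ : A →⋆ₐ[ℂ] (K →L[ℂ] K)) (a : A) : L2 G K →L[ℂ] L2 G K :=
  diagOp (fun h : G => ρ (α h⁻¹ a)) ⟨‖a‖, fun h =>
    (NonUnitalStarAlgHom.norm_apply_le ρ _).trans (NonUnitalStarAlgHom.norm_apply_le (α h⁻¹) a)⟩

/-- The reduced crossed product of `A` by `G`, as a C⋆-algebra of operators on `K ⊗ ℓ²(G)`: the
closed ⋆-subalgebra generated by the operators `a δ_g = ρ̂(a) λ̂_g`, for a faithful representation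
`ρ` of `A` on `K`. (As a C⋆-algebra it does not depend on the choice of `ρ`.) -/
def crossed (α : G →* (A ≃⋆ₐ[ℂ] A)) (ρ : A →⋆ₐ[ℂ] (K →L[ℂ] K)) :
    StarSubalgebra ℂ (L2 G K →L[ℂ] L2 G K) :=
  (StarAlgebra.adjoin ℂ {T : L2 G K →L[ℂ] L2 G K |
    ∃ (a : A) (g : G), T = regA α ρ a ∘L translate K g}).topologicalClosure

/-- The element `a δ_g` of the reduced crossed product. -/
def crossedElem (α : G →* (A ≃⋆ₐ[ℂ] A)) (ρ : A →⋆ₐ[ℂ] (K →L[ℂ] K)) (a : A) (g : G) :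
    crossed α ρ :=
  ⟨regA α ρ a ∘L translate K g, StarSubalgebra.le_topologicalClosure _
    (StarAlgebra.subset_adjoin ℂ _ ⟨a, g, rfl⟩)⟩

/-- The space `C_c(G, 𝒜)` of the finite sums `∑ a_g δ_g` with coefficients in `𝒜`. -/
def ccSpace (α : G →* (A ≃⋆ₐ[ℂ] A)) (ρ : A →⋆ₐ[ℂ] (K →L[ℂ] K)) (𝒜 : StarSubalgebra ℂ A) :
    Submodule ℂ (crossed α ρ) :=
  Submodule.span ℂ {x | ∃ a ∈ 𝒜, ∃ g : G, x = crossedElem α ρ a g}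

/-- The ⋆-algebra generated by `C_c(G, 𝒜)` in the reduced crossed product. It equals `C_c(G, 𝒜)`
when `𝒜` is invariant under the action, that is, when `C_c(G, 𝒜)` is a ⋆-algebra. -/
def ccAlgebra (α : G →* (A ≃⋆ₐ[ℂ] A)) (ρ : A →⋆ₐ[ℂ] (K →L[ℂ] K)) (𝒜 : StarSubalgebra ℂ A) :
    StarSubalgebra ℂ (crossed α ρ) :=
  StarAlgebra.adjoin ℂ (ccSpace α ρ 𝒜 : Set (crossed α ρ))

end CrossedProduct

/-! ### The Hilbert space, Dirac operator and grading of the triple on the crossed product -/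

section Dual

variable {H : Type*} [NormedAddCommGroup H] [InnerProductSpace ℂ H]

/-- The Hilbert space `H ⊗ ℂ²`. -/
abbrev Dbl (H : Type*) : Type _ := WithLp 2 (H × H)

/-- The Hilbert space `H ⊗ ℂ² ⊗ ℓ²(G)`. -/
abbrev Hhat (G : Type*) (H : Type*) [NormedAddCommGroup H] : Type _ := L2 G (Dbl H)

/-- The operator `T ⊕ T'` on `H ⊗ ℂ² = H ⊕ H`. -/
def dsum (T T' : H →L[ℂ] H) : Dbl H →L[ℂ] Dbl H :=
  (WithLp.prodContinuousLinearEquiv 2 ℂ H H).symm.toContinuousLinearMap ∘L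
    (T.prodMap T') ∘L (WithLp.prodContinuousLinearEquiv 2 ℂ H H).toContinuousLinearMap

/-- Two copies of the operator `π̂₂(a) = π(a) ⊗ 1`. -/
def pi2Hat {A : Type*} [CStarAlgebra A] [CompleteSpace H] (G : Type*)
    (π : A →⋆ₐ[ℂ] (H →L[ℂ] H)) (a : A) : Hhat G H →L[ℂ] Hhat G H :=
  ampl G (dsum (π a) (π a))

/-- Two copies of the operator `Γ̂_g = u_g ⊗ λ_g`, `ξ ⊗ δ_h ↦ u_g ξ ⊗ δ_{gh}`. -/
def gammaHat {G : Type*} [Group G] [CompleteSpace H] (u : G →* unitary (H →L[ℂ] H)) (g : G) :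
    Hhat G H →L[ℂ] Hhat G H :=
  tens (dsum (u g : H →L[ℂ] H) (u g : H →L[ℂ] H)) g

/-- The operator `D ⊗ σ₁ + t ⊗ σ₂` on `H ⊕ H`, with domain `Dom D ⊕ Dom D`:
`(x, y) ↦ (D y - i t y, D x + i t x)`. -/
def fiberDirac (D : H →ₗ.[ℂ] H) (t : ℝ) : Dbl H →ₗ.[ℂ] Dbl H where
  domain := (D.domain.prod D.domain).comap (WithLp.linearEquiv 2 ℂ (H × H)).toLinearMap
  toFun :=
    { toFun := fun x => WithLp.toLp 2
        (D ⟨(x : Dbl H).snd, x.2.2⟩ - (Complex.I * t) • (x : Dbl H).snd,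
          D ⟨(x : Dbl H).fst, x.2.1⟩ + (Complex.I * t) • (x : Dbl H).fst)
      map_add' := fun x y => by
        have h₁ : D ⟨((x + y : _) : Dbl H).fst, (x + y).2.1⟩ =
            D ⟨(x : Dbl H).fst, x.2.1⟩ + D ⟨(y : Dbl H).fst, y.2.1⟩ :=
          D.map_add ⟨(x : Dbl H).fst, x.2.1⟩ ⟨(y : Dbl H).fst, y.2.1⟩
        have h₂ : D ⟨((x + y : _) : Dbl H).snd, (x + y).2.2⟩ =
            D ⟨(x : Dbl H).snd, x.2.2⟩ + D ⟨(y : Dbl H).snd, y.2.2⟩ :=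
          D.map_add ⟨(x : Dbl H).snd, x.2.2⟩ ⟨(y : Dbl H).snd, y.2.2⟩
        rw [h₁, h₂, ← WithLp.toLp_add, Prod.mk_add_mk]
        congr 2
        · simp only [Submodule.coe_add, WithLp.add_snd, smul_add]; abel
        · simp only [Submodule.coe_add, WithLp.add_fst, smul_add]; abel
      map_smul' := fun c x => by
        have h₁ : D ⟨((c • x : _) : Dbl H).fst, (c • x).2.1⟩ =
            c • D ⟨(x : Dbl H).fst, x.2.1⟩ :=
          D.map_smul c ⟨(x : Dbl H).fst, x.2.1⟩
        have h₂ : D ⟨((c • x : _) : Dbl H).snd, (c • x).2.2⟩ =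
            c • D ⟨(x : Dbl H).snd, x.2.2⟩ :=
          D.map_smul c ⟨(x : Dbl H).snd, x.2.2⟩
        rw [h₁, h₂, RingHom.id_apply, ← WithLp.toLp_smul, Prod.smul_mk]
        congr 2
        · simp only [Submodule.coe_smul, WithLp.smul_snd, smul_sub, smul_comm c]
        · simp only [Submodule.coe_smul, WithLp.smul_fst, smul_add, smul_comm c] }

/-- The Dirac operator `D̂ = D ⊗ 1 ⊗ σ₁ + 1 ⊗ M_l ⊗ σ₂`. On the subspace
`H ⊗ ℂ² ⊗ δ_g` it is the operator `D_g = D ⊗ σ₁ + l(g) ⊗ σ₂`, and `D̂` is the Hilbert sum of the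
operators `D_g`: its domain consists of the `ψ` with `ψ g ∈ Dom D_g` for every `g` and
`∑ ‖D_g (ψ g)‖² < ∞`. -/
def Dhat {G : Type*} (l : G → ℝ) (D : H →ₗ.[ℂ] H) : Hhat G H →ₗ.[ℂ] Hhat G H where
  domain :=
    { carrier := {ψ | ∃ hψ : ∀ g, ψ g ∈ (fiberDirac D (l g)).domain,
        Memℓp (fun g => fiberDirac D (l g) ⟨ψ g, hψ g⟩) 2}
      add_mem' := fun {ψ φ} ⟨h, hm⟩ ⟨h', hm'⟩ => ⟨fun g => add_mem (h g) (h' g), by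
        convert hm.add hm' using 1
        funext g
        exact (fiberDirac D (l g)).map_add ⟨ψ g, h g⟩ ⟨φ g, h' g⟩⟩
      zero_mem' := ⟨fun g => zero_mem _, by
        convert (zero_memℓp : Memℓp (fun _ : G => (0 : Dbl H)) 2) using 1
        funext g
        exact (fiberDirac D (l g)).map_zero⟩
      smul_mem' := fun c {ψ} ⟨h, hm⟩ => ⟨fun g => Submodule.smul_mem _ c (h g), by
        convert hm.const_smul c using 1
        funext g
        exact (fiberDirac D (l g)).map_smul c ⟨ψ g, h g⟩⟩ }
  toFun :=
    { toFun := fun ψ => ⟨fun g => fiberDirac D (l g) ⟨(ψ : Hhat G H) g, ψ.2.choose g⟩,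
        ψ.2.choose_spec⟩
      map_add' := fun ψ φ => by
        ext1
        funext g
        exact (fiberDirac D (l g)).map_add ⟨(ψ : Hhat G H) g, ψ.2.choose g⟩
          ⟨(φ : Hhat G H) g, φ.2.choose g⟩
      map_smul' := fun c ψ => by
        ext1
        funext g
        exact (fiberDirac D (l g)).map_smul c ⟨(ψ : Hhat G H) g, ψ.2.choose g⟩ }

/-- The grading operator `χ̂ = 1 ⊗ 1 ⊗ σ₃`. -/
def chiHat (G H : Type*) [NormedAddCommGroup H] [InnerProductSpace ℂ H] :
    Hhat G H →L[ℂ] Hhat G H :=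
  ampl G (dsum 1 (-1))

end Dual

end CrossedTriple

end

open scoped InnerProductSpace

noncomputable section

set_option linter.unusedSectionVars false

namespace CrossedTriple

/-! ### Operators on `X ⊗ ℓ²(G)` -/

section LTwo

variable {G : Type*}
variable {X Y Z : Type*} [NormedAddCommGroup X] [InnerProductSpace ℂ X]
  [NormedAddCommGroup Y] [InnerProductSpace ℂ Y] [NormedAddCommGroup Z] [InnerProductSpace ℂ Z]

/-! Part (a), representation. The diagonal unitary `V = ⊕ u_h` conjugates the regular representation
built from `π` into the operators `π(a) u_g ⊗ λ_g`, so it suffices that the regular representation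
of any `π` factors through the crossed product formed with the faithful `ρ`. Finite sums of
generators have the same `A`-valued matrix in both pictures. A finite compression is the image of a
matrix over `A`; a faithful representation of the C⋆-algebra of such matrices is isometric and any
other is contractive, so norms can only decrease (`norm_le_of_matrix`). An estimate on generated
⋆-algebras extends to the closures (`exists_starAlgHom_of_norm_le`).

Part (a), Dirac operator. `D̂` is the Hilbert sum of `D_g = D ⊗ σ₁ + l(g) ⊗ σ₂`. As `σ₁` and `σ₂`
anticommute, `D_g² = (D² + l(g)²) ⊗ 1`, hence `(1 + D̂²)^(-1/2)` is the direct sum of the compact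
operators `(1 + l(g)² + D²)^(-1/2)`, doubled. Their norms are at most `1/|l(g)|` when `l(g) ≠ 0`, so
properness of `l` makes the sum compact (`exists_invSqrt_Dhat`). The commutator of `D̂` with `S ⊗
λ_g` is `[D, S] ⊗ σ₁ ⊗ λ_g` plus a `σ₂`-term with coefficients `l(h) - l(g⁻¹h)`, bounded because `l`
is a Dirac weight (`hasBoundedCommutator_tens`).

Parts (b) and (c) come from the multiplicative unitary `W : ξ ⊗ δ_h ⊗ δ_k ↦ ξ ⊗ δ_h ⊗ δ_{hk}`: the
coaction is `b ↦ W (b ⊗ 1) W⋆`, the corepresentation is `Θ ξ = W (ξ ⊗ 1)`, and `U` is composition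
with `W`. Equivariance is then `W (b ⊗ 1) = (W (b ⊗ 1) W⋆) W`. On the fibre over `δ_g`, `W` is just
`λ_g` in the last leg, while `D̂` and `χ̂` are diagonal in `g` and do not touch that leg; hence they
commute with `U`. Finally `W (σ(b) ⊗ 1) W⋆` is a limit of sums of operators `σ(a δ_g) ⊗ λ_g`, so it
commutes with `c ⊗ 1` for every `c` in the commutant, and its slices lie in the bicommutant.

In iterated spaces such as `L2 G (L2 G X)` the outer index belongs to the last tensor factor. -/

theorem L2.ext {ψ φ : L2 G X} (h : ∀ g, ψ g = φ g) : ψ = φ := lp.ext (funext h)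

theorem memℓp_two_iff {f : G → X} : Memℓp f 2 ↔ Summable fun g => ‖f g‖ ^ 2 := by
  rw [memℓp_gen_iff two_toReal_pos]
  simp

theorem L2.summable (ψ : L2 G X) : Summable fun g => ‖ψ g‖ ^ 2 :=
  memℓp_two_iff.1 (lp.memℓp ψ)

theorem L2.norm_sq (ψ : L2 G X) : ‖ψ‖ ^ 2 = ∑' g, ‖ψ g‖ ^ 2 := by
  have := lp.norm_rpow_eq_tsum two_toReal_pos ψ
  simpa using this

theorem L2.norm_le_of_forall_le {ψ : L2 G X} {φ : L2 G Y} {C : ℝ} (hC : 0 ≤ C)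
    (h : ∀ g, ‖ψ g‖ ≤ C * ‖φ g‖) : ‖ψ‖ ≤ C * ‖φ‖ := by
  refine le_of_sq_le_sq ?_ (by positivity)
  rw [mul_pow, L2.norm_sq, L2.norm_sq, ← tsum_mul_left]
  refine Summable.tsum_le_tsum (fun g => ?_) (L2.summable ψ) ((L2.summable φ).mul_left _)
  rw [← mul_pow]
  exact pow_le_pow_left₀ (norm_nonneg _) (h g) 2

theorem memℓp_two_of_le {f : G → X} {C : ℝ} {φ : L2 G Y} (h : ∀ g, ‖f g‖ ≤ C * ‖φ g‖) :
    Memℓp f 2 := by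
  refine memℓp_two_iff.2 (Summable.of_nonneg_of_le (fun g => by positivity) (fun g => ?_)
    ((L2.summable φ).mul_left (C ^ 2)))
  rw [← mul_pow]
  exact pow_le_pow_left₀ (norm_nonneg _) (h g) 2

theorem diagOp_norm_le (T : G → X →L[ℂ] Y) (hT : ∃ C : ℝ, ∀ g, ‖T g‖ ≤ C) {C : ℝ} (hC : 0 ≤ C)
    (h : ∀ g, ‖T g‖ ≤ C) : ‖diagOp T hT‖ ≤ C :=
  ContinuousLinearMap.opNorm_le_bound _ hC fun _ =>
    L2.norm_le_of_forall_le hC fun g => (T g).le_of_opNorm_le (h g) _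

@[simp] theorem ampl_apply (T : X →L[ℂ] Y) (ψ : L2 G X) (h : G) : ampl G T ψ h = T (ψ h) := rfl

@[simp] theorem leftVec_apply (ξ : X) (η : L2 G ℂ) (h : G) : leftVec G ξ η h = η h • ξ := rfl

@[simp] theorem tens_apply [Group G] (T : X →L[ℂ] Y) (g : G) (ψ : L2 G X) (h : G) :
    tens T g ψ h = T (ψ (g⁻¹ * h)) := rfl

theorem ampl_norm_le (T : X →L[ℂ] Y) : ‖ampl G T‖ ≤ ‖T‖ :=
  diagOp_norm_le _ _ (norm_nonneg _) fun _ => le_rfl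

variable (G X Y) in
/-- The amplification `T ↦ T ⊗ 1` as a continuous linear map. -/
def amplL : (X →L[ℂ] Y) →L[ℂ] (L2 G X →L[ℂ] L2 G Y) :=
  LinearMap.mkContinuous
    { toFun := fun T : X →L[ℂ] Y => ampl G T
      map_add' := fun T S => by ext ψ : 1; exact L2.ext fun g => rfl
      map_smul' := fun c T => by ext ψ : 1; exact L2.ext fun g => rfl } 1 fun T => by
    rw [one_mul]; exact ampl_norm_le T

theorem translate_one [Group G] : translate X (1 : G) = 1 := by
  ext ψ : 1; exact L2.ext fun g => by simp

theorem translate_comp [Group G] (g k : G) :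
    translate X g ∘L translate X k = translate X (g * k) := by
  ext ψ : 1; exact L2.ext fun h => by simp [mul_assoc]

theorem tens_comp [Group G] (S : Y →L[ℂ] Z) (T : X →L[ℂ] Y) (g k : G) :
    tens S g ∘L tens T k = tens (S ∘L T) (g * k) := by
  ext ψ : 1; exact L2.ext fun h => by simp [mul_assoc]

theorem tens_mul [Group G] (S T : X →L[ℂ] X) (g k : G) :
    tens S g * tens T k = tens (S * T) (g * k) := tens_comp S T g k

theorem tens_one [Group G] : tens (1 : X →L[ℂ] X) (1 : G) = 1 := by
  ext ψ : 1; exact L2.ext fun h => by simp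

variable (X Y) in
/-- The map `T ↦ T ⊗ λ_g` as a continuous linear map. -/
def tensL [Group G] (g : G) : (X →L[ℂ] Y) →L[ℂ] (L2 G X →L[ℂ] L2 G Y) :=
  (ContinuousLinearMap.compL ℂ (L2 G X) (L2 G X) (L2 G Y)).flip (translate X g) ∘L amplL G X Y

theorem leftVec_norm_le (ξ : X) : ‖leftVec G ξ‖ ≤ ‖ξ‖ :=
  (ampl_norm_le _).trans (by simp)

variable (G X) in
/-- The map `ξ ↦ (η ↦ ξ ⊗ η)` as a continuous linear map. -/
def leftVecL : X →L[ℂ] (L2 G ℂ →L[ℂ] L2 G X) :=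
  LinearMap.mkContinuous
    { toFun := fun ξ : X => leftVec G ξ
      map_add' := fun T S => by ext ψ : 1; exact L2.ext fun g => by simp
      map_smul' := fun c T => by
        ext ψ : 1; exact L2.ext fun g => by simp [smul_comm c] } 1 fun T => by
    rw [one_mul]; exact leftVec_norm_le T

theorem ampl_comp_leftVec (T : X →L[ℂ] Y) (ξ : X) :
    ampl G T ∘L leftVec G ξ = leftVec G (T ξ) := by
  ext ψ : 1; exact L2.ext fun h => by simp

open Classical in
theorem deltaVec_apply (g : G) (ξ : X) (h : G) : deltaVec g ξ h = if h = g then ξ else 0 := by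
  simp [deltaVec, Pi.single_apply]

theorem deltaVec_self (g : G) (ξ : X) : deltaVec g ξ g = ξ := by simp [deltaVec_apply]

theorem deltaVec_ne {g h : G} (hg : h ≠ g) (ξ : X) : deltaVec g ξ h = 0 := by
  simp [deltaVec_apply, hg]

variable (X) in
open Classical in
/-- The isometry `ξ ↦ ξ ⊗ δ_g`. -/
def deltaL (g : G) : X →L[ℂ] L2 G X := lp.singleContinuousLinearMap ℂ (fun _ : G => X) 2 g

@[simp] theorem deltaL_apply (g : G) (ξ : X) : deltaL X g ξ = deltaVec g ξ := rfl

theorem hasSum_deltaVec (ψ : L2 G X) : HasSum (fun g => deltaVec g (ψ g)) ψ := by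
  classical
  simpa [deltaVec] using lp.hasSum_single (by norm_num) ψ

theorem sum_deltaVec_apply (F : Finset G) (f : G → X) [DecidableEq G] (h : G) :
    (∑ g ∈ F, deltaVec g (f g) : L2 G X) h = if h ∈ F then f h else 0 := by
  rw [lp.coeFn_sum, Finset.sum_apply]
  by_cases hF : h ∈ F
  · rw [if_pos hF, Finset.sum_eq_single_of_mem h hF, deltaVec_self]
    intro g _ hg
    exact deltaVec_ne hg.symm _
  · rw [if_neg hF]
    exact Finset.sum_eq_zero fun g hg => deltaVec_ne (ne_of_mem_of_not_mem hg hF).symm _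

theorem L2.hom_ext {E : Type*} [NormedAddCommGroup E] [NormedSpace ℂ E] {S T : L2 G X →L[ℂ] E}
    (h : ∀ g ξ, S (deltaVec g ξ) = T (deltaVec g ξ)) : S = T := by
  ext ψ : 1
  have h₁ := S.hasSum (hasSum_deltaVec ψ)
  have h₂ := T.hasSum (hasSum_deltaVec ψ)
  simp only [h] at h₁
  exact h₁.unique h₂

/-- A closed subspace that contains the elementary tensors `ξ ⊗ δ_g` is everything. -/
theorem L2.induction {p : L2 G X → Prop} (hc : IsClosed {ψ | p ψ}) (h0 : p 0)
    (hadd : ∀ ψ φ, p ψ → p φ → p (ψ + φ)) (hδ : ∀ g ξ, p (deltaVec g ξ)) (ψ : L2 G X) : p ψ := by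
  classical
  refine hc.mem_of_tendsto (hasSum_deltaVec ψ) (Filter.Eventually.of_forall fun F => ?_)
  change p _
  induction F using Finset.induction with
  | empty => simpa using h0
  | insert g F hg ih => rw [Finset.sum_insert hg]; exact hadd _ _ (hδ _ _) ih

/-! #### Permutations of the double index set -/

theorem L2.summable_prod (ψ : L2 G (L2 G X)) : Summable fun p : G × G => ‖ψ p.1 p.2‖ ^ 2 := by
  rw [summable_prod_of_nonneg (fun p => by positivity)]
  refine ⟨fun k => L2.summable (ψ k), ?_⟩
  simp_rw [← L2.norm_sq]
  exact L2.summable ψ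

theorem L2.norm_sq_prod (ψ : L2 G (L2 G X)) : ‖ψ‖ ^ 2 = ∑' p : G × G, ‖ψ p.1 p.2‖ ^ 2 := by
  rw [(L2.summable_prod ψ).tsum_prod, L2.norm_sq]
  simp_rw [← L2.norm_sq]

/-- An element of `X ⊗ ℓ²(G) ⊗ ℓ²(G)` from a square summable family. -/
def ofProd (f : G × G → X) (hf : Summable fun p => ‖f p‖ ^ 2) : L2 G (L2 G X) :=
  ⟨fun k => ⟨fun h => f (k, h), memℓp_two_iff.2
      (((summable_prod_of_nonneg (fun p => by positivity)).1 hf).1 k)⟩, by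
    refine memℓp_two_iff.2 ?_
    simp_rw [L2.norm_sq]
    exact ((summable_prod_of_nonneg (fun p => by positivity)).1 hf).2⟩

@[simp] theorem ofProd_apply (f : G × G → X) (hf : Summable fun p => ‖f p‖ ^ 2) (k h : G) :
    ofProd f hf k h = f (k, h) := rfl

variable (X) in
/-- The unitary operator on `X ⊗ ℓ²(G) ⊗ ℓ²(G)` given by a permutation of `G × G`. -/
def reindex (e : G × G ≃ G × G) : L2 G (L2 G X) ≃ₗᵢ[ℂ] L2 G (L2 G X) where
  toFun ψ := ofProd (fun p => ψ (e p).1 (e p).2) ((e.summable_iff).2 (L2.summable_prod ψ))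
  invFun ψ := ofProd (fun p => ψ (e.symm p).1 (e.symm p).2)
    ((e.symm.summable_iff).2 (L2.summable_prod ψ))
  left_inv ψ := L2.ext fun k => L2.ext fun h => by simp
  right_inv ψ := L2.ext fun k => L2.ext fun h => by simp
  map_add' ψ φ := L2.ext fun k => L2.ext fun h => by simp
  map_smul' c ψ := L2.ext fun k => L2.ext fun h => by simp
  norm_map' ψ := by
    rw [← sq_eq_sq₀ (norm_nonneg _) (norm_nonneg _), L2.norm_sq_prod, L2.norm_sq_prod]
    exact e.tsum_eq fun p => ‖ψ p.1 p.2‖ ^ 2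

@[simp] theorem reindex_apply (e : G × G ≃ G × G) (ψ : L2 G (L2 G X)) (k h : G) :
    reindex X e ψ k h = ψ (e (k, h)).1 (e (k, h)).2 := rfl

@[simp] theorem reindex_symm_apply (e : G × G ≃ G × G) (ψ : L2 G (L2 G X)) (k h : G) :
    (reindex X e).symm ψ k h = ψ (e.symm (k, h)).1 (e.symm (k, h)).2 := rfl

variable (G X) in
/-- The flip of the two factors `ℓ²(G)`. -/
def flipU : L2 G (L2 G X) ≃ₗᵢ[ℂ] L2 G (L2 G X) := reindex X (Equiv.prodComm G G)

/-- The permutation `(k, h) ↦ (h⁻¹ k, h)`. -/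
def shear (G : Type*) [Group G] : G × G ≃ G × G where
  toFun p := (p.2⁻¹ * p.1, p.2)
  invFun p := (p.2 * p.1, p.2)
  left_inv p := by simp
  right_inv p := by simp

variable (G X) in
/-- The multiplicative unitary `ξ ⊗ δ_h ⊗ δ_k ↦ ξ ⊗ δ_h ⊗ δ_{hk}`. -/
def mulU [Group G] : L2 G (L2 G X) ≃ₗᵢ[ℂ] L2 G (L2 G X) := reindex X (shear G)

@[simp] theorem mulU_apply [Group G] (ψ : L2 G (L2 G X)) (k h : G) :
    mulU G X ψ k h = ψ (h⁻¹ * k) h := rfl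
@[simp] theorem mulU_symm_apply [Group G] (ψ : L2 G (L2 G X)) (k h : G) :
    (mulU G X).symm ψ k h = ψ (h * k) h := rfl

/-- The diagonal unitary given by a family of unitaries. -/
def diagEquiv (e : G → X ≃ₗᵢ[ℂ] Y) : L2 G X ≃ₗᵢ[ℂ] L2 G Y where
  toFun ψ := ⟨fun g => e g (ψ g), memℓp_two_iff.2 (by simpa using L2.summable ψ)⟩
  invFun ψ := ⟨fun g => (e g).symm (ψ g), memℓp_two_iff.2 (by simpa using L2.summable ψ)⟩
  left_inv ψ := L2.ext fun g => by simp
  right_inv ψ := L2.ext fun g => by simp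
  map_add' ψ φ := L2.ext fun g => map_add (e g) _ _
  map_smul' c ψ := L2.ext fun g => map_smul (e g) _ _
  norm_map' ψ := by
    rw [← sq_eq_sq₀ (norm_nonneg _) (norm_nonneg _), L2.norm_sq, L2.norm_sq]
    simp

@[simp] theorem diagEquiv_apply (e : G → X ≃ₗᵢ[ℂ] Y) (ψ : L2 G X) (g : G) :
    diagEquiv e ψ g = e g (ψ g) := rfl
@[simp] theorem diagEquiv_symm_apply (e : G → X ≃ₗᵢ[ℂ] Y) (ψ : L2 G Y) (g : G) :
    (diagEquiv e).symm ψ g = (e g).symm (ψ g) := rfl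

/-- The unitary `e ⊗ 1`. -/
def amplEquiv (G : Type*) (e : X ≃ₗᵢ[ℂ] Y) : L2 G X ≃ₗᵢ[ℂ] L2 G Y := diagEquiv fun _ => e

/-! #### Adjoints -/

section Adjoint

variable [CompleteSpace X] [CompleteSpace Y]

theorem adjoint_diagOp (T : G → X →L[ℂ] Y) (hT : ∃ C : ℝ, ∀ g, ‖T g‖ ≤ C)
    (hT' : ∃ C : ℝ, ∀ g, ‖ContinuousLinearMap.adjoint (T g)‖ ≤ C) :
    ContinuousLinearMap.adjoint (diagOp T hT) =
      diagOp (fun g => ContinuousLinearMap.adjoint (T g)) hT' := by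
  symm
  rw [ContinuousLinearMap.eq_adjoint_iff]
  intro ψ φ
  rw [lp.inner_eq_tsum, lp.inner_eq_tsum]
  simp [ContinuousLinearMap.adjoint_inner_left]

theorem adjoint_ampl (T : X →L[ℂ] Y) :
    ContinuousLinearMap.adjoint (ampl G T) = ampl G (ContinuousLinearMap.adjoint T) :=
  adjoint_diagOp _ _ _

theorem adjoint_translate [Group G] (g : G) :
    ContinuousLinearMap.adjoint (translate X g) = translate X g⁻¹ := by
  symm
  rw [ContinuousLinearMap.eq_adjoint_iff]
  intro ψ φ
  rw [lp.inner_eq_tsum, lp.inner_eq_tsum]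
  refine ((Equiv.mulLeft g⁻¹).tsum_eq _).symm.trans ?_
  simp

theorem star_translate [Group G] (g : G) : star (translate X g) = translate X g⁻¹ :=
  adjoint_translate g

theorem star_ampl (T : X →L[ℂ] X) : star (ampl G T) = ampl G (star T) := adjoint_ampl T

theorem star_tens [Group G] (T : X →L[ℂ] X) (g : G) : star (tens T g) = tens (star T) g⁻¹ := by
  have : tens T g = ampl G T * translate X g := rfl
  rw [this, star_mul, star_translate, star_ampl]
  rfl

variable (G X) in
/-- The amplification `T ↦ T ⊗ 1` as a ⋆-homomorphism. -/
def amplHom : (X →L[ℂ] X) →⋆ₐ[ℂ] (L2 G X →L[ℂ] L2 G X) where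
  toFun T := ampl G T
  map_one' := rfl
  map_mul' _ _ := rfl
  map_zero' := rfl
  map_add' _ _ := rfl
  commutes' _ := rfl
  map_star' T := (star_ampl T).symm

theorem adjoint_leftVec_comp (η ξ : X) :
    ContinuousLinearMap.adjoint (leftVec G η) ∘L leftVec G ξ =
      ⟪η, ξ⟫_ℂ • (1 : L2 G ℂ →L[ℂ] L2 G ℂ) := by
  refine ContinuousLinearMap.ext fun v => ext_inner_left ℂ fun w => ?_
  rw [ContinuousLinearMap.comp_apply, ContinuousLinearMap.adjoint_inner_right,
    lp.inner_eq_tsum, smul_apply, inner_smul_right,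
    one_apply_eq_self, lp.inner_eq_tsum, ← tsum_mul_left]
  refine tsum_congr fun h => ?_
  simp only [leftVec_apply, inner_smul_left, inner_smul_right, RCLike.inner_apply]
  ring

end Adjoint

end LTwo

/-! ### Generated ⋆-algebras -/

section Adjoin

/-- By bilinearity and antilinearity the hypotheses on generators pass to the span, which is then
itself a unital ⋆-algebra. This lets elements of generated algebras be treated as linear
combinations of explicit operators. -/
theorem adjoin_toSubmodule_eq_span {R : Type*} [Ring R] [StarRing R] [Algebra ℂ R]
    [StarModule ℂ R] {s : Set R} (h1 : (1 : R) ∈ Submodule.span ℂ s)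
    (hmul : ∀ a ∈ s, ∀ b ∈ s, a * b ∈ Submodule.span ℂ s)
    (hstar : ∀ a ∈ s, star a ∈ Submodule.span ℂ s) :
    Subalgebra.toSubmodule (StarAlgebra.adjoin ℂ s).toSubalgebra = Submodule.span ℂ s := by
  have hmul' : ∀ a ∈ Submodule.span ℂ s, ∀ b ∈ Submodule.span ℂ s,
      a * b ∈ Submodule.span ℂ s := by
    intro a ha b hb
    have h := Submodule.mul_mem_mul ha hb
    rw [Submodule.span_mul_span] at h
    refine Submodule.span_le.2 ?_ h
    rintro _ ⟨x, hx, y, hy, rfl⟩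
    exact hmul x hx y hy
  have hstar' : ∀ a ∈ Submodule.span ℂ s, star a ∈ Submodule.span ℂ s := by
    intro a ha
    induction ha using Submodule.span_induction with
    | mem x hx => exact hstar x hx
    | zero => rw [star_zero]; exact zero_mem _
    | add x y _ _ hx hy => rw [star_add]; exact add_mem hx hy
    | smul c x _ hx => rw [star_smul]; exact Submodule.smul_mem _ _ hx
  refine le_antisymm (fun x hx => ?_) (Submodule.span_le.2 (StarAlgebra.subset_adjoin ℂ s))
  have hx' : x ∈ StarAlgebra.adjoin ℂ s := hx
  clear hx
  induction hx' using StarAlgebra.adjoin_induction with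
  | mem x hx => exact Submodule.subset_span hx
  | algebraMap r => rw [Algebra.algebraMap_eq_smul_one]; exact Submodule.smul_mem _ _ h1
  | add x y _ _ hx hy => exact add_mem hx hy
  | mul x y _ _ hx hy => exact hmul' _ hx _ hy
  | star x _ hx => exact hstar' _ hx

/-- A correspondence `x i ↦ y i` of generators that decreases norms on the generated ⋆-algebras
extends to the closed ⋆-algebra generated by the `x i`. -/
theorem exists_starAlgHom_of_norm_le {A₁ A₂ ι : Type*} [CStarAlgebra A₁] [CStarAlgebra A₂]
    (x : ι → A₁) (y : ι → A₂)
    (h : ∀ z ∈ StarAlgebra.adjoin ℂ (Set.range fun i => (x i, y i)), ‖z.2‖ ≤ ‖z.1‖)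
    (C : StarSubalgebra ℂ A₁) (hC : C = (StarAlgebra.adjoin ℂ (Set.range x)).topologicalClosure) :
    ∃ φ : C →⋆ₐ[ℂ] A₂, ∀ i (hi : x i ∈ C), φ ⟨x i, hi⟩ = y i := by
  -- The homomorphism is obtained from its graph `Z`, a closed ⋆-subalgebra of `A₁ × A₂` on which
  -- the norm estimate persists; the estimate applied to differences makes `Z` single-valued.
  let S := StarAlgebra.adjoin ℂ (Set.range fun i => (x i, y i))
  let Z := S.topologicalClosure
  have hZ : ∀ z ∈ Z, ‖z.2‖ ≤ ‖z.1‖ := by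
    intro z hz
    have hcl : IsClosed {z : A₁ × A₂ | ‖z.2‖ ≤ ‖z.1‖} :=
      isClosed_le continuous_snd.norm continuous_fst.norm
    exact closure_minimal (s := (S : Set (A₁ × A₂))) h hcl hz
  have huniq : ∀ z ∈ Z, ∀ w ∈ Z, z.1 = w.1 → z.2 = w.2 := by
    intro z hz w hw hzw
    have := hZ _ (sub_mem hz hw)
    rw [Prod.fst_sub, Prod.snd_sub, hzw, sub_self, norm_zero] at this
    exact sub_eq_zero.1 (norm_le_zero_iff.1 this)
  -- The product carries the maximum norm, so the first projection is isometric on `Z`; its image is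
  -- complete, hence closed, and therefore contains all of `C`.
  have hclosed : IsClosed (Prod.fst '' (Z : Set (A₁ × A₂))) := by
    have hcomp : IsComplete (Z : Set (A₁ × A₂)) :=
      (StarSubalgebra.isClosed_topologicalClosure S).isComplete
    have hiso : Isometry (fun z : Z => (z : A₁ × A₂).1) := by
      refine Isometry.of_dist_eq fun z w => ?_
      rw [Subtype.dist_eq, dist_eq_norm, dist_eq_norm, ← Prod.fst_sub, Prod.norm_def,
        max_eq_left (hZ _ (sub_mem z.2 w.2))]
    have : CompleteSpace Z := hcomp.completeSpace_coe
    have h' := hiso.isClosedEmbedding.isClosed_range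
    convert h' using 1
    ext a
    simp
  have hsurj : ∀ c ∈ C, ∃ z ∈ Z, z.1 = c := by
    intro c hc
    rw [hC] at hc
    refine closure_minimal (s := (StarAlgebra.adjoin ℂ (Set.range x) : Set A₁)) ?_ hclosed hc
    intro a ha
    have hle : StarAlgebra.adjoin ℂ (Set.range x) ≤ S.map (StarAlgHom.fst ℂ A₁ A₂) := by
      refine StarAlgebra.adjoin_le ?_
      rintro _ ⟨i, rfl⟩
      exact ⟨(x i, y i), StarAlgebra.subset_adjoin ℂ _ ⟨i, rfl⟩, rfl⟩
    obtain ⟨z, hz, hza⟩ := hle ha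
    exact ⟨z, StarSubalgebra.le_topologicalClosure _ hz, hza⟩
  choose f hf hf1 using fun c : C => hsurj c c.2
  -- Single-valuedness: any pair in `Z` over `c` computes the value at `c`. Each homomorphism axiom
  -- follows by naming such a pair.
  have key : ∀ z ∈ Z, ∀ c : C, z.1 = c → (f c).2 = z.2 := fun z hz c hzc =>
    huniq _ (hf c) _ hz ((hf1 c).trans hzc.symm)
  refine ⟨{ toFun := fun c => (f c).2
            map_one' := key 1 (one_mem _) _ rfl
            map_mul' := fun c d => key (f c * f d) (mul_mem (hf c) (hf d)) _ (by simp [hf1])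
            map_zero' := key 0 (zero_mem _) _ rfl
            map_add' := fun c d => key (f c + f d) (add_mem (hf c) (hf d)) _ (by simp [hf1])
            commutes' := fun r => key (algebraMap ℂ _ r) (algebraMap_mem _ r) _ rfl
            map_star' := fun c => key (star (f c)) (star_mem (hf c)) _ (by simp [hf1]) },
    fun i hi => ?_⟩
  exact key (x i, y i) (StarSubalgebra.le_topologicalClosure _
    (StarAlgebra.subset_adjoin ℂ _ ⟨i, rfl⟩)) _ rfl

end Adjoin

/-! ### Comparison of norms of operator matrices -/

section MatrixNorm

variable {A : Type*} [CStarAlgebra A] {G : Type*}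
variable {K H : Type*} [NormedAddCommGroup K] [InnerProductSpace ℂ K] [CompleteSpace K]
  [NormedAddCommGroup H] [InnerProductSpace ℂ H] [CompleteSpace H]

theorem inner_deltaVec_left (g : G) (ξ : K) (ψ : L2 G K) : ⟪deltaVec g ξ, ψ⟫_ℂ = ⟪ξ, ψ g⟫_ℂ := by
  classical
  rw [lp.inner_eq_tsum, tsum_eq_single g]
  · rw [deltaVec_self]
  · intro h hh
    rw [deltaVec_ne hh, inner_zero_left]

variable (G K) in
/-- Evaluation at `g` as a bounded operator. -/
def evalL (g : G) : L2 G K →L[ℂ] K := lp.evalCLM ℂ (fun _ : G => K) 2 g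

@[simp] theorem evalL_apply (g : G) (ψ : L2 G K) : evalL G K g ψ = ψ g := rfl

/-- The operator with matrix `M` over a finite index set. -/
def matOp {F : Type*} [Fintype F] (ρ : A →⋆ₐ[ℂ] (K →L[ℂ] K)) (M : CStarMatrix F F A) :
    L2 F K →L[ℂ] L2 F K :=
  ∑ i, ∑ j, deltaL K i ∘L ρ (M i j) ∘L evalL F K j

theorem matOp_apply {F : Type*} [Fintype F] (ρ : A →⋆ₐ[ℂ] (K →L[ℂ] K)) (M : CStarMatrix F F A)
    (ψ : L2 F K) (i : F) : matOp ρ M ψ i = ∑ j, ρ (M i j) (ψ j) := by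
  classical
  have : matOp ρ M ψ = ∑ i, deltaVec i (∑ j, ρ (M i j) (ψ j)) := by
    simp only [matOp, sum_apply, ContinuousLinearMap.comp_apply, evalL_apply,
      deltaL_apply]
    refine Finset.sum_congr rfl fun i _ => ?_
    rw [← deltaL_apply, map_sum]
    rfl
  rw [this, sum_deltaVec_apply, if_pos (Finset.mem_univ i)]

/-- The representation of the matrix algebra over `A` that is induced by `ρ`. -/
def matRep {F : Type*} [Fintype F] [DecidableEq F] (ρ : A →⋆ₐ[ℂ] (K →L[ℂ] K)) :
    CStarMatrix F F A →⋆ₐ[ℂ] (L2 F K →L[ℂ] L2 F K) where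
  toFun := matOp ρ
  map_one' := by
    ext ψ : 1
    refine L2.ext fun i => ?_
    rw [matOp_apply, Finset.sum_eq_single i]
    · simp [CStarMatrix.one_apply_eq]
    · intro j _ hj
      simp [CStarMatrix.one_apply_ne hj.symm]
    · simp
  map_mul' M N := by
    ext ψ : 1
    refine L2.ext fun i => ?_
    rw [mul_apply_eq_comp, matOp_apply, matOp_apply]
    simp only [matOp_apply, CStarMatrix.mul_apply, map_sum, map_mul,
      sum_apply, mul_apply_eq_comp]
    exact Finset.sum_comm
  map_zero' := by
    ext ψ : 1
    exact L2.ext fun i => by simp [matOp_apply]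
  map_add' M N := by
    ext ψ : 1
    exact L2.ext fun i => by simp [matOp_apply, Finset.sum_add_distrib]
  commutes' r := by
    ext ψ : 1
    refine L2.ext fun i => ?_
    rw [matOp_apply, Finset.sum_eq_single i]
    · simp [CStarMatrix.algebraMap_apply, Algebra.algebraMap_eq_smul_one]
    · intro j _ hj
      simp [CStarMatrix.algebraMap_apply, hj.symm]
    · simp
  map_star' M := by
    rw [ContinuousLinearMap.star_eq_adjoint, ContinuousLinearMap.eq_adjoint_iff]
    intro ψ φ
    rw [lp.inner_eq_tsum, lp.inner_eq_tsum, tsum_fintype, tsum_fintype]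
    simp only [matOp_apply, sum_inner, inner_sum, CStarMatrix.star_apply, map_star,
      ContinuousLinearMap.star_eq_adjoint, ContinuousLinearMap.adjoint_inner_left]
    exact Finset.sum_comm

theorem matRep_apply {F : Type*} [Fintype F] [DecidableEq F] (ρ : A →⋆ₐ[ℂ] (K →L[ℂ] K))
    (M : CStarMatrix F F A) (ψ : L2 F K) (i : F) : matRep ρ M ψ i = ∑ j, ρ (M i j) (ψ j) :=
  matOp_apply ρ M ψ i

theorem matRep_deltaVec {F : Type*} [Fintype F] [DecidableEq F] (ρ : A →⋆ₐ[ℂ] (K →L[ℂ] K))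
    (M : CStarMatrix F F A) (i j : F) (ξ : K) : matRep ρ M (deltaVec j ξ) i = ρ (M i j) ξ := by
  rw [matRep_apply, Finset.sum_eq_single j]
  · rw [deltaVec_self]
  · intro k _ hk
    rw [deltaVec_ne hk, map_zero]
  · simp

theorem matRep_injective {F : Type*} [Fintype F] [DecidableEq F] (ρ : A →⋆ₐ[ℂ] (K →L[ℂ] K))
    (hρ : Function.Injective ρ) : Function.Injective (matRep (F := F) ρ) := by
  intro M N h
  ext i j
  refine hρ (ContinuousLinearMap.ext fun ξ => ?_)
  rw [← matRep_deltaVec, ← matRep_deltaVec, h]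

variable (K) in
/-- Restriction of functions to a finite set. -/
def restrictL (F : Finset G) : L2 G K →L[ℂ] L2 F K :=
  LinearMap.mkContinuous
    { toFun := fun ψ => ⟨fun i => ψ i, Memℓp.all _⟩
      map_add' := fun _ _ => rfl
      map_smul' := fun _ _ => rfl } 1 fun ψ => by
    rw [one_mul]
    refine le_of_sq_le_sq ?_ (norm_nonneg _)
    rw [L2.norm_sq, L2.norm_sq, tsum_fintype]
    refine le_trans (le_of_eq ?_) ((L2.summable ψ).sum_le_tsum F fun _ _ => by positivity)
    exact Finset.sum_coe_sort F fun i => ‖ψ i‖ ^ 2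

@[simp] theorem restrictL_apply (F : Finset G) (ψ : L2 G K) (i : F) :
    restrictL K F ψ i = ψ i := rfl

theorem norm_restrictL_le (F : Finset G) : ‖restrictL K F‖ ≤ 1 :=
  LinearMap.mkContinuous_norm_le _ zero_le_one _

theorem adjoint_restrictL_deltaVec (F : Finset G) (i : F) (ξ : K) :
    ContinuousLinearMap.adjoint (restrictL K F) (deltaVec i ξ) = deltaVec (i : G) ξ := by
  refine ext_inner_right ℂ fun ψ => ?_
  rw [ContinuousLinearMap.adjoint_inner_left, inner_deltaVec_left, inner_deltaVec_left,
    restrictL_apply]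

theorem adjoint_restrictL_restrictL (F : Finset G) (ψ : L2 G K) :
    ContinuousLinearMap.adjoint (restrictL K F) (restrictL K F ψ) =
      ∑ g ∈ F, deltaVec g (ψ g) := by
  refine ext_inner_right ℂ fun φ => ?_
  rw [ContinuousLinearMap.adjoint_inner_left, sum_inner, lp.inner_eq_tsum, tsum_fintype]
  simp only [inner_deltaVec_left, restrictL_apply]
  exact Finset.sum_coe_sort F fun i => ⟪ψ i, φ i⟫_ℂ

/-- Operators whose finite compressions are bounded by `C` are bounded by `C`. -/
theorem norm_le_of_compression_le (T : L2 G K →L[ℂ] L2 G K) {C : ℝ} (hC : 0 ≤ C)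
    (h : ∀ F : Finset G,
      ‖restrictL K F ∘L T ∘L ContinuousLinearMap.adjoint (restrictL K F)‖ ≤ C) : ‖T‖ ≤ C := by
  classical
  -- The finite coordinate projections converge strongly to the identity, so matrix coefficients of
  -- `T` are limits of those of its compressions; at the end `φ = T ψ` is inserted.
  have hlim : ∀ ψ : L2 G K, Filter.Tendsto (fun F : Finset G =>
      ContinuousLinearMap.adjoint (restrictL K F) (restrictL K F ψ)) Filter.atTop (nhds ψ) := by
    intro ψ
    simp_rw [adjoint_restrictL_restrictL]
    exact hasSum_deltaVec ψ
  have hle : ∀ φ ψ : L2 G K, ‖⟪φ, T ψ⟫_ℂ‖ ≤ C * ‖φ‖ * ‖ψ‖ := by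
    intro φ ψ
    refine le_of_tendsto ((((hlim φ).inner ((T.continuous.tendsto ψ).comp (hlim ψ)))).norm)
      (Filter.Eventually.of_forall fun F => ?_)
    have hn : ∀ χ : L2 G K, ‖restrictL K F χ‖ ≤ ‖χ‖ := fun χ => by
      simpa using (restrictL K F).le_of_opNorm_le (norm_restrictL_le F) χ
    rw [ContinuousLinearMap.adjoint_inner_left]
    refine (norm_inner_le_norm _ _).trans ?_
    have h2 := (restrictL K F ∘L T ∘L ContinuousLinearMap.adjoint (restrictL K F)).le_of_opNorm_le
      (h F) (restrictL K F ψ)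
    calc _ ≤ ‖φ‖ * (C * ‖restrictL K F ψ‖) := by gcongr; exacts [hn φ, h2]
      _ ≤ ‖φ‖ * (C * ‖ψ‖) := by gcongr; exact hn ψ
      _ = _ := by ring
  refine T.opNorm_le_bound hC fun ψ => ?_
  have := hle (T ψ) ψ
  rw [inner_self_eq_norm_sq_to_K] at this
  by_cases h0 : ‖T ψ‖ = 0
  · rw [h0]; positivity
  · have hpos : 0 < ‖T ψ‖ := lt_of_le_of_ne (norm_nonneg _) (Ne.symm h0)
    rw [norm_pow] at this
    have h3 : ‖T ψ‖ ^ 2 ≤ C * ‖T ψ‖ * ‖ψ‖ := by simpa using this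
    nlinarith

/-- Over a finite `F` both compressions represent one matrix `M` with entries in `A`. The
representation induced by the faithful `ρ` preserves `‖M‖`, the one induced by `π` does not increase
it. -/
theorem norm_le_of_matrix (ρ : A →⋆ₐ[ℂ] (K →L[ℂ] K)) (hρ : Function.Injective ρ)
    (π : A →⋆ₐ[ℂ] (H →L[ℂ] H)) (T : L2 G K →L[ℂ] L2 G K) (S : L2 G H →L[ℂ] L2 G H)
    (m : G → G → A) (hT : ∀ g h ξ, T (deltaVec h ξ) g = ρ (m g h) ξ)
    (hS : ∀ g h ξ, S (deltaVec h ξ) g = π (m g h) ξ) : ‖S‖ ≤ ‖T‖ := by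
  classical
  refine norm_le_of_compression_le S (norm_nonneg _) fun F => ?_
  let M : CStarMatrix F F A := CStarMatrix.ofMatrix (Matrix.of fun i j => m i j)
  have h₁ : restrictL K F ∘L T ∘L ContinuousLinearMap.adjoint (restrictL K F) = matRep ρ M := by
    refine L2.hom_ext fun j ξ => L2.ext fun i => ?_
    rw [matRep_deltaVec]
    simp only [ContinuousLinearMap.comp_apply, adjoint_restrictL_deltaVec, restrictL_apply, hT]
    rfl
  have h₂ : restrictL H F ∘L S ∘L ContinuousLinearMap.adjoint (restrictL H F) = matRep π M := by
    refine L2.hom_ext fun j ξ => L2.ext fun i => ?_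
    rw [matRep_deltaVec]
    simp only [ContinuousLinearMap.comp_apply, adjoint_restrictL_deltaVec, restrictL_apply, hS]
    rfl
  -- An auxiliary choice: the C⋆-structure on matrices over `A` refers to an order on `A`.
  let := CStarAlgebra.spectralOrder A
  have := CStarAlgebra.spectralOrderedRing A
  rw [h₂]
  calc ‖matRep π M‖ ≤ ‖M‖ := NonUnitalStarAlgHom.norm_apply_le _ _
    _ = ‖matRep ρ M‖ := (NonUnitalStarAlgHom.norm_map (matRep ρ) (matRep_injective ρ hρ) M).symm
    _ ≤ ‖T‖ := by
      rw [← h₁]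
      refine (ContinuousLinearMap.opNorm_comp_le _ _).trans ?_
      refine (mul_le_mul (norm_restrictL_le F) (ContinuousLinearMap.opNorm_comp_le _ _)
        (norm_nonneg _) zero_le_one).trans ?_
      rw [one_mul, LinearIsometryEquiv.norm_map]
      exact mul_le_of_le_one_right (norm_nonneg _) (norm_restrictL_le F)

end MatrixNorm

/-! ### The generators of the reduced crossed product -/

section CrossedOp

variable {A : Type*} [CStarAlgebra A] {G : Type*} [Group G]
variable {K H : Type*} [NormedAddCommGroup K] [InnerProductSpace ℂ K] [CompleteSpace K]
  [NormedAddCommGroup H] [InnerProductSpace ℂ H] [CompleteSpace H]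

/-- The operator `ρ̂(a) λ̂_g`. -/
def crossedOp (α : G →* (A ≃⋆ₐ[ℂ] A)) (ρ : A →⋆ₐ[ℂ] (K →L[ℂ] K)) (a : A) (g : G) :
    L2 G K →L[ℂ] L2 G K := regA α ρ a ∘L translate K g

@[simp] theorem crossedOp_apply (α : G →* (A ≃⋆ₐ[ℂ] A)) (ρ : A →⋆ₐ[ℂ] (K →L[ℂ] K)) (a : A)
    (g : G) (ψ : L2 G K) (k : G) : crossedOp α ρ a g ψ k = ρ (α k⁻¹ a) (ψ (g⁻¹ * k)) := rfl

theorem crossedOp_one (α : G →* (A ≃⋆ₐ[ℂ] A)) (ρ : A →⋆ₐ[ℂ] (K →L[ℂ] K)) :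
    crossedOp α ρ 1 1 = 1 := by
  ext ψ : 1
  exact L2.ext fun k => by simp

theorem crossedOp_mul (α : G →* (A ≃⋆ₐ[ℂ] A)) (ρ : A →⋆ₐ[ℂ] (K →L[ℂ] K)) (a b : A) (g h : G) :
    crossedOp α ρ a g * crossedOp α ρ b h = crossedOp α ρ (a * α g b) (g * h) := by
  ext ψ : 1
  exact L2.ext fun k => by simp [mul_assoc]

theorem star_crossedOp (α : G →* (A ≃⋆ₐ[ℂ] A)) (ρ : A →⋆ₐ[ℂ] (K →L[ℂ] K)) (a : A) (g : G) :
    star (crossedOp α ρ a g) = crossedOp α ρ (α g⁻¹ (star a)) g⁻¹ := by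
  have h1 : ∀ k, ContinuousLinearMap.adjoint (ρ (α k⁻¹ a)) = ρ (α k⁻¹ (star a)) := fun k => by
    rw [← ContinuousLinearMap.star_eq_adjoint, ← map_star, ← map_star]
  have h2 : star (regA α ρ a) = regA α ρ (star a) := by
    rw [ContinuousLinearMap.star_eq_adjoint, regA, adjoint_diagOp]
    · ext ψ : 1
      exact L2.ext fun k => DFunLike.congr_fun (h1 k) (ψ k)
    · obtain ⟨C, hC⟩ : ∃ C : ℝ, ∀ h : G, ‖ρ (α h⁻¹ a)‖ ≤ C := ⟨‖a‖, fun h =>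
        (NonUnitalStarAlgHom.norm_apply_le ρ _).trans
          (NonUnitalStarAlgHom.norm_apply_le (α h⁻¹) a)⟩
      exact ⟨C, fun h => by rw [LinearIsometryEquiv.norm_map]; exact hC h⟩
  have h3 : crossedOp α ρ a g = regA α ρ a * translate K g := rfl
  rw [h3, star_mul, h2, star_translate]
  ext ψ : 1
  exact L2.ext fun k => by simp [regA]

theorem crossedOp_deltaVec (α : G →* (A ≃⋆ₐ[ℂ] A)) (ρ : A →⋆ₐ[ℂ] (K →L[ℂ] K)) (a : A) (g h k : G)
    [DecidableEq G] (ξ : K) :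
    crossedOp α ρ a g (deltaVec h ξ) k = ρ (if g⁻¹ * k = h then α k⁻¹ a else 0) ξ := by
  rw [crossedOp_apply]
  split_ifs with hk
  · rw [hk, deltaVec_self]
  · rw [deltaVec_ne hk, map_zero, map_zero, zero_apply]

/-- The pairs of generators multiply and star by the same covariance rules in both components, so
the generated ⋆-algebra is their span. Having a common `A`-valued matrix holds for generators and is
a linear condition. -/
theorem norm_le_of_mem_adjoin_crossedOp (α : G →* (A ≃⋆ₐ[ℂ] A)) (ρ : A →⋆ₐ[ℂ] (K →L[ℂ] K))
    (hρ : Function.Injective ρ) (π : A →⋆ₐ[ℂ] (H →L[ℂ] H))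
    (z : (L2 G K →L[ℂ] L2 G K) × (L2 G H →L[ℂ] L2 G H))
    (hz : z ∈ StarAlgebra.adjoin ℂ (Set.range fun p : A × G =>
      (crossedOp α ρ p.1 p.2, crossedOp α π p.1 p.2))) : ‖z.2‖ ≤ ‖z.1‖ := by
  classical
  have hspan := adjoin_toSubmodule_eq_span (s := Set.range fun p : A × G =>
      (crossedOp α ρ p.1 p.2, crossedOp α π p.1 p.2))
    (Submodule.subset_span ⟨(1, 1), by simp only [crossedOp_one]; rfl⟩)
    (by
      rintro _ ⟨⟨a, g⟩, rfl⟩ _ ⟨⟨b, h⟩, rfl⟩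
      refine Submodule.subset_span ⟨(a * α g b, g * h), ?_⟩
      simp only [Prod.mk_mul_mk, crossedOp_mul])
    (by
      rintro _ ⟨⟨a, g⟩, rfl⟩
      refine Submodule.subset_span ⟨(α g⁻¹ (star a), g⁻¹), ?_⟩
      simp only [← star_crossedOp]
      rfl)
  have hz' : z ∈ Submodule.span ℂ (Set.range fun p : A × G =>
      (crossedOp α ρ p.1 p.2, crossedOp α π p.1 p.2)) := by
    rw [← hspan]
    exact hz
  suffices h : ∃ m : G → G → A, (∀ g h ξ, z.1 (deltaVec h ξ) g = ρ (m g h) ξ) ∧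
      ∀ g h ξ, z.2 (deltaVec h ξ) g = π (m g h) ξ by
    obtain ⟨m, h₁, h₂⟩ := h
    exact norm_le_of_matrix ρ hρ π _ _ m h₁ h₂
  clear hz hspan
  induction hz' using Submodule.span_induction with
  | mem z hz =>
    obtain ⟨⟨a, g⟩, rfl⟩ := hz
    exact ⟨fun k h => if g⁻¹ * k = h then α k⁻¹ a else 0,
      fun k h ξ => crossedOp_deltaVec α ρ a g h k ξ, fun k h ξ => crossedOp_deltaVec α π a g h k ξ⟩
  | zero => exact ⟨0, by simp, by simp⟩
  | add z w _ _ hz hw =>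
    obtain ⟨m, h₁, h₂⟩ := hz
    obtain ⟨n, h₃, h₄⟩ := hw
    exact ⟨m + n, fun g h ξ => by simp [h₁, h₃], fun g h ξ => by simp [h₂, h₄]⟩
  | smul c z _ hz =>
    obtain ⟨m, h₁, h₂⟩ := hz
    exact ⟨c • m, fun g h ξ => by simp [h₁], fun g h ξ => by simp [h₂]⟩

theorem crossed_eq (α : G →* (A ≃⋆ₐ[ℂ] A)) (ρ : A →⋆ₐ[ℂ] (K →L[ℂ] K)) :
    crossed α ρ = (StarAlgebra.adjoin ℂ
      (Set.range fun p : A × G => crossedOp α ρ p.1 p.2)).topologicalClosure := by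
  rw [crossed]
  congr 2
  ext T
  constructor
  · rintro ⟨a, g, rfl⟩; exact ⟨(a, g), rfl⟩
  · rintro ⟨⟨a, g⟩, rfl⟩; exact ⟨a, g, rfl⟩

/-- The reduced crossed product, formed with a faithful representation `ρ`, is represented on
`H ⊗ ℓ²(G)` for every representation `π` of `A` on `H`. -/
theorem exists_crossed_hom (α : G →* (A ≃⋆ₐ[ℂ] A)) (ρ : A →⋆ₐ[ℂ] (K →L[ℂ] K))
    (hρ : Function.Injective ρ) (π : A →⋆ₐ[ℂ] (H →L[ℂ] H)) :
    ∃ φ : crossed α ρ →⋆ₐ[ℂ] (L2 G H →L[ℂ] L2 G H),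
      ∀ a g, φ (crossedElem α ρ a g) = crossedOp α π a g := by
  obtain ⟨φ, hφ⟩ := exists_starAlgHom_of_norm_le
    (fun p : A × G => crossedOp α ρ p.1 p.2) (fun p : A × G => crossedOp α π p.1 p.2)
    (norm_le_of_mem_adjoin_crossedOp α ρ hρ π) _ (crossed_eq α ρ)
  exact ⟨φ, fun a g => hφ (a, g) _⟩

/-! ### Tensor products with `C⋆_r(G)`, as crossed products by the trivial action. -/

variable (G) in
theorem tensorCr_eq (B : StarSubalgebra ℂ (K →L[ℂ] K)) :
    tensorCr G B = (StarAlgebra.adjoin ℂ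
      (Set.range fun p : B × G => tens (p.1 : K →L[ℂ] K) p.2)).topologicalClosure := by
  rw [tensorCr]
  congr 2
  ext T
  constructor
  · rintro ⟨b, hb, g, rfl⟩; exact ⟨(⟨b, hb⟩, g), rfl⟩
  · rintro ⟨⟨b, g⟩, rfl⟩; exact ⟨b, b.2, g, rfl⟩

/-- The ⋆-homomorphism `σ ⊗ id` on the spatial tensor product with `C⋆_r(G)`. -/
theorem exists_tensorCr_hom (B : StarSubalgebra ℂ (K →L[ℂ] K)) (hB : IsClosed (B : Set (K →L[ℂ] K)))
    (σ : B →⋆ₐ[ℂ] (H →L[ℂ] H)) :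
    ∃ Φ : tensorCr G B →⋆ₐ[ℂ] (L2 G H →L[ℂ] L2 G H),
      ∀ b g, Φ (tensorElem b g) = tens (σ b) g := by
  have := hB
  -- For the trivial action `b δ_g` is the operator `b ⊗ λ_g`, so the norm comparison for crossed
  -- products applies, with the inclusion of `B` as the faithful representation.
  obtain ⟨Φ, hΦ⟩ := exists_starAlgHom_of_norm_le
    (fun p : B × G => crossedOp (1 : G →* (B ≃⋆ₐ[ℂ] B)) B.subtype p.1 p.2)
    (fun p : B × G => crossedOp (1 : G →* (B ≃⋆ₐ[ℂ] B)) σ p.1 p.2)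
    (norm_le_of_mem_adjoin_crossedOp (1 : G →* (B ≃⋆ₐ[ℂ] B)) B.subtype Subtype.val_injective σ) _
    (tensorCr_eq G B)
  exact ⟨Φ, fun b g => hΦ (b, g) _⟩

end CrossedOp

/-! ### Dense subspaces -/

section Dense

/-- An isometric embedding induces the topology of its source; this turns closures taken among all
operators into density inside a subalgebra. -/
theorem dense_span_of_range_subset {V E : Type*} [NormedAddCommGroup V] [NormedSpace ℂ V]
    [NormedAddCommGroup E] [NormedSpace ℂ E] (i : V →ₗᵢ[ℂ] E) (t : Set V)
    (h : ∀ v, i v ∈ closure (Submodule.span ℂ (i '' t) : Set E)) :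
    Dense (Submodule.span ℂ t : Set V) := by
  intro v
  rw [i.isometry.isUniformInducing.isInducing.closure_eq_preimage_closure_image]
  have h1 : (Submodule.span ℂ (i '' t) : Set E) = i '' (Submodule.span ℂ t : Set V) := by
    have := Submodule.map_span i.toLinearMap t
    exact (congrArg (fun p : Submodule ℂ E => (p : Set E)) this).symm
  rw [Set.mem_preimage, ← h1]
  exact h v

variable {A : Type*} [CStarAlgebra A] {G : Type*} [Group G]
variable {K H : Type*} [NormedAddCommGroup K] [InnerProductSpace ℂ K] [CompleteSpace K]
  [NormedAddCommGroup H] [InnerProductSpace ℂ H] [CompleteSpace H]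

theorem coe_crossed (α : G →* (A ≃⋆ₐ[ℂ] A)) (ρ : A →⋆ₐ[ℂ] (K →L[ℂ] K)) :
    (crossed α ρ : Set (L2 G K →L[ℂ] L2 G K)) = closure
      (Submodule.span ℂ (Set.range fun p : A × G => crossedOp α ρ p.1 p.2) :
        Set (L2 G K →L[ℂ] L2 G K)) := by
  rw [crossed_eq, StarSubalgebra.topologicalClosure_coe]
  congr 1
  rw [← adjoin_toSubmodule_eq_span]
  · rfl
  · exact Submodule.subset_span ⟨(1, 1), crossedOp_one α ρ⟩
  · rintro _ ⟨⟨a, g⟩, rfl⟩ _ ⟨⟨b, h⟩, rfl⟩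
    exact Submodule.subset_span ⟨(a * α g b, g * h), (crossedOp_mul α ρ a b g h).symm⟩
  · rintro _ ⟨⟨a, g⟩, rfl⟩
    exact Submodule.subset_span ⟨(α g⁻¹ (star a), g⁻¹), (star_crossedOp α ρ a g).symm⟩

variable (G) in
theorem coe_tensorCr (B : StarSubalgebra ℂ (K →L[ℂ] K)) :
    (tensorCr G B : Set (L2 G K →L[ℂ] L2 G K)) = closure
      (Submodule.span ℂ (Set.range fun p : B × G => tens (p.1 : K →L[ℂ] K) p.2) :
        Set (L2 G K →L[ℂ] L2 G K)) := by
  rw [tensorCr_eq, StarSubalgebra.topologicalClosure_coe]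
  congr 1
  rw [← adjoin_toSubmodule_eq_span]
  · rfl
  · exact Submodule.subset_span ⟨(1, 1), tens_one⟩
  · rintro _ ⟨⟨a, g⟩, rfl⟩ _ ⟨⟨b, h⟩, rfl⟩
    exact Submodule.subset_span ⟨(a * b, g * h), (tens_mul (a : K →L[ℂ] K) b g h).symm⟩
  · rintro _ ⟨⟨a, g⟩, rfl⟩
    exact Submodule.subset_span ⟨(star a, g⁻¹), (star_tens (a : K →L[ℂ] K) g).symm⟩

theorem isClosed_crossed (α : G →* (A ≃⋆ₐ[ℂ] A)) (ρ : A →⋆ₐ[ℂ] (K →L[ℂ] K)) :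
    IsClosed (crossed α ρ : Set (L2 G K →L[ℂ] L2 G K)) :=
  StarSubalgebra.isClosed_topologicalClosure _

instance (α : G →* (A ≃⋆ₐ[ℂ] A)) (ρ : A →⋆ₐ[ℂ] (K →L[ℂ] K)) :
    IsClosed (crossed α ρ : Set (L2 G K →L[ℂ] L2 G K)) := isClosed_crossed α ρ

theorem isClosed_tensorCr (B : StarSubalgebra ℂ (K →L[ℂ] K)) :
    IsClosed (tensorCr G B : Set (L2 G K →L[ℂ] L2 G K)) :=
  StarSubalgebra.isClosed_topologicalClosure _

theorem dense_span_crossedElem (α : G →* (A ≃⋆ₐ[ℂ] A)) (ρ : A →⋆ₐ[ℂ] (K →L[ℂ] K)) :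
    Dense (Submodule.span ℂ (Set.range fun p : A × G => crossedElem α ρ p.1 p.2) :
      Set (crossed α ρ)) := by
  refine dense_span_of_range_subset
    (V := crossed α ρ) (Subalgebra.toSubmodule (crossed α ρ).toSubalgebra).subtypeₗᵢ _ fun v => ?_
  rw [← Set.range_comp]
  have := v.2
  rwa [← SetLike.mem_coe, coe_crossed] at this

/-- Stated for continuous linear maps rather than homomorphisms, so that it also covers maps such as
`b ↦ φ b * c`. -/
theorem crossed_hom_ext {α : G →* (A ≃⋆ₐ[ℂ] A)} {ρ : A →⋆ₐ[ℂ] (K →L[ℂ] K)} {E : Type*}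
    [NormedAddCommGroup E] [NormedSpace ℂ E] {S T : crossed α ρ →L[ℂ] E}
    (h : ∀ a g, S (crossedElem α ρ a g) = T (crossedElem α ρ a g)) : S = T := by
  refine ContinuousLinearMap.ext_on (dense_span_crossedElem α ρ) ?_
  rintro _ ⟨⟨a, g⟩, rfl⟩
  exact h a g

/-- A ⋆-homomorphism between concrete C⋆-algebras as a continuous linear map. -/
def starHomL {B : StarSubalgebra ℂ (K →L[ℂ] K)} [hB : IsClosed (B : Set (K →L[ℂ] K))]
    (φ : B →⋆ₐ[ℂ] (H →L[ℂ] H)) : B →L[ℂ] (H →L[ℂ] H) :=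
  φ.toAlgHom.toLinearMap.mkContinuous 1 fun b => by
    rw [one_mul]
    exact NonUnitalStarAlgHom.norm_apply_le φ b

@[simp] theorem starHomL_apply {B : StarSubalgebra ℂ (K →L[ℂ] K)}
    [hB : IsClosed (B : Set (K →L[ℂ] K))] (φ : B →⋆ₐ[ℂ] (H →L[ℂ] H)) (b : B) :
    starHomL φ b = φ b := rfl

/-- The inclusion of a concrete C⋆-algebra as a continuous linear map. -/
def inclL (B : StarSubalgebra ℂ (K →L[ℂ] K)) : B →L[ℂ] (K →L[ℂ] K) :=
  (Subalgebra.toSubmodule B.toSubalgebra).subtypeL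

end Dense

/-! ### The dual coaction -/

section Coaction

variable {A : Type*} [CStarAlgebra A] {G : Type*} [Group G]
variable {X K H : Type*} [NormedAddCommGroup X] [InnerProductSpace ℂ X] [CompleteSpace X]
  [NormedAddCommGroup K] [InnerProductSpace ℂ K] [CompleteSpace K]
  [NormedAddCommGroup H] [InnerProductSpace ℂ H] [CompleteSpace H]

/-- Conjugation with a unitary as a ⋆-homomorphism. -/
def conjHom (e : X ≃ₗᵢ[ℂ] K) : (X →L[ℂ] X) →⋆ₐ[ℂ] (K →L[ℂ] K) where
  toFun := e.conjStarAlgEquiv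
  map_one' := map_one _
  map_mul' := map_mul _
  map_zero' := map_zero _
  map_add' := map_add _
  commutes' r := by
    rw [Algebra.algebraMap_eq_smul_one, map_smul, map_one, Algebra.algebraMap_eq_smul_one]
  map_star' := map_star _

variable (G X) in
/-- The ⋆-homomorphism `T ↦ W (T ⊗ 1) W⋆` with the multiplicative unitary `W`. -/
def mulHom : (L2 G X →L[ℂ] L2 G X) →⋆ₐ[ℂ] (L2 G (L2 G X) →L[ℂ] L2 G (L2 G X)) :=
  (conjHom (mulU G X)).comp (amplHom G (L2 G X))

theorem mulHom_apply (T : L2 G X →L[ℂ] L2 G X) (ψ : L2 G (L2 G X)) :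
    mulHom G X T ψ = mulU G X (ampl G T ((mulU G X).symm ψ)) := rfl

/-- With `W` the multiplicative unitary: `W⋆` sends `δ_h ⊗ δ_k` to `δ_h ⊗ δ_{h⁻¹k}`, `T` moves `h`
to `gh`, and `W` then produces `δ_{gh} ⊗ δ_{gk}`. The coefficients `R h` depend only on the leg that
`W` leaves fixed. Both the operators `T ⊗ λ_g` and the generators of the crossed product have this
form. -/
theorem mulHom_of_apply_eq {T : L2 G X →L[ℂ] L2 G X} {g : G} {R : G → X →L[ℂ] X}
    (hT : ∀ ψ h, T ψ h = R h (ψ (g⁻¹ * h))) : mulHom G X T = tens T g := by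
  ext ψ : 1
  refine L2.ext fun k => L2.ext fun h => ?_
  rw [mulHom_apply, mulU_apply, ampl_apply, tens_apply, hT, hT, mulU_symm_apply]
  simp [mul_assoc]

theorem mulHom_tens (T : X →L[ℂ] X) (g : G) : mulHom G X (tens T g) = tens (tens T g) g :=
  mulHom_of_apply_eq (R := fun _ => T) fun _ _ => rfl

theorem mulHom_crossedOp (α : G →* (A ≃⋆ₐ[ℂ] A)) (ρ : A →⋆ₐ[ℂ] (K →L[ℂ] K)) (a : A) (g : G) :
    mulHom G K (crossedOp α ρ a g) = tens (crossedOp α ρ a g) g :=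
  mulHom_of_apply_eq (R := fun h => ρ (α h⁻¹ a)) fun _ _ => rfl

/-- The dual coaction is the restriction of `mulHom`; its values stay in the spatial tensor product
because this holds on generators and the target is closed. -/
theorem exists_dual_coaction (α : G →* (A ≃⋆ₐ[ℂ] A)) (ρ : A →⋆ₐ[ℂ] (K →L[ℂ] K)) :
    ∃ θ : crossed α ρ →⋆ₐ[ℂ] tensorCr G (crossed α ρ),
      ∀ a g, θ (crossedElem α ρ a g) = tensorElem (crossedElem α ρ a g) g := by
  have hle : crossed α ρ ≤ (tensorCr G (crossed α ρ)).comap (mulHom G K) := by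
    rw [crossed_eq]
    refine StarSubalgebra.topologicalClosure_minimal (StarAlgebra.adjoin_le ?_) ?_
    · rintro _ ⟨⟨a, g⟩, rfl⟩
      rw [← crossed_eq]
      change mulHom G K (crossedOp α ρ a g) ∈ tensorCr G (crossed α ρ)
      rw [mulHom_crossedOp]
      exact (tensorElem (crossedElem α ρ a g) g).2
    · exact (isClosed_tensorCr _).preimage
        (AddMonoidHomClass.continuous_of_bound (mulHom G K) 1 fun T => by
          rw [one_mul]; exact NonUnitalStarAlgHom.norm_apply_le _ _)
  refine ⟨((mulHom G K).comp (crossed α ρ).subtype).codRestrict _ fun b => hle b.2, fun a g => ?_⟩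
  exact Subtype.ext (mulHom_crossedOp α ρ a g)

variable (G K) in
/-- The ⋆-homomorphism `T₁ ⊗ T₂ ↦ W (T₁ ⊗ 1) W⋆ ⊗ T₂` on `𝓛(K ⊗ ℓ²(G) ⊗ ℓ²(G))`. -/
def mulHomAmpl : (L2 G (L2 G K) →L[ℂ] L2 G (L2 G K)) →⋆ₐ[ℂ]
    (L2 G (L2 G (L2 G K)) →L[ℂ] L2 G (L2 G (L2 G K))) :=
  (conjHom ((flipU G (L2 G K)).trans (amplEquiv G (mulU G K)))).comp
    (amplHom G (L2 G (L2 G K)))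

/-- The flip of the two outer legs turns `T ⊗ λ_g ⊗ 1` into `T ⊗ 1 ⊗ λ_g`; the multiplicative
unitary then acts on the first two copies of `ℓ²(G)` only. -/
theorem mulHomAmpl_tens (T : L2 G K →L[ℂ] L2 G K) (g : G) :
    mulHomAmpl G K (tens T g) = tens (mulHom G K T) g := by
  ext ψ : 1
  refine L2.ext fun k => ?_
  change mulU G K _ = mulU G K _
  congr 1

theorem tens_mem_of_crossedElem (α : G →* (A ≃⋆ₐ[ℂ] A)) (ρ : A →⋆ₐ[ℂ] (K →L[ℂ] K))
    (M : Submodule ℂ (L2 G (L2 G K) →L[ℂ] L2 G (L2 G K)))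
    (hM : IsClosed (M : Set (L2 G (L2 G K) →L[ℂ] L2 G (L2 G K)))) (g : G)
    (h : ∀ a h, tens (crossedElem α ρ a h : L2 G K →L[ℂ] L2 G K) g ∈ M) (b : crossed α ρ) :
    tens (b : L2 G K →L[ℂ] L2 G K) g ∈ M := by
  let F := (tensL (L2 G K) (L2 G K) g).comp (inclL (crossed α ρ))
  have hsub : (Submodule.span ℂ (Set.range fun p : A × G => crossedElem α ρ p.1 p.2)) ≤
      M.comap F.toLinearMap := by
    refine Submodule.span_le.2 ?_
    rintro _ ⟨⟨a, k⟩, rfl⟩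
    exact h a k
  have hcl : IsClosed (F ⁻¹' (M : Set (L2 G (L2 G K) →L[ℂ] L2 G (L2 G K)))) :=
    hM.preimage F.continuous
  exact closure_minimal (SetLike.coe_subset_coe.2 hsub) hcl (dense_span_crossedElem α ρ b)

/-- By density `θ` must be conjugation with the multiplicative unitary, so `θ ⊗ id` and `id ⊗ Δ` are
restrictions of maps defined on all operators. They agree because both send `a δ_g ⊗ λ_g`, the image
of `a δ_g` under `θ`, to `a δ_g ⊗ λ_g ⊗ λ_g`. -/
theorem isCoaction_of_apply_crossedElem (α : G →* (A ≃⋆ₐ[ℂ] A)) (ρ : A →⋆ₐ[ℂ] (K →L[ℂ] K))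
    (θ : crossed α ρ →⋆ₐ[ℂ] tensorCr G (crossed α ρ))
    (hθ : ∀ a g, θ (crossedElem α ρ a g) = tensorElem (crossedElem α ρ a g) g) :
    IsCoaction (crossed α ρ) θ := by
  have hmul : ∀ b : crossed α ρ, mulHom G K b = (θ b : L2 G (L2 G K) →L[ℂ] L2 G (L2 G K)) := by
    have : starHomL ((mulHom G K).comp (crossed α ρ).subtype) =
        starHomL ((tensorCr G (crossed α ρ)).subtype.comp θ) := by
      refine crossed_hom_ext fun a g => ?_
      simp only [starHomL_apply, StarAlgHom.comp_apply, hθ]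
      exact mulHom_crossedOp α ρ a g
    exact fun b => DFunLike.congr_fun this b
  constructor
  · let Φ := (mulHomAmpl G K).comp (tensorCr G (crossed α ρ)).subtype
    -- Over the base space `L2 G K` the multiplicative unitary links the last two legs, so
    -- conjugation with it duplicates `λ_g`.
    let Ψ := (mulHom G (L2 G K)).comp (tensorCr G (crossed α ρ)).subtype
    have hΦ : ∀ (b : crossed α ρ) (g : G), Φ (tensorElem b g) = tens (θ b : L2 G (L2 G K) →L[ℂ] L2 G (L2 G K)) g := by
      intro b g
      rw [← hmul]
      exact mulHomAmpl_tens _ g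
    have hΨ : ∀ (b : crossed α ρ) (g : G), Ψ (tensorElem b g) = tens (tens (b : L2 G K →L[ℂ] L2 G K) g) g :=
      fun b g => mulHom_tens _ g
    refine ⟨Φ, Ψ, hΦ, hΨ, ?_⟩
    have : starHomL (Φ.comp θ) = starHomL (Ψ.comp θ) := by
      refine crossed_hom_ext fun a g => ?_
      simp only [starHomL_apply, StarAlgHom.comp_apply, hθ]
      rw [hΦ, hΨ, hθ]
      rfl
    exact fun b => DFunLike.congr_fun this b
  · refine subset_antisymm (closure_minimal ?_ (isClosed_tensorCr _)) ?_
    · have hle : Submodule.span ℂ {T : L2 G (L2 G K) →L[ℂ] L2 G (L2 G K) |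
          ∃ (b : crossed α ρ) (c : tensorCr G (⊥ : StarSubalgebra ℂ (L2 G K →L[ℂ] L2 G K))),
            T = (θ b : L2 G (L2 G K) →L[ℂ] L2 G (L2 G K)) * c} ≤
          Subalgebra.toSubmodule (tensorCr G (crossed α ρ)).toSubalgebra := by
        refine Submodule.span_le.2 ?_
        rintro _ ⟨b, c, rfl⟩
        have hbot : tensorCr G (⊥ : StarSubalgebra ℂ (L2 G K →L[ℂ] L2 G K)) ≤
            tensorCr G (crossed α ρ) := by
          refine StarSubalgebra.topologicalClosure_mono (StarAlgebra.adjoin_mono ?_)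
          rintro _ ⟨b, hb, g, rfl⟩
          exact ⟨b, bot_le (a := crossed α ρ) hb, g, rfl⟩
        have h := mul_mem (θ b).2 (hbot c.2)
        exact h
      exact hle
    · rw [coe_tensorCr]
      refine closure_minimal ?_ isClosed_closure
      rw [← Submodule.topologicalClosure_coe]
      refine SetLike.coe_subset_coe.2 (Submodule.span_le.2 ?_)
      rintro _ ⟨⟨b, g⟩, rfl⟩
      refine tens_mem_of_crossedElem α ρ _ (Submodule.isClosed_topologicalClosure _) g
        (fun a h => ?_) b
      refine Submodule.le_topologicalClosure _ (Submodule.subset_span ?_)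
      -- This factor corrects the last leg: `a δ_h ⊗ λ_g = θ(a δ_h) (1 ⊗ λ_{h⁻¹g})`.
      let e : tensorCr G (⊥ : StarSubalgebra ℂ (L2 G K →L[ℂ] L2 G K)) :=
        tensorElem ⟨1, one_mem _⟩ (h⁻¹ * g)
      refine ⟨crossedElem α ρ a h, e, ?_⟩
      rw [hθ]
      change tens _ g = tens _ h * tens 1 (h⁻¹ * g)
      rw [tens_mul, mul_one, mul_inv_cancel_left]

end Coaction

/-! ### The Hilbert module `X ⊗ C⋆_r(G)` -/

section Module

variable {G : Type*} [Group G]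
variable {X Y : Type*} [NormedAddCommGroup X] [InnerProductSpace ℂ X]
  [NormedAddCommGroup Y] [InnerProductSpace ℂ Y]

theorem isClosed_hmod : IsClosed (hmod G X : Set (L2 G ℂ →L[ℂ] L2 G X)) :=
  Submodule.isClosed_topologicalClosure _

theorem leftVec_comp_mem_hmod (ξ : X) {c : L2 G ℂ →L[ℂ] L2 G ℂ} (hc : c ∈ Cr G) :
    leftVec G ξ ∘L c ∈ hmod G X := (elem ξ ⟨c, hc⟩ : hmod G X).2

/-- A bounded linear map that sends the elementary tensors into `Y ⊗ C⋆_r(G)` sends all of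
`X ⊗ C⋆_r(G)` into it. -/
theorem map_hmod_mem
    (F : (L2 G ℂ →L[ℂ] L2 G X) →L[ℂ] (L2 G ℂ →L[ℂ] L2 G Y))
    (h : ∀ (ξ : X) (c : Cr G), F (leftVec G ξ ∘L (c : L2 G ℂ →L[ℂ] L2 G ℂ)) ∈ hmod G Y)
    {S : L2 G ℂ →L[ℂ] L2 G X} (hS : S ∈ hmod G X) : F S ∈ hmod G Y := by
  have : hmod G X ≤ (hmod G Y).comap F.toLinearMap := by
    refine Submodule.topologicalClosure_minimal _ (Submodule.span_le.2 ?_)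
      (isClosed_hmod.preimage F.continuous)
    rintro _ ⟨ξ, c, rfl⟩
    exact h ξ c
  exact this hS

theorem comp_mem_hmod {S : L2 G ℂ →L[ℂ] L2 G X} (hS : S ∈ hmod G X) (c : Cr G) :
    S ∘L (c : L2 G ℂ →L[ℂ] L2 G ℂ) ∈ hmod G X :=
  map_hmod_mem ((ContinuousLinearMap.compL ℂ (L2 G ℂ) (L2 G ℂ) (L2 G X)).flip
    (c : L2 G ℂ →L[ℂ] L2 G ℂ))
    (fun ξ d => leftVec_comp_mem_hmod ξ (mul_mem d.2 c.2)) hS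

/-- Composition from the left with a fixed operator. -/
def compLeft (T : L2 G X →L[ℂ] L2 G Y) : (L2 G ℂ →L[ℂ] L2 G X) →L[ℂ] (L2 G ℂ →L[ℂ] L2 G Y) :=
  ContinuousLinearMap.compL ℂ (L2 G ℂ) (L2 G X) (L2 G Y) T

theorem left_comp_mem_hmod (T : L2 G X →L[ℂ] L2 G Y) (h : ∀ ξ : X, T ∘L leftVec G ξ ∈ hmod G Y)
    {S : L2 G ℂ →L[ℂ] L2 G X} (hS : S ∈ hmod G X) : T ∘L S ∈ hmod G Y :=
  map_hmod_mem (compLeft T) (fun ξ c => comp_mem_hmod (h ξ) c) hS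

theorem elem_add_left (ξ η : X) (c : Cr G) : elem (ξ + η) c = elem ξ c + elem η c := by
  refine Subtype.ext ?_
  change leftVecL G X (ξ + η) ∘L _ = _
  rw [map_add]
  rfl

theorem elem_smul_left (r : ℂ) (ξ : X) (c : Cr G) : elem (r • ξ) c = r • elem ξ c := by
  refine Subtype.ext ?_
  change leftVecL G X (r • ξ) ∘L _ = _
  rw [map_smul]
  rfl

variable (X) in
/-- The map `ξ ↦ ξ ⊗ c` as a continuous linear map. -/
def elemL (c : Cr G) : X →L[ℂ] hmod G X :=
  LinearMap.mkContinuous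
    { toFun := fun ξ : X => (elem ξ c : hmod G X)
      map_add' := fun ξ η => elem_add_left ξ η c
      map_smul' := fun r ξ => elem_smul_left r ξ c } ‖(c : L2 G ℂ →L[ℂ] L2 G ℂ)‖ fun ξ => by
    rw [mul_comm]
    exact (ContinuousLinearMap.opNorm_comp_le _ _).trans
      (mul_le_mul_of_nonneg_right (leftVec_norm_le ξ) (norm_nonneg _))

theorem modAmpl_elem (T : X →L[ℂ] X) (ξ : X) (c : Cr G) : modAmpl T (elem ξ c) = elem (T ξ) c := by
  refine Subtype.ext ?_
  change ampl G T ∘L leftVec G ξ ∘L _ = leftVec G (T ξ) ∘L _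
  rw [← ContinuousLinearMap.comp_assoc, ampl_comp_leftVec]

end Module

/-! ### The corepresentation on `X ⊗ ℓ²(G)` -/

section Corep

variable {G : Type*} [Group G]
variable {X : Type*} [NormedAddCommGroup X] [InnerProductSpace ℂ X]

variable (G X) in
/-- The multiplicative unitary as a bounded operator. -/
def mulL : L2 G (L2 G X) →L[ℂ] L2 G (L2 G X) := (mulU G X : _ →L[ℂ] L2 G (L2 G X))

variable (G X) in
/-- The inverse of the multiplicative unitary as a bounded operator. -/
def mulLSymm : L2 G (L2 G X) →L[ℂ] L2 G (L2 G X) := ((mulU G X).symm : _ →L[ℂ] L2 G (L2 G X))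

@[simp] theorem mulL_apply (ψ : L2 G (L2 G X)) : mulL G X ψ = mulU G X ψ := rfl

@[simp] theorem mulLSymm_apply (ψ : L2 G (L2 G X)) : mulLSymm G X ψ = (mulU G X).symm ψ := rfl

/-- With the middle leg fixed at `δ_g`, the multiplicative unitary is the translation `λ_g` of the
last leg. Hence it preserves the Hilbert module and commutes with everything diagonal in `g` that
ignores the last leg. -/
theorem mulL_comp_leftVec_deltaVec (g : G) (ζ : X) :
    mulL G X ∘L leftVec G (deltaVec g ζ) = leftVec G (deltaVec g ζ) ∘L translate ℂ g := by
  ext η : 1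
  refine L2.ext fun k => L2.ext fun h => ?_
  simp only [ContinuousLinearMap.comp_apply, mulL_apply, mulU_apply, leftVec_apply, translate_apply,
    lp.coeFn_smul, Pi.smul_apply]
  by_cases hh : h = g
  · rw [hh]
  · rw [deltaVec_ne hh, smul_zero, smul_zero]

theorem mulLSymm_comp_mulL : mulLSymm G X ∘L mulL G X = ContinuousLinearMap.id ℂ _ := by
  ext ψ : 1
  simp

theorem mulL_comp_mulLSymm : mulL G X ∘L mulLSymm G X = ContinuousLinearMap.id ℂ _ := by
  ext ψ : 1
  simp

theorem mulLSymm_comp_leftVec_deltaVec (g : G) (ζ : X) :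
    mulLSymm G X ∘L leftVec G (deltaVec g ζ) = leftVec G (deltaVec g ζ) ∘L translate ℂ g⁻¹ := by
  have h : leftVec G (deltaVec g ζ) =
      mulL G X ∘L leftVec G (deltaVec g ζ) ∘L translate ℂ g⁻¹ := by
    rw [← ContinuousLinearMap.comp_assoc, mulL_comp_leftVec_deltaVec,
      ContinuousLinearMap.comp_assoc, translate_comp, mul_inv_cancel, translate_one]
    rfl
  conv_lhs => rw [h, ← ContinuousLinearMap.comp_assoc, mulLSymm_comp_mulL]
  rfl

theorem comp_leftVec_mem_hmod_of_deltaVec {Y : Type*} [NormedAddCommGroup Y]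
    [InnerProductSpace ℂ Y] (T : L2 G (L2 G X) →L[ℂ] L2 G Y)
    (h : ∀ g (ζ : X), T ∘L leftVec G (deltaVec g ζ) ∈ hmod G Y) (ξ : L2 G X) :
    T ∘L leftVec G ξ ∈ hmod G Y := by
  have hmem : ∀ ξ, (compLeft T ∘L leftVecL G (L2 G X)) ξ ∈ hmod G Y := by
    refine L2.induction ?_ ?_ ?_ ?_
    · exact isClosed_hmod.preimage (compLeft T ∘L leftVecL G (L2 G X)).continuous
    · rw [map_zero]; exact zero_mem _
    · intro ψ φ hψ hφ; rw [map_add]; exact add_mem hψ hφ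
    · exact h
  exact hmem ξ

theorem mulL_comp_leftVec_mem (ξ : L2 G X) : mulL G X ∘L leftVec G ξ ∈ hmod G (L2 G X) :=
  comp_leftVec_mem_hmod_of_deltaVec _ (fun g ζ => by
    rw [mulL_comp_leftVec_deltaVec]
    exact leftVec_comp_mem_hmod _ (lam g).2) ξ

theorem mulLSymm_comp_leftVec_mem (ξ : L2 G X) : mulLSymm G X ∘L leftVec G ξ ∈ hmod G (L2 G X) :=
  comp_leftVec_mem_hmod_of_deltaVec _ (fun g ζ => by
    rw [mulLSymm_comp_leftVec_deltaVec]
    exact leftVec_comp_mem_hmod _ (lam g⁻¹).2) ξ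

theorem mulL_comp_mem {S : L2 G ℂ →L[ℂ] L2 G (L2 G X)} (hS : S ∈ hmod G (L2 G X)) :
    mulL G X ∘L S ∈ hmod G (L2 G X) :=

  left_comp_mem_hmod (mulL G X) mulL_comp_leftVec_mem hS

theorem mulLSymm_comp_mem {S : L2 G ℂ →L[ℂ] L2 G (L2 G X)} (hS : S ∈ hmod G (L2 G X)) :
    mulLSymm G X ∘L S ∈ hmod G (L2 G X) :=

  left_comp_mem_hmod (mulLSymm G X) mulLSymm_comp_leftVec_mem hS

variable (G X) in
/-- The corepresentation `Θ (ξ ⊗ δ_g) = ξ ⊗ δ_g ⊗ δ_g` of `G` on `X ⊗ ℓ²(G)`. -/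
def corep : L2 G X →L[ℂ] hmod G (L2 G X) :=
  (compLeft (mulL G X) ∘L leftVecL G (L2 G X)).codRestrict _ mulL_comp_leftVec_mem

theorem corep_deltaVec (g : G) (ζ : X) : corep G X (deltaVec g ζ) = elem (deltaVec g ζ) (lam g) :=
  Subtype.ext (mulL_comp_leftVec_deltaVec g ζ)

variable (G X) in
/-- The operatorial form `U` of the corepresentation `Θ`. -/
def corepU : hmod G (L2 G X) ≃ₗᵢ[ℂ] hmod G (L2 G X) where
  toFun S := ⟨mulL G X ∘L S, mulL_comp_mem S.2⟩
  invFun S := ⟨mulLSymm G X ∘L S, mulLSymm_comp_mem S.2⟩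
  left_inv S := by
    refine Subtype.ext ?_
    change mulLSymm G X ∘L mulL G X ∘L _ = _
    rw [← ContinuousLinearMap.comp_assoc, mulLSymm_comp_mulL]
    rfl
  right_inv S := by
    refine Subtype.ext ?_
    change mulL G X ∘L mulLSymm G X ∘L _ = _
    rw [← ContinuousLinearMap.comp_assoc, mulL_comp_mulLSymm]
    rfl
  map_add' S T := Subtype.ext ((compLeft (mulL G X)).map_add S T)
  map_smul' c S := Subtype.ext ((compLeft (mulL G X)).map_smul c S)
  norm_map' S := (mulU G X).toLinearIsometry.norm_toContinuousLinearMap_comp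

theorem isOperatorForm_corepU : IsOperatorForm (corep G X).toLinearMap (corepU G X) :=
  fun _ _ => rfl

theorem corepU_elem_deltaVec (g : G) (ζ : X) (c : Cr G) :
    corepU G X (elem (deltaVec g ζ) c) = elem (deltaVec g ζ) (lam g * c) := by
  refine Subtype.ext ?_
  change mulL G X ∘L leftVec G (deltaVec g ζ) ∘L _ = leftVec G _ ∘L translate ℂ g ∘L _
  rw [← ContinuousLinearMap.comp_assoc, mulL_comp_leftVec_deltaVec]
  rfl

theorem corepU_symm_elem_deltaVec (g : G) (ζ : X) (c : Cr G) :
    (corepU G X).symm (elem (deltaVec g ζ) c) = elem (deltaVec g ζ) (lam g⁻¹ * c) := by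
  refine Subtype.ext ?_
  change mulLSymm G X ∘L leftVec G (deltaVec g ζ) ∘L _ = leftVec G _ ∘L translate ℂ g⁻¹ ∘L _
  rw [← ContinuousLinearMap.comp_assoc, mulLSymm_comp_leftVec_deltaVec]
  rfl

/-- Both maps have the form `S ↦ V (S ⊗ 1) V'` with fixed unitaries, hence are bounded. For `id ⊗ Δ`
the multiplicative unitary stands on the left and its inverse on the right, in accordance with `Δ(c)
= W (c ⊗ 1) W⋆`; for `Θ ⊗ id` flips put `λ_g` into the last leg. Boundedness reduces the identity to
the vectors `ζ ⊗ δ_g`. -/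
theorem exists_corep_coassoc : ∃ Φ Ψ : hmod G (L2 G X) →L[ℂ]
      (L2 G (L2 G ℂ) →L[ℂ] L2 G (L2 G (L2 G X))),
    (∀ (ξ : L2 G X) (g : G), Φ (elem ξ (lam g)) =
      tens (corep G X ξ : L2 G ℂ →L[ℂ] L2 G (L2 G X)) g) ∧
    (∀ (ξ : L2 G X) (g : G), Ψ (elem ξ (lam g)) =
      tens (elem ξ (lam g) : L2 G ℂ →L[ℂ] L2 G (L2 G X)) g) ∧
    ∀ ξ : L2 G X, Φ (corep G X ξ) = Ψ (corep G X ξ) := by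
  let L : hmod G (L2 G X) →L[ℂ] (L2 G (L2 G ℂ) →L[ℂ] L2 G (L2 G (L2 G X))) :=
    amplL G (L2 G ℂ) (L2 G (L2 G X)) ∘L (hmod G (L2 G X)).subtypeL
  let P (V : L2 G (L2 G (L2 G X)) →L[ℂ] L2 G (L2 G (L2 G X)))
      (W : L2 G (L2 G ℂ) →L[ℂ] L2 G (L2 G ℂ)) :
      (L2 G (L2 G ℂ) →L[ℂ] L2 G (L2 G (L2 G X))) →L[ℂ]
        (L2 G (L2 G ℂ) →L[ℂ] L2 G (L2 G (L2 G X))) :=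
    ContinuousLinearMap.compL ℂ (L2 G (L2 G ℂ)) (L2 G (L2 G (L2 G X))) (L2 G (L2 G (L2 G X))) V ∘L
      (ContinuousLinearMap.compL ℂ (L2 G (L2 G ℂ)) (L2 G (L2 G ℂ)) (L2 G (L2 G (L2 G X)))).flip W
  let e : L2 G (L2 G (L2 G X)) ≃ₗᵢ[ℂ] L2 G (L2 G (L2 G X)) :=
    (flipU G (L2 G X)).trans (amplEquiv G (mulU G X))
  let V₁ : L2 G (L2 G (L2 G X)) →L[ℂ] L2 G (L2 G (L2 G X)) := e
  let W₁ : L2 G (L2 G ℂ) →L[ℂ] L2 G (L2 G ℂ) := flipU G ℂ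
  let Φ := P V₁ W₁ ∘L L
  let Ψ := P (mulL G (L2 G X)) (mulLSymm G ℂ) ∘L L
  have hΦ : ∀ (ξ : L2 G X) (g : G), Φ (elem ξ (lam g)) =
      tens (corep G X ξ : L2 G ℂ →L[ℂ] L2 G (L2 G X)) g := by
    intro ξ g
    ext ψ : 1
    refine L2.ext fun k => ?_
    change mulU G X _ = mulU G X _
    congr 1
  have hΨ : ∀ (ξ : L2 G X) (g : G), Ψ (elem ξ (lam g)) =
      tens (elem ξ (lam g) : L2 G ℂ →L[ℂ] L2 G (L2 G X)) g := by
    intro ξ g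
    ext ψ : 1
    refine L2.ext fun k => L2.ext fun h => ?_
    change ((mulU G ℂ).symm ψ (h⁻¹ * k)) (g⁻¹ * h) • ξ = (ψ (g⁻¹ * k)) (g⁻¹ * h) • ξ
    rw [mulU_symm_apply]
    simp [mul_assoc]
  refine ⟨Φ, Ψ, hΦ, hΨ, fun ξ => ?_⟩
  have : Φ ∘L corep G X = Ψ ∘L corep G X := by
    refine L2.hom_ext (E := L2 G (L2 G ℂ) →L[ℂ] L2 G (L2 G (L2 G X))) fun g ζ => ?_
    simp only [ContinuousLinearMap.comp_apply, corep_deltaVec]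
    rw [hΦ, hΨ, corep_deltaVec]
  exact DFunLike.congr_fun this ξ

theorem isUnitaryCorep_corep [CompleteSpace X] :
    IsUnitaryCorep (corep G X).toLinearMap := by
  refine ⟨exists_corep_coassoc, ?_, fun ξ η => ?_⟩
  · set M := Submodule.span ℂ {S : L2 G ℂ →L[ℂ] L2 G (L2 G X) | ∃ (ξ : L2 G X) (c : Cr G),
      S = ((corep G X).toLinearMap ξ : L2 G ℂ →L[ℂ] L2 G (L2 G X)) ∘L
        (c : L2 G ℂ →L[ℂ] L2 G ℂ)} with hM
    refine subset_antisymm (closure_minimal ?_ isClosed_hmod) ?_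
    · refine SetLike.coe_subset_coe.2 (Submodule.span_le.2 ?_)
      rintro _ ⟨ξ, c, rfl⟩
      exact comp_mem_hmod (corep G X ξ).2 c
    · rw [← Submodule.topologicalClosure_coe]
      refine SetLike.coe_subset_coe.2 (Submodule.topologicalClosure_minimal _
        (Submodule.span_le.2 ?_) (Submodule.isClosed_topologicalClosure _))
      rintro _ ⟨ξ, c, rfl⟩
      revert ξ
      refine L2.induction ?_ ?_ ?_ ?_
      · exact (Submodule.isClosed_topologicalClosure M).preimage
          ((hmod G (L2 G X)).subtypeL ∘L elemL (L2 G X) c).continuous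
      · change ((hmod G (L2 G X)).subtypeL ∘L elemL (L2 G X) c) 0 ∈ _
        rw [map_zero]
        exact zero_mem _
      · intro ψ φ hψ hφ
        change ((hmod G (L2 G X)).subtypeL ∘L elemL (L2 G X) c) (ψ + φ) ∈ _
        rw [map_add]
        exact add_mem hψ hφ
      · intro g ζ
        -- `Θ(ζ ⊗ δ_g)` contributes a factor `λ_g`, which `λ_{g⁻¹}` cancels.
        refine Submodule.le_topologicalClosure _ (Submodule.subset_span
          ⟨deltaVec g ζ, lam g⁻¹ * c, ?_⟩)
        change _ = (mulL G X ∘L leftVec G (deltaVec g ζ)) ∘L (translate ℂ g⁻¹ ∘L _)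
        rw [mulL_comp_leftVec_deltaVec, ContinuousLinearMap.comp_assoc,
          ← ContinuousLinearMap.comp_assoc _ (translate ℂ g⁻¹), translate_comp, mul_inv_cancel,
          translate_one]
        rfl
  · refine Subtype.ext ?_
    refine Eq.trans ?_ (adjoint_leftVec_comp ξ η)
    refine ContinuousLinearMap.ext fun v => ext_inner_left ℂ fun w => ?_
    change ⟪w, ContinuousLinearMap.adjoint (mulL G X ∘L leftVec G ξ)
      ((mulL G X ∘L leftVec G η) v)⟫_ℂ = _
    rw [ContinuousLinearMap.adjoint_inner_right, ContinuousLinearMap.comp_apply,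
      ContinuousLinearMap.comp_apply, ContinuousLinearMap.comp_apply,
      ContinuousLinearMap.adjoint_inner_right]
    exact (mulU G X).inner_map_map _ _

end Corep

/-! ### Slices -/

section Slice

variable {G : Type*} [Group G]
variable {X : Type*} [NormedAddCommGroup X] [InnerProductSpace ℂ X] [CompleteSpace X]

/-- Continuity is not part of `IsState`; it is automatic for positive functionals on a C⋆-algebra.
-/
theorem IsState.exists_norm_le {φ : Cr G →ₗ[ℂ] ℂ} (hφ : IsState φ) :
    ∃ C : ℝ, 0 ≤ C ∧ ∀ c, ‖φ c‖ ≤ C * ‖(c : L2 G ℂ →L[ℂ] L2 G ℂ)‖ := by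
  open scoped ComplexOrder in
  have hcl : IsClosed (Cr G : Set (L2 G ℂ →L[ℂ] L2 G ℂ)) :=
    StarSubalgebra.isClosed_topologicalClosure _
  let := CStarAlgebra.spectralOrder (Cr G)
  have := CStarAlgebra.spectralOrderedRing (Cr G)
  obtain ⟨C, hC⟩ := PositiveLinearMap.exists_norm_apply_le (PositiveLinearMap.mk₀ φ fun c hc => by
    obtain ⟨x, rfl⟩ := CStarAlgebra.nonneg_iff_eq_star_mul_self.1 hc
    exact Complex.nonneg_iff.2 ⟨(hφ.1 x).1, (hφ.1 x).2.symm⟩)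
  exact ⟨C, C.2, hC⟩

theorem norm_modInner_le (S T : hmod G X) :
    ‖(modInner S T : L2 G ℂ →L[ℂ] L2 G ℂ)‖ ≤ ‖S‖ * ‖T‖ := by
  refine (ContinuousLinearMap.opNorm_comp_le _ _).trans ?_
  rw [LinearIsometryEquiv.norm_map]
  rfl

theorem norm_elem_one_le (ξ : X) : ‖(elem ξ 1 : hmod G X)‖ ≤ ‖ξ‖ := leftVec_norm_le ξ

/-- The prescribed matrix coefficients form a bounded sesquilinear form, with constant `C * M`, and
Riesz representation gives the operator. -/
theorem exists_isSlice {φ : Cr G →ₗ[ℂ] ℂ} (hφ : IsState φ) (F : hmod G X →ₗ[ℂ] hmod G X)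
    {M : ℝ} (hM0 : 0 ≤ M) (hM : ∀ S, ‖F S‖ ≤ M * ‖S‖) :
    ∃ R : X →L[ℂ] X, IsSlice φ F R := by
  obtain ⟨C, hC0, hC⟩ := hφ.exists_norm_le
  let B₀ : X →ₗ⋆[ℂ] X →ₗ[ℂ] ℂ := LinearMap.mk₂'ₛₗ (starRingEnd ℂ) (RingHom.id ℂ)
    (fun ξ η => φ (modInner (elem ξ 1) (F (elem η 1))))
    (fun ξ ξ' η => by
      rw [← map_add]
      congr 1
      refine Subtype.ext ?_
      rw [elem_add_left]
      change ContinuousLinearMap.adjoint (_ + _) ∘L _ = _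
      rw [map_add]
      rfl)
    (fun r ξ η => by
      rw [smul_eq_mul, ← smul_eq_mul, ← map_smul]
      congr 1
      refine Subtype.ext ?_
      rw [elem_smul_left]
      change ContinuousLinearMap.adjoint (_ • _) ∘L _ = _
      rw [LinearIsometryEquiv.map_smulₛₗ]
      rfl)
    (fun ξ η η' => by
      rw [← map_add]
      congr 1
      refine Subtype.ext ?_
      rw [elem_add_left, map_add]
      exact ContinuousLinearMap.comp_add _ _ _)
    (fun r ξ η => by
      rw [RingHom.id_apply, ← map_smul]
      congr 1
      refine Subtype.ext ?_
      rw [elem_smul_left, map_smul]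
      exact ContinuousLinearMap.comp_smul _ _ _)
  let B : X →L⋆[ℂ] X →L[ℂ] ℂ := B₀.mkContinuous₂ (C * M) fun ξ η => by
    refine (hC _).trans ?_
    calc _ ≤ C * (‖(elem ξ 1 : hmod G X)‖ * ‖F (elem η 1)‖) := by
            gcongr; exact norm_modInner_le _ _
      _ ≤ C * (‖ξ‖ * (M * ‖η‖)) := by
            gcongr
            · exact norm_elem_one_le ξ
            · exact (hM _).trans (by gcongr; exact norm_elem_one_le η)
      _ = _ := by ring
  -- The Riesz operator of `B` stands in the first slot of the inner product, while a slice stands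
  -- in the second; hence the adjoint.
  refine ⟨ContinuousLinearMap.adjoint (InnerProductSpace.continuousLinearMapOfBilin B),
    fun ξ η => ?_⟩
  rw [ContinuousLinearMap.adjoint_inner_right, InnerProductSpace.continuousLinearMapOfBilin_apply]
  rfl

/-- Moving `c ⊗ 1` across the module inner product replaces `ξ ⊗ 1` by `c⋆ ξ ⊗ 1`. Only commutation
with `c` itself is used, not with `c⋆`. -/
theorem IsSlice.commute {φ : Cr G →ₗ[ℂ] ℂ} {F : hmod G X → hmod G X} {R : X →L[ℂ] X}
    (hR : IsSlice φ F R) {c : X →L[ℂ] X} (hc : ∀ S, F (modAmpl c S) = modAmpl c (F S)) :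
    c * R = R * c := by
  refine ContinuousLinearMap.ext fun η => ext_inner_left ℂ fun ξ => ?_
  rw [mul_apply_eq_comp, mul_apply_eq_comp, ← ContinuousLinearMap.adjoint_inner_left,
    hR, hR, ← modAmpl_elem c η, hc]
  congr 1
  refine Subtype.ext ?_
  have h : ((elem (ContinuousLinearMap.adjoint c ξ) 1 : hmod G X) : L2 G ℂ →L[ℂ] L2 G X) =
      ContinuousLinearMap.adjoint (ampl G c) ∘L
        ((elem ξ 1 : hmod G X) : L2 G ℂ →L[ℂ] L2 G X) := by
    rw [adjoint_ampl]
    exact congrArg Subtype.val (modAmpl_elem (ContinuousLinearMap.adjoint c) ξ (1 : Cr G)).symm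
  change ContinuousLinearMap.adjoint _ ∘L _ = _
  rw [h, ContinuousLinearMap.adjoint_comp, ContinuousLinearMap.adjoint_adjoint]
  rfl

end Slice

/-! ### Self-adjoint operators and bounded commutators -/

section SelfAdjoint

variable {H : Type*} [NormedAddCommGroup H] [InnerProductSpace ℂ H] [CompleteSpace H]

/-- Symmetry puts `T` below its adjoint, and `hm` says that the domain of the adjoint is no larger
than that of `T`. -/
theorem isSelfAdjoint_of_symmetric_of_maximal {T : H →ₗ.[ℂ] H} (hd : Dense (T.domain : Set H))
    (hs : ∀ x y : T.domain, ⟪T x, (y : H)⟫_ℂ = ⟪(x : H), T y⟫_ℂ)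
    (hm : ∀ y w : H, (∀ x : T.domain, ⟪w, (x : H)⟫_ℂ = ⟪y, T x⟫_ℂ) → y ∈ T.domain) :
    IsSelfAdjoint T := by
  rw [LinearPMap.isSelfAdjoint_def]
  have hle : T ≤ T.adjoint := LinearPMap.IsFormalAdjoint.le_adjoint hd fun x y => hs x y
  refine le_antisymm ?_ hle
  refine ⟨fun y hy => ?_, fun x y hxy => ?_⟩
  · exact hm y (T.adjoint ⟨y, hy⟩) fun x => LinearPMap.adjoint_isFormalAdjoint hd ⟨y, hy⟩ x
  · refine LinearPMap.adjoint_apply_eq hd x fun z => ?_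
    rw [hs y z, hxy]

variable {D : H →ₗ.[ℂ] H}

theorem symmetric_of_isSelfAdjoint (hD : IsSelfAdjoint D) (x y : D.domain) :
    ⟪D x, (y : H)⟫_ℂ = ⟪(x : H), D y⟫_ℂ := by
  have h := LinearPMap.adjoint_isFormalAdjoint hD.dense_domain
  rw [LinearPMap.isSelfAdjoint_def.1 hD] at h
  exact h x y

theorem exists_apply_eq_of_isSelfAdjoint (hD : IsSelfAdjoint D) {y w : H}
    (h : ∀ x : D.domain, ⟪w, (x : H)⟫_ℂ = ⟪y, D x⟫_ℂ) :
    ∃ hy : y ∈ D.domain, D ⟨y, hy⟩ = w := by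
  have hy : y ∈ D.adjoint.domain := LinearPMap.mem_adjoint_domain_of_exists _ ⟨w, h⟩
  have hw : D.adjoint ⟨y, hy⟩ = w := LinearPMap.adjoint_apply_eq hD.dense_domain ⟨y, hy⟩ h
  -- A general `E` allows substitution along `D.adjoint = D`, although membership in the domain
  -- occurs inside the statement.
  have hext : ∀ E : H →ₗ.[ℂ] H, E = D → ∀ hE : y ∈ E.domain, E ⟨y, hE⟩ = w →
      ∃ hy : y ∈ D.domain, D ⟨y, hy⟩ = w := by
    rintro E rfl hE hw
    exact ⟨hE, hw⟩
  exact hext _ (LinearPMap.isSelfAdjoint_def.1 hD) hy hw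

theorem HasBoundedCommutator.add {S T : H →L[ℂ] H} (hS : HasBoundedCommutator D S)
    (hT : HasBoundedCommutator D T) : HasBoundedCommutator D (S + T) := by
  obtain ⟨hS, C, hC⟩ := hS
  obtain ⟨hT, C', hC'⟩ := hT
  refine ⟨fun x => add_mem (hS x) (hT x), C + C', fun x => ?_⟩
  have : D ⟨(S + T) x, add_mem (hS x) (hT x)⟩ = D ⟨S x, hS x⟩ + D ⟨T x, hT x⟩ :=
    D.map_add ⟨S x, hS x⟩ ⟨T x, hT x⟩
  rw [this, add_apply, add_apply, ← hC, ← hC']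
  abel

theorem HasBoundedCommutator.algebraMap (r : ℂ) :
    HasBoundedCommutator D (algebraMap ℂ (H →L[ℂ] H) r) := by
  refine ⟨fun x => D.domain.smul_mem r x.2, 0, fun x => ?_⟩
  have : D ⟨r • (x : H), D.domain.smul_mem r x.2⟩ = r • D x := D.map_smul r x
  exact sub_eq_zero.2 this

theorem HasBoundedCommutator.mul {S T : H →L[ℂ] H} (hS : HasBoundedCommutator D S)
    (hT : HasBoundedCommutator D T) : HasBoundedCommutator D (S * T) := by
  obtain ⟨hS, C, hC⟩ := hS
  obtain ⟨hT, C', hC'⟩ := hT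
  refine ⟨fun x => hS ⟨T x, hT x⟩, C * T + S * C', fun x => ?_⟩
  have h := hC ⟨T x, hT x⟩
  have h' := hC' x
  rw [sub_eq_iff_eq_add] at h h'
  simp only [mul_apply_eq_comp, add_apply, h, h', map_add]
  abel

/-- The weak description of `Dom D` gives invariance under `T⋆`, with `[D, T⋆] = -[D, T]⋆`. Closure
under stars is needed because `ccAlgebra` is generated as a ⋆-algebra, and `(a δ_g)⋆` has
coefficient `α_{g⁻¹}(a⋆)`, possibly outside `𝒜`. -/
theorem hasBoundedCommutator_star (hD : IsSelfAdjoint D) {T : H →L[ℂ] H}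
    (hT : HasBoundedCommutator D T) : HasBoundedCommutator D (star T) := by
  obtain ⟨hT, C, hC⟩ := hT
  have key : ∀ y : D.domain, ∃ hy : star T y ∈ D.domain,
      D ⟨star T y, hy⟩ = star T (D y) - star C y := by
    intro y
    refine exists_apply_eq_of_isSelfAdjoint hD fun x => ?_
    rw [ContinuousLinearMap.star_eq_adjoint, ContinuousLinearMap.star_eq_adjoint, inner_sub_left,
      ContinuousLinearMap.adjoint_inner_left, ContinuousLinearMap.adjoint_inner_left,
      ContinuousLinearMap.adjoint_inner_left, ← hC, inner_sub_right, sub_sub_eq_add_sub]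
    have := symmetric_of_isSelfAdjoint hD y ⟨T x, hT x⟩
    rw [this]
    abel
  refine ⟨fun y => (key y).1, -star C, fun y => ?_⟩
  rw [(key y).2, neg_apply]
  abel

/-- The ⋆-algebra of bounded operators with bounded commutator with the self-adjoint `D`. -/
def commutatorAlgebra (D : H →ₗ.[ℂ] H) (hD : IsSelfAdjoint D) : StarSubalgebra ℂ (H →L[ℂ] H) where
  carrier := {T | HasBoundedCommutator D T}
  mul_mem' := HasBoundedCommutator.mul
  add_mem' := HasBoundedCommutator.add
  algebraMap_mem' := HasBoundedCommutator.algebraMap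
  star_mem' := hasBoundedCommutator_star hD

/-- Expanding and using symmetry, `‖x‖² = ‖y‖² + 2‖T y‖² + ‖T² y‖²`. The bound is uniform over the
fibres, which gives square summability in `exists_invSqrt_Dhat`. -/
theorem norm_apply_le_of_add_sq_eq {T : H →ₗ.[ℂ] H}
    (hs : ∀ x y : T.domain, ⟪T x, (y : H)⟫_ℂ = ⟪(x : H), T y⟫_ℂ) {x y : H} (h₁ : y ∈ T.domain)
    (h₂ : T ⟨y, h₁⟩ ∈ T.domain) (h : y + T ⟨T ⟨y, h₁⟩, h₂⟩ = x) : ‖T ⟨y, h₁⟩‖ ≤ ‖x‖ := by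
  have h3 : ⟪y, T ⟨T ⟨y, h₁⟩, h₂⟩⟫_ℂ = ((‖T ⟨y, h₁⟩‖ ^ 2 : ℝ) : ℂ) := by
    rw [← hs ⟨y, h₁⟩ ⟨T ⟨y, h₁⟩, h₂⟩, inner_self_eq_norm_sq_to_K]
    simp
  have h4 := norm_add_sq (𝕜 := ℂ) y (T ⟨T ⟨y, h₁⟩, h₂⟩)
  rw [h, h3, RCLike.re_eq_complex_re, Complex.ofReal_re] at h4
  refine le_of_sq_le_sq ?_ (norm_nonneg _)
  nlinarith [sq_nonneg ‖y‖, sq_nonneg ‖T ⟨T ⟨y, h₁⟩, h₂⟩‖, sq_nonneg ‖T ⟨y, h₁⟩‖]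

end SelfAdjoint

/-! ### Operators on `H ⊗ ℂ²` -/

section Double

variable {H : Type*} [NormedAddCommGroup H] [InnerProductSpace ℂ H]

theorem Dbl.ext {x y : Dbl H} (h₁ : x.fst = y.fst) (h₂ : x.snd = y.snd) : x = y :=
  WithLp.ofLp_injective 2 (Prod.ext h₁ h₂)

@[simp] theorem dsum_fst (T T' : H →L[ℂ] H) (x : Dbl H) : (dsum T T' x).fst = T x.fst := rfl
@[simp] theorem dsum_snd (T T' : H →L[ℂ] H) (x : Dbl H) : (dsum T T' x).snd = T' x.snd := rfl

/-- The operator `T ⊗ e₁₂ + T' ⊗ e₂₁` on `H ⊗ ℂ²`. -/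
def dswap (T T' : H →L[ℂ] H) : Dbl H →L[ℂ] Dbl H :=
  (WithLp.prodContinuousLinearEquiv 2 ℂ H H).symm.toContinuousLinearMap ∘L
    ((T ∘L ContinuousLinearMap.snd ℂ H H).prod (T' ∘L ContinuousLinearMap.fst ℂ H H)) ∘L
      (WithLp.prodContinuousLinearEquiv 2 ℂ H H).toContinuousLinearMap

@[simp] theorem dswap_fst (T T' : H →L[ℂ] H) (x : Dbl H) : (dswap T T' x).fst = T x.snd := rfl
@[simp] theorem dswap_snd (T T' : H →L[ℂ] H) (x : Dbl H) : (dswap T T' x).snd = T' x.fst := rfl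

theorem Dbl.norm_sq (x : Dbl H) : ‖x‖ ^ 2 = ‖x.fst‖ ^ 2 + ‖x.snd‖ ^ 2 :=
  WithLp.prod_norm_sq_eq_of_L2 x

theorem dsum_norm_le {T : H →L[ℂ] H} {C : ℝ} (hT : ‖T‖ ≤ C) : ‖dsum T T‖ ≤ C := by
  have hC := (norm_nonneg _).trans hT
  refine ContinuousLinearMap.opNorm_le_bound _ hC fun x => ?_
  refine le_of_sq_le_sq ?_ (by positivity)
  rw [mul_pow, Dbl.norm_sq, Dbl.norm_sq, dsum_fst, dsum_snd, mul_add, ← mul_pow, ← mul_pow]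
  gcongr <;> exact T.le_of_opNorm_le hT _

theorem Dbl.inner_eq (x y : Dbl H) : ⟪x, y⟫_ℂ = ⟪x.fst, y.fst⟫_ℂ + ⟪x.snd, y.snd⟫_ℂ := rfl

theorem star_dsum [CompleteSpace H] (T T' : H →L[ℂ] H) :
    star (dsum T T') = dsum (star T) (star T') := by
  symm
  simp only [ContinuousLinearMap.star_eq_adjoint]
  rw [ContinuousLinearMap.eq_adjoint_iff]
  intro x y
  simp [ContinuousLinearMap.adjoint_inner_left]

variable (H) in
/-- The ⋆-homomorphism `T ↦ T ⊗ 1` from operators on `H` to operators on `H ⊗ ℂ²`. -/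
def dsumHom [CompleteSpace H] : (H →L[ℂ] H) →⋆ₐ[ℂ] (Dbl H →L[ℂ] Dbl H) where
  toFun T := dsum T T
  map_one' := rfl
  map_mul' _ _ := rfl
  map_zero' := rfl
  map_add' _ _ := rfl
  commutes' _ := rfl
  map_star' T := (star_dsum T T).symm

end Double

/-! ### The Dirac operator -/

section Dirac

variable {H : Type*} [NormedAddCommGroup H] [InnerProductSpace ℂ H]
variable {G : Type*}

theorem fiberDirac_fst (D : H →ₗ.[ℂ] H) (t : ℝ) (x : (fiberDirac D t).domain) :
    (fiberDirac D t x).fst = D ⟨(x : Dbl H).snd, x.2.2⟩ - (Complex.I * t) • (x : Dbl H).snd := rfl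

theorem fiberDirac_snd (D : H →ₗ.[ℂ] H) (t : ℝ) (x : (fiberDirac D t).domain) :
    (fiberDirac D t x).snd = D ⟨(x : Dbl H).fst, x.2.1⟩ + (Complex.I * t) • (x : Dbl H).fst := rfl

theorem dense_fiberDirac_domain {D : H →ₗ.[ℂ] H} (hD : Dense (D.domain : Set H)) (t : ℝ) :
    Dense ((fiberDirac D t).domain : Set (Dbl H)) := by
  have h := hD.prod hD
  exact h.preimage (WithLp.prodContinuousLinearEquiv 2 ℂ H H).toHomeomorph.isOpenMap

theorem fiberDirac_symmetric {D : H →ₗ.[ℂ] H}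
    (hs : ∀ x y : D.domain, ⟪D x, (y : H)⟫_ℂ = ⟪(x : H), D y⟫_ℂ) (t : ℝ)
    (x y : (fiberDirac D t).domain) :
    ⟪fiberDirac D t x, (y : Dbl H)⟫_ℂ = ⟪(x : Dbl H), fiberDirac D t y⟫_ℂ := by
  rw [Dbl.inner_eq, Dbl.inner_eq, fiberDirac_fst, fiberDirac_fst, fiberDirac_snd, fiberDirac_snd]
  have h₁ : ⟪D ⟨(x : Dbl H).fst, x.2.1⟩, (y : Dbl H).snd⟫_ℂ =
      ⟪(x : Dbl H).fst, D ⟨(y : Dbl H).snd, y.2.2⟩⟫_ℂ :=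
    hs ⟨(x : Dbl H).fst, x.2.1⟩ ⟨(y : Dbl H).snd, y.2.2⟩
  have h₂ : ⟪D ⟨(x : Dbl H).snd, x.2.2⟩, (y : Dbl H).fst⟫_ℂ =
      ⟪(x : Dbl H).snd, D ⟨(y : Dbl H).fst, y.2.1⟩⟫_ℂ :=
    hs ⟨(x : Dbl H).snd, x.2.2⟩ ⟨(y : Dbl H).fst, y.2.1⟩
  simp only [inner_sub_left, inner_sub_right, inner_add_left, inner_add_right, inner_smul_left,
    inner_smul_right, h₁, h₂, map_mul, Complex.conj_I, Complex.conj_ofReal]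
  ring

/-- Test vectors `(x, 0)` and `(0, x)` decouple the weak equation into two weak equations for `D`,
with the scalar terms moved to the side of `w`. -/
theorem fiberDirac_maximal [CompleteSpace H] {D : H →ₗ.[ℂ] H} (hD : IsSelfAdjoint D) (t : ℝ)
    {y w : Dbl H} (h : ∀ x : (fiberDirac D t).domain, ⟪w, (x : Dbl H)⟫_ℂ = ⟪y, fiberDirac D t x⟫_ℂ) :
    ∃ hy : y ∈ (fiberDirac D t).domain, fiberDirac D t ⟨y, hy⟩ = w := by
  obtain ⟨h₁, e₁⟩ := exists_apply_eq_of_isSelfAdjoint hD (y := y.fst)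
    (w := w.snd - (Complex.I * t) • y.fst) fun x => by
      have : ⟪w.fst, (0 : H)⟫_ℂ + ⟪w.snd, (x : H)⟫_ℂ = ⟪y.fst, D x - (Complex.I * t) • (x : H)⟫_ℂ +
          ⟪y.snd, D ⟨(0 : H), zero_mem _⟩ + (Complex.I * t) • (0 : H)⟫_ℂ :=
        h ⟨WithLp.toLp 2 (0, (x : H)), zero_mem _, x.2⟩
      have h0 : D ⟨(0 : H), zero_mem _⟩ = 0 := D.map_zero
      simp only [inner_zero_right, zero_add, h0, smul_zero, add_zero, inner_sub_right,
        inner_smul_right] at this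
      rw [inner_sub_left, inner_smul_left, this]
      simp only [map_mul, Complex.conj_I, Complex.conj_ofReal]
      ring
  obtain ⟨h₂, e₂⟩ := exists_apply_eq_of_isSelfAdjoint hD (y := y.snd)
    (w := w.fst + (Complex.I * t) • y.snd) fun x => by
      have : ⟪w.fst, (x : H)⟫_ℂ + ⟪w.snd, (0 : H)⟫_ℂ =
          ⟪y.fst, D ⟨(0 : H), zero_mem _⟩ - (Complex.I * t) • (0 : H)⟫_ℂ +
            ⟪y.snd, D x + (Complex.I * t) • (x : H)⟫_ℂ :=
        h ⟨WithLp.toLp 2 ((x : H), 0), x.2, zero_mem _⟩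
      have h0 : D ⟨(0 : H), zero_mem _⟩ = 0 := D.map_zero
      simp only [inner_zero_right, add_zero, h0, smul_zero, sub_zero, zero_add, inner_add_right,
        inner_smul_right] at this
      rw [inner_add_left, inner_smul_left, this]
      simp only [map_mul, Complex.conj_I, Complex.conj_ofReal]
      ring
  refine ⟨⟨h₁, h₂⟩, Dbl.ext ?_ ?_⟩
  · rw [fiberDirac_fst]
    simp only [e₂]
    abel
  · rw [fiberDirac_snd]
    simp only [e₁]
    abel

/-! ### The Hilbert sum of the fibre operators: domain, self-adjointness, commutators. -/

theorem mem_Dhat_domain_apply {l : G → ℝ} {D : H →ₗ.[ℂ] H} {ψ : Hhat G H}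
    (h : ψ ∈ (Dhat l D).domain) (g : G) : ψ g ∈ (fiberDirac D (l g)).domain := h.choose g

theorem exists_Dhat_eq {l : G → ℝ} {D : H →ₗ.[ℂ] H} {ψ φ : Hhat G H}
    (h : ∀ g, ∃ hg : ψ g ∈ (fiberDirac D (l g)).domain, fiberDirac D (l g) ⟨ψ g, hg⟩ = φ g) :
    ∃ hψ : ψ ∈ (Dhat l D).domain, Dhat l D ⟨ψ, hψ⟩ = φ := by
  have hψ : ψ ∈ (Dhat l D).domain := by
    refine ⟨fun g => (h g).1, ?_⟩
    convert lp.memℓp φ using 1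
    exact funext fun g => (h g).2
  exact ⟨hψ, L2.ext fun g => (h g).2⟩

theorem exists_Dhat_deltaVec (l : G → ℝ) (D : H →ₗ.[ℂ] H) (g : G)
    (ζ : (fiberDirac D (l g)).domain) :
    ∃ h : deltaVec g (ζ : Dbl H) ∈ (Dhat l D).domain,
      Dhat l D ⟨deltaVec g (ζ : Dbl H), h⟩ = deltaVec g (fiberDirac D (l g) ζ) := by
  refine exists_Dhat_eq fun h => ?_
  by_cases hh : h = g
  · subst hh
    simp only [deltaVec_self]
    exact ⟨ζ.2, trivial⟩
  · simp only [deltaVec_ne hh]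
    exact ⟨zero_mem _, (fiberDirac D (l h)).map_zero⟩

theorem dense_Dhat_domain {D : H →ₗ.[ℂ] H} (hD : Dense (D.domain : Set H)) (l : G → ℝ) :
    Dense ((Dhat l D).domain : Set (Hhat G H)) := by
  intro ψ
  rw [← Submodule.topologicalClosure_coe]
  revert ψ
  refine L2.induction ?_ ?_ ?_ ?_
  · exact Submodule.isClosed_topologicalClosure (Dhat l D).domain
  · exact zero_mem (Dhat l D).domain.topologicalClosure
  · exact fun ψ φ hψ hφ => add_mem (S := Submodule ℂ (Hhat G H)) hψ hφ
  · intro g ζ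
    exact map_mem_closure (deltaL (Dbl H) g).continuous (dense_fiberDirac_domain hD (l g) ζ)
      fun z hz => (exists_Dhat_deltaVec l D g ⟨z, hz⟩).1

/-- Everything is fibrewise. Testing a weak solution against vectors `ζ ⊗ δ_g` shows `D_g (y g) = w
g`, so the square summability required for the domain is inherited from `w`. -/
theorem isSelfAdjoint_Dhat [CompleteSpace H] {D : H →ₗ.[ℂ] H} (hD : IsSelfAdjoint D) (l : G → ℝ) :
    IsSelfAdjoint (Dhat l D) := by
  refine isSelfAdjoint_of_symmetric_of_maximal (dense_Dhat_domain hD.dense_domain l)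
    (fun x y => ?_) (fun y w h => ?_)
  · rw [lp.inner_eq_tsum, lp.inner_eq_tsum]
    exact tsum_congr fun g => fiberDirac_symmetric (symmetric_of_isSelfAdjoint hD) (l g)
      ⟨_, mem_Dhat_domain_apply x.2 g⟩ ⟨_, mem_Dhat_domain_apply y.2 g⟩
  · refine (exists_Dhat_eq (φ := w) fun g => fiberDirac_maximal hD (l g) fun x => ?_).1
    obtain ⟨hx, ex⟩ := exists_Dhat_deltaVec l D g x
    have := h ⟨_, hx⟩
    rw [ex] at this
    rw [← inner_conj_symm, ← inner_conj_symm y] at this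
    simp only [inner_deltaVec_left] at this
    rwa [inner_conj_symm, inner_conj_symm] at this

theorem hasBoundedCommutator_tens [Group G] {l : G → ℝ} (hl : IsDiracWeight l) {D : H →ₗ.[ℂ] H}
    {S : H →L[ℂ] H} (hS : HasBoundedCommutator D S) (g : G) :
    HasBoundedCommutator (Dhat l D) (tens (dsum S S) g) := by
  obtain ⟨hS, C, hC⟩ := hS
  obtain ⟨M, hM⟩ := hl g
  -- The block operator is `S ⊗ σ₂`; the scalar is the difference of weights that appears when `M_l`
  -- passes the translation by `g`.
  let T : G → Dbl H →L[ℂ] Dbl H := fun h =>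
    ((l h - l (g⁻¹ * h) : ℝ) : ℂ) • dswap ((-Complex.I) • S) (Complex.I • S)
  have hT : ∃ C : ℝ, ∀ h, ‖T h‖ ≤ C := ⟨M * ‖dswap ((-Complex.I) • S) (Complex.I • S)‖, fun h => by
    have hM0 : 0 ≤ M := (abs_nonneg _).trans (hM h)
    refine ContinuousLinearMap.opNorm_le_bound _ (by positivity) fun x => ?_
    rw [smul_apply, norm_smul, Complex.norm_real, mul_assoc]
    exact mul_le_mul (hM h) (ContinuousLinearMap.le_opNorm _ _) (norm_nonneg _) hM0⟩
  let E : Hhat G H →L[ℂ] Hhat G H := tens (dswap C C) g + diagOp T hT ∘L translate (Dbl H) g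
  have key : ∀ ψ : (Dhat l D).domain, ∃ h : tens (dsum S S) g (ψ : Hhat G H) ∈ (Dhat l D).domain,
      Dhat l D ⟨tens (dsum S S) g (ψ : Hhat G H), h⟩ =
        tens (dsum S S) g (Dhat l D ψ) + E ψ := by
    intro ψ
    refine exists_Dhat_eq fun h => ?_
    have hx := mem_Dhat_domain_apply ψ.2 (g⁻¹ * h)
    refine ⟨⟨hS ⟨_, hx.1⟩, hS ⟨_, hx.2⟩⟩, ?_⟩
    have hx₁ : ((ψ : Hhat G H) (g⁻¹ * h)).fst ∈ D.domain := hx.1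
    have hx₂ : ((ψ : Hhat G H) (g⁻¹ * h)).snd ∈ D.domain := hx.2
    have h₁ := hC ⟨_, hx₁⟩
    have h₂ := hC ⟨_, hx₂⟩
    rw [sub_eq_iff_eq_add] at h₁ h₂
    have hE : (tens (dsum S S) g (Dhat l D ψ) + E ψ) h = dsum S S (fiberDirac D (l (g⁻¹ * h))
        ⟨(ψ : Hhat G H) (g⁻¹ * h), hx⟩) + (dswap C C ((ψ : Hhat G H) (g⁻¹ * h)) +
          T h ((ψ : Hhat G H) (g⁻¹ * h))) := rfl
    rw [hE]
    refine Dbl.ext ?_ ?_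
    · rw [fiberDirac_fst]
      refine (congrArg₂ _ h₂ rfl).trans ?_
      simp only [T, tens_apply, WithLp.add_fst, dsum_fst, dswap_fst, fiberDirac_fst, smul_apply,
        WithLp.smul_fst, map_sub, map_smul, dsum_snd, smul_smul, Complex.ofReal_sub]
      module
    · rw [fiberDirac_snd]
      refine (congrArg₂ _ h₁ rfl).trans ?_
      simp only [T, tens_apply, WithLp.add_snd, dsum_fst, dswap_snd, fiberDirac_snd, smul_apply,
        WithLp.smul_snd, map_add, map_smul, dsum_snd, smul_smul, Complex.ofReal_sub]
      module
  refine ⟨fun ψ => (key ψ).1, E, fun ψ => ?_⟩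
  rw [(key ψ).2]
  abel

/-- Convergence in the graph norm: the finitely supported vectors of the domain form a core. -/
theorem hasSum_Dhat {l : G → ℝ} {D : H →ₗ.[ℂ] H} (ψ : (Dhat l D).domain) :
    HasSum (fun g => ((deltaVec g ((ψ : Hhat G H) g), deltaVec g (Dhat l D ψ g)) :
      Hhat G H × Hhat G H)) ((ψ : Hhat G H), Dhat l D ψ) :=
  (hasSum_deltaVec _).prodMk (hasSum_deltaVec _)

end Dirac

/-! ### The resolvent of the Dirac operator -/

section Resolvent

variable {H : Type*} [NormedAddCommGroup H] [InnerProductSpace ℂ H] [CompleteSpace H]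

/-- The function `x ↦ (1 + t² x²)^(-1/2)`. -/
def invSqrtFun (t x : ℝ) : ℝ := (Real.sqrt (1 + t ^ 2 * x ^ 2))⁻¹

theorem sqrt_one_add_pos (t x : ℝ) : 0 < Real.sqrt (1 + t ^ 2 * x ^ 2) :=
  Real.sqrt_pos.2 (by positivity)

theorem invSqrtFun_pos (t x : ℝ) : 0 < invSqrtFun t x := inv_pos.2 (sqrt_one_add_pos t x)

theorem invSqrtFun_mul_self (t x : ℝ) :
    invSqrtFun t x * invSqrtFun t x = (1 + t ^ 2 * x ^ 2)⁻¹ := by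
  rw [invSqrtFun, ← mul_inv, Real.mul_self_sqrt (by positivity)]

theorem invSqrtFun_le_one (t x : ℝ) : invSqrtFun t x ≤ 1 := by
  refine inv_le_one_of_one_le₀ (Real.one_le_sqrt.2 ?_)
  nlinarith [mul_nonneg (sq_nonneg t) (sq_nonneg x)]

theorem abs_mul_invSqrtFun_le (t x : ℝ) : |t| * |x * invSqrtFun t x| ≤ 1 := by
  rw [← abs_mul, ← mul_assoc, abs_mul, abs_of_pos (invSqrtFun_pos t x), invSqrtFun,
    mul_inv_le_iff₀ (sqrt_one_add_pos t x), one_mul]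
  refine Real.le_sqrt_of_sq_le ?_
  rw [sq_abs, mul_pow]
  linarith

theorem continuous_invSqrtFun (t : ℝ) : Continuous (invSqrtFun t) :=
  Continuous.inv₀ (by fun_prop) fun x => (sqrt_one_add_pos t x).ne'

/-- From `(1 + D²)^(-1/2)` one obtains `(1 + t² + D²)^(-1/2)`. -/
theorem exists_invSqrt_add_sq {D : H →ₗ.[ℂ] H} {R : H →L[ℂ] H} (hR : IsInvSqrtOneAddSq D R)
    (hc : IsCompactOperator R) (t : ℝ) :
    ∃ S : H →L[ℂ] H, S.IsPositive ∧ IsCompactOperator S ∧ ‖S‖ ≤ ‖R‖ ∧ |t| * ‖S‖ ≤ 1 ∧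
      ∀ x : H, ∃ h₁ : S (S x) ∈ D.domain, ∃ h₂ : D ⟨S (S x), h₁⟩ ∈ D.domain,
        S (S x) + D ⟨D ⟨S (S x), h₁⟩, h₂⟩ + ((t : ℂ) ^ 2) • S (S x) = x := by
  obtain ⟨hpos, hinv⟩ := hR
  have h0 : 0 ≤ R := (ContinuousLinearMap.nonneg_iff_isPositive R).2 hpos
  have hsa : IsSelfAdjoint R := hpos.isSelfAdjoint
  have hw : ContinuousOn (invSqrtFun t) (spectrum ℝ R) := (continuous_invSqrtFun t).continuousOn
  have hid : ContinuousOn (fun x : ℝ => x) (spectrum ℝ R) := continuousOn_id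
  -- Since `R² = (1 + D²)⁻¹`, one has `(1 + t² + D²)⁻¹ = R² (1 + t² R²)⁻¹`. Thus `W = (1 + t²
  -- R²)^(-1/2)` and the required root is `R W`, compact because `R` is.
  set W := cfc (invSqrtFun t) R with hW
  have hS : cfc (fun x => x * invSqrtFun t x) R = R * W := by
    rw [cfc_mul (fun x => x) (invSqrtFun t) R hid hw, cfc_id' ℝ R]
  have hWR : R * W = W * R := by
    rw [← hS, show (fun x => x * invSqrtFun t x) = fun x => invSqrtFun t x * x from
      funext fun x => mul_comm _ _, cfc_mul (invSqrtFun t) (fun x => x) R hw hid, cfc_id' ℝ R]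
  have hRR : cfc (fun x : ℝ => x * x) R = R * R := by
    rw [cfc_mul (fun x => x) (fun x => x) R hid hid, cfc_id' ℝ R]
  have hWW : cfc (fun x => invSqrtFun t x * invSqrtFun t x) R = W * W :=
    cfc_mul (invSqrtFun t) (invSqrtFun t) R hw hw
  have hone : W * W + (t ^ 2 : ℝ) • (R * R * (W * W)) = 1 := by
    rw [← hRR, ← hWW, ← cfc_mul (fun x : ℝ => x * x)
        (fun x => invSqrtFun t x * invSqrtFun t x) R (hid.mul hid) (hw.mul hw),
      ← cfc_const_mul (t ^ 2) (fun x => x * x * (invSqrtFun t x * invSqrtFun t x)) R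
        ((hid.mul hid).mul (hw.mul hw)),
      ← cfc_add R (fun x => invSqrtFun t x * invSqrtFun t x)
        (fun x => t ^ 2 * (x * x * (invSqrtFun t x * invSqrtFun t x))) (hw.mul hw)
        (((hid.mul hid).mul (hw.mul hw)).const_mul _ ), ← cfc_const_one ℝ R]
    refine cfc_congr fun x _ => ?_
    simp only [invSqrtFun_mul_self]
    have : 1 + t ^ 2 * x ^ 2 ≠ 0 := by positivity
    field_simp
  have hSS : ∀ x, (R * W) ((R * W) x) = R (R ((W * W) x)) := fun x => by
    have : R * W * (R * W) = R * R * (W * W) := by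
      rw [mul_assoc, ← mul_assoc W, ← hWR]
      simp only [mul_assoc]
    exact DFunLike.congr_fun this x
  refine ⟨R * W, ?_, hc.comp_clm W, ?_, ?_, fun x => ?_⟩
  · rw [← ContinuousLinearMap.nonneg_iff_isPositive, ← hS]
    exact cfc_nonneg fun x hx =>
      mul_nonneg (spectrum_nonneg_of_nonneg h0 hx) (invSqrtFun_pos t x).le
  · refine (norm_mul_le R W).trans (mul_le_of_le_one_right (norm_nonneg _) ?_)
    refine norm_cfc_le zero_le_one fun x _ => ?_
    rw [Real.norm_of_nonneg (invSqrtFun_pos t x).le]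
    exact invSqrtFun_le_one t x
  · rcases eq_or_ne t 0 with rfl | ht
    · simp
    · rw [mul_comm, ← le_div_iff₀ (abs_pos.2 ht), ← hS]
      refine norm_cfc_le (by positivity) fun x _ => ?_
      rw [le_div_iff₀ (abs_pos.2 ht), mul_comm]
      exact abs_mul_invSqrtFun_le t x
  -- At `W² x` the hypothesis reads `(1 + D²) R² W² x = W² x`; adding `t² R² W² x` gives `x` by
  -- `hone`.
  · obtain ⟨h₁, h₂, h⟩ := hinv ((W * W) x)
    simp only [hSS]
    refine ⟨h₁, h₂, ?_⟩
    rw [h]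
    have := DFunLike.congr_fun hone x
    rw [add_apply, smul_apply, one_apply_eq_self] at this
    convert this using 2
    rw [← Complex.coe_smul, Complex.ofReal_pow]
    rfl

theorem dsum_isPositive {T : H →L[ℂ] H} (hT : T.IsPositive) : (dsum T T).IsPositive := by
  refine ContinuousLinearMap.isPositive_def'.2 ⟨?_, fun x => ?_⟩
  · exact (star_dsum T T).trans (by rw [hT.isSelfAdjoint.star_eq])
  · rw [ContinuousLinearMap.reApplyInnerSelf_apply, Dbl.inner_eq, map_add]
    exact add_nonneg (hT.re_inner_nonneg_left _) (hT.re_inner_nonneg_left _)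

theorem dsum_isCompactOperator {T : H →L[ℂ] H} (hT : IsCompactOperator T) :
    IsCompactOperator (dsum T T) := by
  let e := WithLp.prodContinuousLinearEquiv 2 ℂ H H
  let F : Dbl H →L[ℂ] H := ContinuousLinearMap.fst ℂ H H ∘L e.toContinuousLinearMap
  let S : Dbl H →L[ℂ] H := ContinuousLinearMap.snd ℂ H H ∘L e.toContinuousLinearMap
  let I : H →L[ℂ] Dbl H := e.symm.toContinuousLinearMap ∘L ContinuousLinearMap.inl ℂ H H
  let J : H →L[ℂ] Dbl H := e.symm.toContinuousLinearMap ∘L ContinuousLinearMap.inr ℂ H H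
  have h := ((hT.comp_clm F).clm_comp I).add ((hT.comp_clm S).clm_comp J)
  have heq : (dsum T T : Dbl H → Dbl H) = I ∘ T ∘ F + J ∘ T ∘ S := by
    funext x
    refine Dbl.ext ?_ ?_
    · exact (add_zero _).symm
    · exact (zero_add _).symm
  rw [heq]
  exact h

/-- The cross terms of the squared fibre operator cancel, leaving `D² + t²` on each summand; the
scalar equation for `S` is applied to both components. -/
theorem fiberDirac_invSqrt {D : H →ₗ.[ℂ] H} {S : H →L[ℂ] H} {t : ℝ}
    (hS : ∀ x : H, ∃ h₁ : S (S x) ∈ D.domain, ∃ h₂ : D ⟨S (S x), h₁⟩ ∈ D.domain,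
        S (S x) + D ⟨D ⟨S (S x), h₁⟩, h₂⟩ + ((t : ℂ) ^ 2) • S (S x) = x) (x : Dbl H) :
    ∃ h₁ : dsum S S (dsum S S x) ∈ (fiberDirac D t).domain,
      ∃ h₂ : fiberDirac D t ⟨dsum S S (dsum S S x), h₁⟩ ∈ (fiberDirac D t).domain,
        dsum S S (dsum S S x) +
          fiberDirac D t ⟨fiberDirac D t ⟨dsum S S (dsum S S x), h₁⟩, h₂⟩ = x := by
  obtain ⟨a₁, a₂, ha⟩ := hS x.fst
  obtain ⟨b₁, b₂, hb⟩ := hS x.snd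
  have k₁ : D ⟨S (S x.snd), b₁⟩ - (Complex.I * t) • S (S x.snd) ∈ D.domain :=
    sub_mem b₂ (D.domain.smul_mem _ b₁)
  have k₂ : D ⟨S (S x.fst), a₁⟩ + (Complex.I * t) • S (S x.fst) ∈ D.domain :=
    add_mem a₂ (D.domain.smul_mem _ a₁)
  have e₁ : D ⟨_, k₁⟩ = D ⟨_, b₂⟩ - (Complex.I * t) • D ⟨_, b₁⟩ := by
    rw [← D.map_smul, ← D.map_sub]
    rfl
  have e₂ : D ⟨_, k₂⟩ = D ⟨_, a₂⟩ + (Complex.I * t) • D ⟨_, a₁⟩ := by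
    rw [← D.map_smul, ← D.map_add]
    rfl
  refine ⟨⟨a₁, b₁⟩, ⟨k₁, k₂⟩, Dbl.ext ?_ ?_⟩
  · have hI : (Complex.I * t) * (Complex.I * t) = -(t : ℂ) ^ 2 := by
      rw [mul_mul_mul_comm, Complex.I_mul_I]; ring
    change S (S x.fst) + (D ⟨_, k₂⟩ - (Complex.I * t) •
      (D ⟨S (S x.fst), a₁⟩ + (Complex.I * t) • S (S x.fst))) = x.fst
    rw [e₂, smul_add, smul_smul, hI]
    refine Eq.trans ?_ ha
    module
  · have hI : (Complex.I * t) * (Complex.I * t) = -(t : ℂ) ^ 2 := by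
      rw [mul_mul_mul_comm, Complex.I_mul_I]; ring
    change S (S x.snd) + (D ⟨_, k₁⟩ + (Complex.I * t) •
      (D ⟨S (S x.snd), b₁⟩ - (Complex.I * t) • S (S x.snd))) = x.snd
    rw [e₁, smul_sub, smul_smul, hI]
    refine Eq.trans ?_ hb
    module

variable {G : Type*}
variable {X : Type*} [NormedAddCommGroup X] [InnerProductSpace ℂ X] [CompleteSpace X]

theorem diagOp_isPositive (T : G → X →L[ℂ] X) (hT : ∃ C : ℝ, ∀ g, ‖T g‖ ≤ C)
    (hpos : ∀ g, (T g).IsPositive) : (diagOp T hT).IsPositive := by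
  refine ContinuousLinearMap.isPositive_def'.2 ⟨?_, fun ψ => ?_⟩
  · have h : ∀ g, ContinuousLinearMap.adjoint (T g) = T g := fun g =>
      (hpos g).isSelfAdjoint.adjoint_eq
    refine (adjoint_diagOp T hT (by simpa only [h] using hT)).trans ?_
    ext ψ : 1
    exact L2.ext fun g => DFunLike.congr_fun (h g) (ψ g)
  · rw [ContinuousLinearMap.reApplyInnerSelf_apply]
    have h := (lp.hasSum_inner (𝕜 := ℂ) (diagOp T hT ψ) ψ).mapL Complex.reCLM
    exact h.nonneg fun g => (hpos g).re_inner_nonneg_left _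

/-- Truncations to finite sets of indices are compact and converge in norm, the error being the
supremum of the omitted `‖T g‖`. -/
theorem diagOp_isCompactOperator (T : G → X →L[ℂ] X) (hT : ∃ C : ℝ, ∀ g, ‖T g‖ ≤ C)
    (hc : ∀ g, IsCompactOperator (T g)) (h0 : ∀ ε > 0, {g | ε < ‖T g‖}.Finite) :
    IsCompactOperator (diagOp T hT) := by
  classical
  let P : Finset G → (L2 G X →L[ℂ] L2 G X) := fun F => ∑ g ∈ F, deltaL X g ∘L T g ∘L evalL G X g
  have hP : ∀ F, IsCompactOperator (P F) := by
    intro F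
    refine Submodule.sum_mem (compactOperator (RingHom.id ℂ) (L2 G X) (L2 G X)) fun g _ => ?_
    exact ((hc g).comp_clm (evalL G X g)).clm_comp (deltaL X g)
  refine isCompactOperator_of_tendsto (l := Filter.atTop) (F := P) ?_
    (Filter.Eventually.of_forall hP)
  rw [Metric.tendsto_atTop]
  intro ε hε
  refine ⟨(h0 (ε / 2) (by positivity)).toFinset, fun F hF => ?_⟩
  rw [dist_comm, dist_eq_norm]
  refine lt_of_le_of_lt ?_ (half_lt_self hε)
  refine ContinuousLinearMap.opNorm_le_bound _ (by positivity) fun ψ =>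
    L2.norm_le_of_forall_le (by positivity) fun g => ?_
  have hPg : P F ψ g = if g ∈ F then T g (ψ g) else 0 := by
    rw [← sum_deltaVec_apply F fun g => T g (ψ g)]
    simp only [P, sum_apply]
    rfl
  rw [sub_apply, lp.coeFn_sub, Pi.sub_apply, hPg, diagOp_apply]
  split_ifs with hg
  · rw [sub_self, norm_zero]; positivity
  · rw [sub_zero]
    refine (T g).le_of_opNorm_le (not_lt.1 fun hlt => hg (hF ?_)) _
    exact (Set.Finite.mem_toFinset _).2 hlt

theorem exists_invSqrt_Dhat {l : G → ℝ} (hl : IsProperWeight l) {D : H →ₗ.[ℂ] H}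
    (hD : IsSelfAdjoint D)
    (hR : ∃ R : H →L[ℂ] H, IsInvSqrtOneAddSq D R ∧ IsCompactOperator R) :
    ∃ R : Hhat G H →L[ℂ] Hhat G H, IsInvSqrtOneAddSq (Dhat l D) R ∧ IsCompactOperator R := by
  obtain ⟨R, hR, hRc⟩ := hR
  choose S hpos hc hle hnorm hinv using fun g => exists_invSqrt_add_sq hR hRc (l g)
  have hb : ∃ C : ℝ, ∀ g, ‖dsum (S g) (S g)‖ ≤ C := ⟨‖R‖, fun g => dsum_norm_le (hle g)⟩
  refine ⟨diagOp (fun g => dsum (S g) (S g)) hb, ⟨?_, fun ψ => ?_⟩, ?_⟩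
  · exact diagOp_isPositive _ _ fun g => dsum_isPositive (hpos g)
  · choose h₁ h₂ h using fun g => fiberDirac_invSqrt (hinv g) (ψ g)
    -- The fibres of `D̂ R² ψ` are dominated by those of `ψ`, so `R² ψ` lies in the domain of `D̂`.
    -- Applying `D̂` again gives `ψ - R² ψ`, which is square summable without further estimates.
    have hmem : Memℓp (fun g => fiberDirac D (l g) ⟨_, h₁ g⟩) 2 := by
      refine memℓp_two_of_le (C := 1) (φ := ψ) fun g => ?_
      rw [one_mul]
      exact norm_apply_le_of_add_sq_eq (fiberDirac_symmetric (symmetric_of_isSelfAdjoint hD) (l g))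
        (h₁ g) (h₂ g) (h g)
    obtain ⟨k₁, e₁⟩ := exists_Dhat_eq (l := l) (D := D)
      (ψ := diagOp (fun g => dsum (S g) (S g)) hb (diagOp (fun g => dsum (S g) (S g)) hb ψ))
      (φ := ⟨_, hmem⟩) fun g => ⟨h₁ g, rfl⟩
    obtain ⟨k₂, e₂⟩ := exists_Dhat_eq (l := l) (D := D) (ψ := ⟨_, hmem⟩)
      (φ := ψ - diagOp (fun g => dsum (S g) (S g)) hb (diagOp (fun g => dsum (S g) (S g)) hb ψ))
      fun g => ⟨h₂ g, eq_sub_of_add_eq' (h g)⟩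
    have k₂' := k₂
    rw [← e₁] at k₂'
    refine ⟨k₁, k₂', ?_⟩
    simp only [e₁, e₂]
    abel
  · refine diagOp_isCompactOperator _ _ (fun g => dsum_isCompactOperator (hc g)) fun ε hε => ?_
    -- From `|l g| * ‖S g‖ ≤ 1`, a norm above `ε` forces `|l g| ≤ 1/ε < n`, a finite set of `g` by
    -- properness.
    obtain ⟨n, hn⟩ := exists_nat_gt (1 / ε)
    refine (hl n).subset fun g hg => ?_
    have hg' : ε < ‖S g‖ := lt_of_lt_of_le hg (dsum_norm_le le_rfl)
    refine abs_le.1 ?_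
    refine le_trans ?_ hn.le
    rw [le_div_iff₀ hε]
    exact (mul_le_mul_of_nonneg_left hg'.le (abs_nonneg _)).trans (hnorm g)

end Resolvent

/-! ### The spectral triple on the crossed product -/

section Triple

variable {A : Type*} [CStarAlgebra A] {G : Type*} [Group G]
variable {H K X : Type*} [NormedAddCommGroup H] [InnerProductSpace ℂ H] [CompleteSpace H]
  [NormedAddCommGroup K] [InnerProductSpace ℂ K] [CompleteSpace K]
  [NormedAddCommGroup X] [InnerProductSpace ℂ X] [CompleteSpace X]
variable {α : G →* (A ≃⋆ₐ[ℂ] A)} {ρ : A →⋆ₐ[ℂ] (K →L[ℂ] K)}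

theorem pi2Hat_mul_gammaHat (π : A →⋆ₐ[ℂ] (H →L[ℂ] H)) (u : G →* unitary (H →L[ℂ] H)) (a : A)
    (g : G) : pi2Hat G π a * gammaHat u g =
      tens (dsum (π a * (u g : H →L[ℂ] H)) (π a * (u g : H →L[ℂ] H))) g := rfl

theorem star_coe_unitary (u : G →* unitary (H →L[ℂ] H)) (g : G) :
    star (u g : H →L[ℂ] H) = (u g⁻¹ : H →L[ℂ] H) := by
  rw [map_inv]
  rfl

theorem coe_unitary_mul (u : G →* unitary (H →L[ℂ] H)) (g h : G) :
    (u g : H →L[ℂ] H) * (u h : H →L[ℂ] H) = (u (g * h) : H →L[ℂ] H) := by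
  rw [map_mul]
  rfl

theorem map_dsumHom_mem (w : unitary (H →L[ℂ] H)) :
    dsumHom H (w : H →L[ℂ] H) ∈ unitary (Dbl H →L[ℂ] Dbl H) := by
  rw [Unitary.mem_iff, ← map_star, ← map_mul, ← map_mul, Unitary.star_mul_self_of_mem w.2,
    Unitary.mul_star_self_of_mem w.2, map_one]
  exact ⟨rfl, rfl⟩

/-- The regular representation of the doubled `π` is conjugated by the diagonal unitary with entries
`u_h`, which moves the twist by `α` from the `π`-part into the translations. -/
theorem exists_covariant_hom (hρ : Function.Injective ρ) (π : A →⋆ₐ[ℂ] (H →L[ℂ] H))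
    (u : G →* unitary (H →L[ℂ] H)) (hcov : ∀ (g : G) (a : A),
      π (α g a) = (u g : H →L[ℂ] H) * π a * star (u g : H →L[ℂ] H)) :
    ∃ σ : crossed α ρ →⋆ₐ[ℂ] (Hhat G H →L[ℂ] Hhat G H),
      ∀ (a : A) (g : G), σ (crossedElem α ρ a g) = pi2Hat G π a * gammaHat u g := by
  obtain ⟨φ, hφ⟩ := exists_crossed_hom α ρ hρ ((dsumHom H).comp π)
  let v : G → unitary (Dbl H →L[ℂ] Dbl H) := fun g =>
    ⟨dsumHom H (u g : H →L[ℂ] H), map_dsumHom_mem (u g)⟩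
  let V : Hhat G H ≃ₗᵢ[ℂ] Hhat G H := diagEquiv fun g => Unitary.linearIsometryEquiv (v g)
  refine ⟨(conjHom V).comp φ, fun a g => ?_⟩
  rw [StarAlgHom.comp_apply, hφ, pi2Hat_mul_gammaHat]
  ext ψ : 1
  refine L2.ext fun h => ?_
  -- Covariance writes `π(α_{h⁻¹}(a))` as `u_h⋆ π(a) u_h`; what remains is `u_h u_{g⁻¹h}⋆ = u_g`.
  have key : (u h : H →L[ℂ] H) * π (α h⁻¹ a) * star (u (g⁻¹ * h) : H →L[ℂ] H) =
      π a * (u g : H →L[ℂ] H) := by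
    rw [hcov, star_coe_unitary, star_coe_unitary, inv_inv, ← mul_assoc, ← mul_assoc,
      coe_unitary_mul, mul_assoc, coe_unitary_mul, mul_inv_cancel, map_one]
    simp
  have hL : conjHom V (crossedOp α ((dsumHom H).comp π) a g) ψ h =
      dsum ((u h : H →L[ℂ] H) * π (α h⁻¹ a) * star (u (g⁻¹ * h) : H →L[ℂ] H))
        ((u h : H →L[ℂ] H) * π (α h⁻¹ a) * star (u (g⁻¹ * h) : H →L[ℂ] H)) (ψ (g⁻¹ * h)) := by
    change dsumHom H (u h : H →L[ℂ] H) (dsumHom H (π (α h⁻¹ a))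
      (star (dsumHom H (u (g⁻¹ * h) : H →L[ℂ] H)) (ψ (g⁻¹ * h)))) = _
    rw [← map_star]
    rfl
  rw [hL, key, tens_apply]

theorem commute_of_crossedElem (φ : crossed α ρ →⋆ₐ[ℂ] (X →L[ℂ] X)) (c : X →L[ℂ] X)
    (h : ∀ a g, φ (crossedElem α ρ a g) * c = c * φ (crossedElem α ρ a g)) (b : crossed α ρ) :
    φ b * c = c * φ b := by
  have : (ContinuousLinearMap.mul ℂ (X →L[ℂ] X)).flip c ∘L starHomL φ =
      ContinuousLinearMap.mul ℂ (X →L[ℂ] X) c ∘L starHomL φ := crossed_hom_ext h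
  exact DFunLike.congr_fun this b

theorem continuous_crossedElem (g : G) : Continuous fun a => crossedElem α ρ a g := by
  let F : A →ₗ[ℂ] (L2 G K →L[ℂ] L2 G K) :=
    { toFun := fun a => crossedOp α ρ a g
      map_add' := fun a b => by ext ψ : 1; exact L2.ext fun k => by simp
      map_smul' := fun c a => by ext ψ : 1; exact L2.ext fun k => by simp }
  have hF : Continuous F := AddMonoidHomClass.continuous_of_bound F 1 fun a => by
    rw [one_mul]
    refine ContinuousLinearMap.opNorm_le_bound _ (norm_nonneg _) fun ψ => ?_
    have h₁ : ‖regA α ρ a (translate K g ψ)‖ ≤ ‖a‖ * ‖translate K g ψ‖ :=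
      L2.norm_le_of_forall_le (norm_nonneg _) fun h => (ρ (α h⁻¹ a)).le_of_opNorm_le
        ((NonUnitalStarAlgHom.norm_apply_le ρ _).trans
          (NonUnitalStarAlgHom.norm_apply_le (α h⁻¹) a)) _
    refine h₁.trans (mul_le_mul_of_nonneg_left ?_ (norm_nonneg _))
    refine le_of_sq_le_sq (le_of_eq ?_) (norm_nonneg _)
    rw [L2.norm_sq, L2.norm_sq]
    exact (Equiv.mulLeft g⁻¹).tsum_eq fun h => ‖ψ h‖ ^ 2
  exact hF.subtype_mk _

/-! ### The dense ⋆-algebra generated by `C_c(G, 𝒜)`. -/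

theorem ccAlgebra_le {𝒜 : StarSubalgebra ℂ A} {S : StarSubalgebra ℂ (crossed α ρ)}
    (h : ∀ a ∈ 𝒜, ∀ g : G, crossedElem α ρ a g ∈ S) : ccAlgebra α ρ 𝒜 ≤ S := by
  refine StarAlgebra.adjoin_le ?_
  have hspan : ccSpace α ρ 𝒜 ≤ Subalgebra.toSubmodule S.toSubalgebra := by
    refine Submodule.span_le.2 ?_
    rintro _ ⟨a, ha, g, rfl⟩
    exact h a ha g
  exact hspan

theorem dense_ccAlgebra {𝒜 : StarSubalgebra ℂ A} (h𝒜 : Dense (𝒜 : Set A)) :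
    Dense (ccAlgebra α ρ 𝒜 : Set (crossed α ρ)) := by
  let M := Subalgebra.toSubmodule (ccAlgebra α ρ 𝒜).toSubalgebra
  have hle : Submodule.span ℂ (Set.range fun p : A × G => crossedElem α ρ p.1 p.2) ≤
      M.topologicalClosure := by
    refine Submodule.span_le.2 ?_
    rintro _ ⟨⟨a, g⟩, rfl⟩
    have h : crossedElem α ρ a g ∈ closure (ccAlgebra α ρ 𝒜 : Set (crossed α ρ)) :=
      map_mem_closure (f := fun b => crossedElem α ρ b g) (continuous_crossedElem g) (h𝒜 a)
        fun b hb => StarAlgebra.subset_adjoin ℂ _ (Submodule.subset_span ⟨b, hb, g, rfl⟩)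
    exact h
  intro b
  exact closure_minimal hle (Submodule.isClosed_topologicalClosure M)
    (dense_span_crossedElem α ρ b)

theorem ccAlgebra_eq_ccSpace {𝒜 : StarSubalgebra ℂ A} (h : ∀ g, ∀ a ∈ 𝒜, α g a ∈ 𝒜) :
    (ccAlgebra α ρ 𝒜 : Set (crossed α ρ)) = ccSpace α ρ 𝒜 := by
  refine subset_antisymm ?_ (StarAlgebra.subset_adjoin ℂ _)
  have hspan := adjoin_toSubmodule_eq_span (s := {x | ∃ a ∈ 𝒜, ∃ g : G, x = crossedElem α ρ a g})
    (Submodule.subset_span ⟨1, one_mem _, 1, Subtype.ext (crossedOp_one α ρ).symm⟩)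
    (by
      rintro _ ⟨a, ha, g, rfl⟩ _ ⟨b, hb, k, rfl⟩
      exact Submodule.subset_span ⟨a * α g b, mul_mem ha (h g b hb), g * k,
        Subtype.ext (crossedOp_mul α ρ a b g k)⟩)
    (by
      rintro _ ⟨a, ha, g, rfl⟩
      exact Submodule.subset_span ⟨α g⁻¹ (star a), h _ _ (star_mem ha), g⁻¹,
        Subtype.ext (star_crossedOp α ρ a g)⟩)
  intro x hx
  have hle : ccAlgebra α ρ 𝒜 ≤
      StarAlgebra.adjoin ℂ {x | ∃ a ∈ 𝒜, ∃ g : G, x = crossedElem α ρ a g} :=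
    ccAlgebra_le fun a ha g => StarAlgebra.subset_adjoin ℂ _ ⟨a, ha, g, rfl⟩
  have hx' : x ∈ Subalgebra.toSubmodule (StarAlgebra.adjoin ℂ
    {x | ∃ a ∈ 𝒜, ∃ g : G, x = crossedElem α ρ a g}).toSubalgebra := hle hx
  rw [hspan] at hx'
  exact hx'

theorem hasBoundedCommutator_of_mem_ccAlgebra {l : G → ℝ} (hdirac : IsDiracWeight l)
    {𝒜 : StarSubalgebra ℂ A} {π : A →⋆ₐ[ℂ] (H →L[ℂ] H)}
    {D : H →ₗ.[ℂ] H} (htriple : IsSpectralTriple 𝒜 π D)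
    {u : G →* unitary (H →L[ℂ] H)} (hequiv : IsGroupEquivariant α π D u)
    {σ : crossed α ρ →⋆ₐ[ℂ] (Hhat G H →L[ℂ] Hhat G H)}
    (hσ : ∀ (a : A) (g : G), σ (crossedElem α ρ a g) = pi2Hat G π a * gammaHat u g)
    {b : crossed α ρ} (hb : b ∈ ccAlgebra α ρ 𝒜) :
    HasBoundedCommutator (Dhat l D) (σ b) := by
  have hle : ccAlgebra α ρ 𝒜 ≤
      (commutatorAlgebra (Dhat l D) (isSelfAdjoint_Dhat htriple.selfAdjoint l)).comap σ := by
    refine ccAlgebra_le fun a ha g => ?_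
    change HasBoundedCommutator (Dhat l D) (σ (crossedElem α ρ a g))
    rw [hσ, pi2Hat_mul_gammaHat]
    exact hasBoundedCommutator_tens hdirac
      ((htriple.commutator a ha).mul (hequiv.commutator g)) g
  exact hle hb

theorem star_chiHat : star (chiHat G H) = chiHat G H := by
  change star (ampl G (dsum 1 (-1))) = ampl G (dsum (1 : H →L[ℂ] H) (-1))
  rw [star_ampl, star_dsum, star_neg, star_one]

theorem chiHat_mul_self : chiHat G H * chiHat G H = 1 := by
  ext ψ : 1
  refine L2.ext fun g => Dbl.ext rfl ?_
  exact neg_neg _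

theorem pi2Hat_mul_gammaHat_mul_chiHat (π : A →⋆ₐ[ℂ] (H →L[ℂ] H))
    (u : G →* unitary (H →L[ℂ] H)) (a : A) (g : G) :
    pi2Hat G π a * gammaHat u g * chiHat G H = chiHat G H * (pi2Hat G π a * gammaHat u g) := by
  rw [pi2Hat_mul_gammaHat]
  ext ψ : 1
  refine L2.ext fun h => Dbl.ext rfl ?_
  exact map_neg (π a * (u g : H →L[ℂ] H)) (ψ (g⁻¹ * h)).snd

theorem exists_Dhat_chiHat (l : G → ℝ) (D : H →ₗ.[ℂ] H) (ψ : (Dhat l D).domain) :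
    ∃ h : chiHat G H (ψ : Hhat G H) ∈ (Dhat l D).domain,
      Dhat l D ⟨chiHat G H (ψ : Hhat G H), h⟩ = -chiHat G H (Dhat l D ψ) := by
  refine exists_Dhat_eq fun g => ?_
  have hx := mem_Dhat_domain_apply ψ.2 g
  have hx₁ : ((ψ : Hhat G H) g).fst ∈ D.domain := hx.1
  have hx₂ : ((ψ : Hhat G H) g).snd ∈ D.domain := hx.2
  refine ⟨⟨hx₁, neg_mem hx₂⟩, Dbl.ext ?_ ?_⟩
  · change D ⟨-((ψ : Hhat G H) g).snd, neg_mem hx₂⟩ -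
      (Complex.I * l g) • (-((ψ : Hhat G H) g).snd) =
        -(D ⟨((ψ : Hhat G H) g).snd, hx₂⟩ - (Complex.I * l g) • ((ψ : Hhat G H) g).snd)
    have : D ⟨-((ψ : Hhat G H) g).snd, neg_mem hx₂⟩ = -D ⟨((ψ : Hhat G H) g).snd, hx₂⟩ :=
      D.map_neg ⟨_, hx₂⟩
    rw [this]
    module
  · exact (neg_neg _).symm

theorem isEvenSpectralTriple_dual {l : G → ℝ} (hproper : IsProperWeight l)
    (hdirac : IsDiracWeight l) {𝒜 : StarSubalgebra ℂ A} {π : A →⋆ₐ[ℂ] (H →L[ℂ] H)}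
    {D : H →ₗ.[ℂ] H} (htriple : IsSpectralTriple 𝒜 π D)
    {u : G →* unitary (H →L[ℂ] H)} (hequiv : IsGroupEquivariant α π D u)
    {σ : crossed α ρ →⋆ₐ[ℂ] (Hhat G H →L[ℂ] Hhat G H)}
    (hσ : ∀ (a : A) (g : G), σ (crossedElem α ρ a g) = pi2Hat G π a * gammaHat u g) :
    IsEvenSpectralTriple (ccAlgebra α ρ 𝒜) σ (Dhat l D) (chiHat G H) where
  dense := dense_ccAlgebra htriple.dense
  dense_domain := dense_Dhat_domain htriple.dense_domain l
  selfAdjoint := isSelfAdjoint_Dhat htriple.selfAdjoint l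
  compact := exists_invSqrt_Dhat hproper htriple.selfAdjoint htriple.compact
  commutator := fun _ hb => hasBoundedCommutator_of_mem_ccAlgebra hdirac htriple hequiv hσ hb
  grading_selfAdjoint := star_chiHat
  grading_sq := chiHat_mul_self
  grading_comm := commute_of_crossedElem σ (chiHat G H) fun a g => by
    rw [hσ]
    exact pi2Hat_mul_gammaHat_mul_chiHat π u a g
  grading_anticomm :=
    ⟨fun ψ => (exists_Dhat_chiHat l D ψ).1, fun ψ => (exists_Dhat_chiHat l D ψ).2⟩

/-! ### Equivariance with respect to the dual coaction -/

theorem mulHom_comp_mulL {Y : Type*} [NormedAddCommGroup Y] [InnerProductSpace ℂ Y]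
    [CompleteSpace Y] (T : L2 G Y →L[ℂ] L2 G Y) :
    mulHom G Y T ∘L mulL G Y = mulL G Y ∘L ampl G T := by
  ext ψ : 1
  simp [mulHom_apply]

/-- An operator on `X ⊗ ℓ²(G) ⊗ C⋆_r(G)` that multiplies the tensors `ζ ⊗ δ_g ⊗ c` in the last
factor leaves the graph of `D̂ ⊗ 1` invariant. -/
theorem amplGraph_Dhat_invariant {l : G → ℝ} {D : H →ₗ.[ℂ] H}
    (e : hmod G (Hhat G H) →L[ℂ] hmod G (Hhat G H)) (m : G → Cr G)
    (he : ∀ g (ζ : Dbl H) c, e (elem (deltaVec g ζ) c) = elem (deltaVec g ζ) (m g * c))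
    {p : hmod G (Hhat G H) × hmod G (Hhat G H)} (hp : p ∈ amplGraph G (Dhat l D)) :
    (e p.1, e p.2) ∈ amplGraph G (Dhat l D) := by
  have hle : amplGraph G (Dhat l D) ≤ (amplGraph G (Dhat l D)).comap (e.prodMap e).toLinearMap := by
    refine Submodule.topologicalClosure_minimal _ (Submodule.span_le.2 ?_)
      ((Submodule.isClosed_topologicalClosure _).preimage (e.prodMap e).continuous)
    rintro _ ⟨ξ, c, rfl⟩
    let F := (e ∘L elemL (Hhat G H) c).prodMap (e ∘L elemL (Hhat G H) c)
    have hF : HasSum _ (F ((ξ : Hhat G H), Dhat l D ξ)) := F.hasSum (hasSum_Dhat ξ)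
    refine (Submodule.isClosed_topologicalClosure _).mem_of_tendsto hF
      (Filter.Eventually.of_forall fun s => ?_)
    -- On a single fibre `e` changes only the algebra factor `c`, so both coordinates still form a
    -- generator of the graph.
    refine Submodule.sum_mem (amplGraph G (Dhat l D)) fun g _ => ?_
    obtain ⟨h₁, h₂⟩ := exists_Dhat_deltaVec l D g ⟨_, mem_Dhat_domain_apply ξ.2 g⟩
    refine Submodule.le_topologicalClosure _ (Submodule.subset_span ⟨⟨_, h₁⟩, m g * c, ?_⟩)
    rw [h₂]
    exact Prod.ext (he g _ c) (he g _ c)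
  exact hle hp

theorem corepU_mem_amplGraph_iff {l : G → ℝ} {D : H →ₗ.[ℂ] H} (S T : hmod G (Hhat G H)) :
    (corepU G (Dbl H) S, corepU G (Dbl H) T) ∈ amplGraph G (Dhat l D) ↔
      (S, T) ∈ amplGraph G (Dhat l D) := by
  refine ⟨fun h => ?_, fun h => ?_⟩
  · have := amplGraph_Dhat_invariant (p := (corepU G (Dbl H) S, corepU G (Dbl H) T))
      ((corepU G (Dbl H)).symm : hmod G (Hhat G H) →L[ℂ] hmod G (Hhat G H)) (fun g => lam g⁻¹)
      (fun g ζ c => corepU_symm_elem_deltaVec g ζ c) h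
    change ((corepU G (Dbl H)).symm (corepU G (Dbl H) S),
      (corepU G (Dbl H)).symm (corepU G (Dbl H) T)) ∈ amplGraph G (Dhat l D) at this
    rwa [LinearIsometryEquiv.symm_apply_apply, LinearIsometryEquiv.symm_apply_apply] at this
  · exact amplGraph_Dhat_invariant
      (corepU G (Dbl H) : hmod G (Hhat G H) →L[ℂ] hmod G (Hhat G H)) lam
      (fun g ζ c => corepU_elem_deltaVec g ζ c) h

theorem norm_modAmpl_le (T : X →L[ℂ] X) (S : hmod G X) : ‖modAmpl T S‖ ≤ ‖T‖ * ‖S‖ :=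
  (ContinuousLinearMap.opNorm_comp_le _ _).trans
    (mul_le_mul_of_nonneg_right (ampl_norm_le T) (norm_nonneg _))

theorem comp_comp_comm {Y : Type*} [NormedAddCommGroup Y] [InnerProductSpace ℂ Y]
    {P Q : X →L[ℂ] X} (h : P * Q = Q * P) (S : Y →L[ℂ] X) : P ∘L Q ∘L S = Q ∘L P ∘L S := by
  ext y
  exact DFunLike.congr_fun h (S y)

/-- On generators the conjugated operator is `σ(a δ_g) ⊗ λ_g`, which visibly commutes with `c ⊗ 1`.
The multiplicative unitary itself need not commute with `c ⊗ 1`. -/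
theorem mulHom_mul_ampl_of_commute {π : A →⋆ₐ[ℂ] (H →L[ℂ] H)} {u : G →* unitary (H →L[ℂ] H)}
    {σ : crossed α ρ →⋆ₐ[ℂ] (Hhat G H →L[ℂ] Hhat G H)}
    (hσ : ∀ (a : A) (g : G), σ (crossedElem α ρ a g) = pi2Hat G π a * gammaHat u g)
    {c : Hhat G H →L[ℂ] Hhat G H} (hc : ∀ b, σ b * c = c * σ b) (b : crossed α ρ) :
    mulHom G (Dbl H) (σ b) * ampl G c = ampl G c * mulHom G (Dbl H) (σ b) := by
  refine commute_of_crossedElem (X := L2 G (Hhat G H)) ((mulHom G (Dbl H)).comp σ) (ampl G c)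
    (fun a g => ?_) b
  have h := hc (crossedElem α ρ a g)
  rw [StarAlgHom.comp_apply]
  rw [hσ, pi2Hat_mul_gammaHat] at h ⊢
  rw [mulHom_tens]
  have h₁ : ampl G c = tens c (1 : G) := by
    ext ψ : 1
    exact L2.ext fun k => by simp
  rw [h₁, tens_mul, tens_mul, h, mul_one, one_mul]

theorem implements_dual {l : G → ℝ} {π : A →⋆ₐ[ℂ] (H →L[ℂ] H)} {D : H →ₗ.[ℂ] H}
    {u : G →* unitary (H →L[ℂ] H)}
    {σ : crossed α ρ →⋆ₐ[ℂ] (Hhat G H →L[ℂ] Hhat G H)}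
    (hσ : ∀ (a : A) (g : G), σ (crossedElem α ρ a g) = pi2Hat G π a * gammaHat u g)
    {θ : crossed α ρ →⋆ₐ[ℂ] tensorCr G (crossed α ρ)}
    (hθ : ∀ (a : A) (g : G), θ (crossedElem α ρ a g) = tensorElem (crossedElem α ρ a g) g) :
    Implements θ σ (Dhat l D) (chiHat G H) (corep G (Dbl H)).toLinearMap where
  corep := isUnitaryCorep_corep
  equivariant := by
    obtain ⟨Φ, hΦ⟩ := exists_tensorCr_hom (G := G) (crossed α ρ) (isClosed_crossed α ρ) σ
    -- Acting by `θ b` through `σ ⊗ id` is conjugating `σ b ⊗ 1` with the multiplicative unitary,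
    -- which turns equivariance into `mulHom_comp_mulL`.
    have key : starHomL (Φ.comp θ) = starHomL ((mulHom G (Dbl H)).comp σ) := by
      refine crossed_hom_ext fun a g => ?_
      rw [starHomL_apply, starHomL_apply, StarAlgHom.comp_apply, StarAlgHom.comp_apply, hθ, hΦ,
        hσ, pi2Hat_mul_gammaHat, mulHom_tens]
    -- `Θ` is bounded and everywhere defined, so the whole space serves as the equivariant module.
    refine ⟨⊤, dense_univ, fun _ _ _ => Submodule.mem_top, Φ, hΦ, fun b x => ?_⟩
    have hb : Φ (θ b) = mulHom G (Dbl H) (σ b) := DFunLike.congr_fun key b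
    rw [hb]
    change mulL G (Dbl H) ∘L leftVec G (σ b x) =
      mulHom G (Dbl H) (σ b) ∘L mulL G (Dbl H) ∘L leftVec G x
    rw [← ContinuousLinearMap.comp_assoc, mulHom_comp_mulL, ContinuousLinearMap.comp_assoc,
      ampl_comp_leftVec]
  operator := by
    refine ⟨corepU G (Dbl H), isOperatorForm_corepU, corepU_mem_amplGraph_iff, fun S => ?_,
      fun b φ hφ => ?_⟩
    · refine Subtype.ext ?_
      ext ψ : 1
      rfl
    · let F : hmod G (Hhat G H) →ₗ[ℂ] hmod G (Hhat G H) :=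
        (corepU G (Dbl H)).toLinearEquiv.toLinearMap ∘ₗ modAmpl (σ b) ∘ₗ
          (corepU G (Dbl H)).symm.toLinearEquiv.toLinearMap
      obtain ⟨R, hR⟩ := exists_isSlice hφ F (norm_nonneg (σ b)) fun S => by
        refine ((corepU G (Dbl H)).norm_map _).le.trans ((norm_modAmpl_le _ _).trans ?_)
        rw [LinearEquiv.coe_coe, LinearIsometryEquiv.coe_toLinearEquiv,
          LinearIsometryEquiv.norm_map]
      refine ⟨R, ?_, hR⟩
      rw [Set.mem_centralizer_iff]
      intro c hc
      refine hR.commute fun S => Subtype.ext ?_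
      have h := mulHom_mul_ampl_of_commute hσ (fun b => hc (σ b) ⟨b, rfl⟩) b
      exact comp_comp_comm h (S : L2 G ℂ →L[ℂ] L2 G (Hhat G H))

end Triple

end CrossedTriple

end

/-! ### The theorem. -/

open CrossedTriple in
theorem proposition3p5
    {A : Type*} [CStarAlgebra A] {G : Type*} [Group G]
    {H : Type*} [NormedAddCommGroup H] [InnerProductSpace ℂ H] [CompleteSpace H]
    {K : Type*} [NormedAddCommGroup K] [InnerProductSpace ℂ K] [CompleteSpace K]
    (α : G →* (A ≃⋆ₐ[ℂ] A)) (l : G → ℝ) (hproper : IsProperWeight l) (hdirac : IsDiracWeight l)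
    (𝒜 : StarSubalgebra ℂ A) (π : A →⋆ₐ[ℂ] (H →L[ℂ] H)) (D : H →ₗ.[ℂ] H)
    (htriple : IsSpectralTriple 𝒜 π D)
    (u : G →* unitary (H →L[ℂ] H)) (hequiv : IsGroupEquivariant α π D u)
    (ρ : A →⋆ₐ[ℂ] (K →L[ℂ] K)) (hρ : Function.Injective ρ) :
    ∃ (σ : crossed α ρ →⋆ₐ[ℂ] (Hhat G H →L[ℂ] Hhat G H))
      (θ : crossed α ρ →⋆ₐ[ℂ] tensorCr G (crossed α ρ))
      (Θ : Hhat G H →ₗ[ℂ] hmod G (Hhat G H)),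
      (∀ (a : A) (g : G), σ (crossedElem α ρ a g) = pi2Hat G π a * gammaHat u g) ∧
      IsEvenSpectralTriple (ccAlgebra α ρ 𝒜) σ (Dhat l D) (chiHat G H) ∧
      ((∀ g, ∀ a ∈ 𝒜, α g a ∈ 𝒜) →
        (ccAlgebra α ρ 𝒜 : Set (crossed α ρ)) = ccSpace α ρ 𝒜) ∧
      (∀ (a : A) (g : G), θ (crossedElem α ρ a g) = tensorElem (crossedElem α ρ a g) g) ∧
      IsCoaction (crossed α ρ) θ ∧
      (∀ (ζ : Dbl H) (g : G), Θ (deltaVec g ζ) = elem (deltaVec g ζ) (lam g)) ∧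
      Implements θ σ (Dhat l D) (chiHat G H) Θ := by
  obtain ⟨σ, hσ⟩ := exists_covariant_hom hρ π u hequiv.covariant
  obtain ⟨θ, hθ⟩ := exists_dual_coaction α ρ
  exact ⟨σ, θ, (corep G (Dbl H)).toLinearMap, hσ,
    isEvenSpectralTriple_dual hproper hdirac htriple hequiv hσ, ccAlgebra_eq_ccSpace, hθ,
    isCoaction_of_apply_crossedElem α ρ θ hθ, fun ζ g => corep_deltaVec g ζ,
    implements_dual hσ hθ⟩
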